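/- **Definitions.** A *cone* is an abelian monoid $(C,+,0)$ with a scalar multiplication $(0,\infty)\times C\to C$, $(t,x)\mapsto tx$, additive in each variable and satisfying $s(tx)=(st)x$ and $1x=x$. Its algebraic pre-order is: $x\le y$ iff $x+z=y$ for some $z\in C$. An *extended Choquet cone* is a cone $C$ with a topology such that: addition and multiplication by positive scalars are jointly continuous; the algebraic pre-order is a partial order for which $C$ is a lattice, with $x+(y\wedge z)=(x+y)\wedge(x+z)$ and $x+(y\vee z)=(x+y)\vee(x+z)$ for all $x,y,z$; and the topology is compact, Hausdorff and has a basis of open convex sets. A complete lattice is *algebraic* if each of its elements is a supremum of compact elements. $C$ has an *abundance of compact idempotents* if $\mathrm{Idem}(C)=\{w\in C: 2w=w\}$ is an algebraic lattice under the opposite of the algebraic order. For a positively ordered monoid $S$ (a partially ordered abelian monoid with translation-invariant order and $0\le x$ for all $x$), write $x\ll y$ if for every increasing sequence $(y_n)$ in $S$ that has a supremum with $y\le\sup_n y_n$ there is $n_0$ with $x\le y_{n_0}$. $S$ is a *Cu-semigroup* if (O1) increasing sequences have suprema; (O2) every $x$ is $\sup_n x_n$ for some sequence with $x_n\ll x_{n+1}$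 for all $n$; (O3) $\sup_n(x_n+y_n)=\sup_n x_n+\sup_n y_n$ for increasing sequences; (O4) $x_i\ll y_i$ ($i=1,2$) implies $x_1+x_2\ll y_1+y_2$. A *Cu-cone* is a Cu-semigroup that is also a cone (with the same addition), such that $t_1\le t_2$ and $s_1\le s_2$ imply $t_1s_1\le t_2s_2$, and $\sup_n t_ns_n=(\sup_n t_n)(\sup_n s_n)$ for increasing sequences $(t_n)$ in $(0,\infty)$ with $\sup_n t_n<\infty$ and $(s_n)$ in $S$. Further axioms: (O5) if $x'\ll x\le y$ there is $z$ with $x'+z\le y\le x+z$; (O6) if $x\le y+z$ and $x'\ll x$, there are $y',z'$ with $x'\le y'+z'$, $y'\le x,y$ and $z'\le x,z$. An *ideal* of a Cu-cone is a hereditary (downward closed) subcone containing $0$ and closed under suprema of increasing sequences; $S$ has an *abundance of compact ideals* if its lattice of ideals, ordered by inclusion, is algebraic. $F(S)$ denotes the cone of *functionals* on $S$, that is, of order preserving monoid maps $\lambda\colon S\to[0,\infty]$ that preserve suprema of increasing sequences, with pointwise operations and the topology in which $\lambda_i\to\lambda$ iff $\limsup_i\lambda_i(s')\le\lambda(s)\le\liminf_i\lambda_i(s)$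 for all $s'\ll s$ in $S$. For a Hausdorff topological cone $C$, $\mathrm{Lsc}_\sigma(C)$ denotes the set of functions $f\colon C\to[0,\infty]$ that are linear (additive, homogeneous under positive scalars, $f(0)=0$) and lower semicontinuous and for which $f^{-1}((a,\infty])$ is $\sigma$-compact for every $a\in[0,\infty)$, with pointwise operations and order. **Theorem.** (1) Let $S$ be a Cu-cone satisfying O5 and O6 and having an abundance of compact ideals. Then $F(S)$ is an extended Choquet cone with an abundance of compact idempotents. Moreover, $s\mapsto\hat s$, where $\hat s(\lambda)=\lambda(s)$ for $\lambda\in F(S)$, is an isomorphism of Cu-cones (a linear bijection that is an order isomorphism) from $S$ onto $\mathrm{Lsc}_\sigma(F(S))$. (2) Let $C$ be an extended Choquet cone with an abundance of compact idempotents. Then $\mathrm{Lsc}_\sigma(C)$ is a Cu-cone satisfying O5 and O6 and having an abundance of compact ideals. Moreover, $x\mapsto\hat x$, where $\hat x(f)=f(x)$ for $f\in\mathrm{Lsc}_\sigma(C)$, is an isomorphism of extended Choquet cones (a linear homeomorphism) from $C$ onto $F(\mathrm{Lsc}_\sigma(C))$. -/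

import Mathlib

open Set Filter Topology
open scoped NNReal ENNReal

universe u v

/- Cones. A cone is a commutative monoid with an action of the positive reals that is additive in
both variables. Setting `0 • x = 0` extends such an action, in exactly one way, to a module
structure over the semiring `ℝ≥0`, and every `ℝ≥0`-module arises in this way; so cones are
`ℝ≥0`-modules. Continuity of scalar multiplication is only ever required at positive scalars. -/

section AlgebraicOrder

variable {C : Type*} [AddCommMonoid C]

/-- The algebraic pre-order of a commutative monoid. -/
def AlgLE (x y : C) : Prop := ∃ z, x + z = y

/-- `m` is the infimum of `x` and `y` for the algebraic pre-order. -/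
def IsAlgInf (x y m : C) : Prop :=
  AlgLE m x ∧ AlgLE m y ∧ ∀ z, AlgLE z x → AlgLE z y → AlgLE z m

/-- `m` is the supremum of `x` and `y` for the algebraic pre-order. -/
def IsAlgSup (x y m : C) : Prop :=
  AlgLE x m ∧ AlgLE y m ∧ ∀ z, AlgLE x z → AlgLE y z → AlgLE m z

end AlgebraicOrder

/-- Extended Choquet cones: algebraically ordered topological cones that are lattices with addition
distributing over infima and suprema, and whose topology is compact, Hausdorff and has a basis of
open convex sets. -/
class IsExtendedChoquetCone (C : Type*) [AddCommMonoid C] [Module ℝ≥0 C] [TopologicalSpace C] :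
    Prop extends CompactSpace C, T2Space C, ContinuousAdd C where
  algLE_antisymm : ∀ x y : C, AlgLE x y → AlgLE y x → x = y
  continuousOn_smul : ContinuousOn (fun p : ℝ≥0 × C => p.1 • p.2) {p | 0 < p.1}
  exists_inf : ∀ x y : C, ∃ m, IsAlgInf x y m
  exists_sup : ∀ x y : C, ∃ m, IsAlgSup x y m
  add_inf : ∀ x y z m : C, IsAlgInf y z m → IsAlgInf (x + y) (x + z) (x + m)
  add_sup : ∀ x y z m : C, IsAlgSup y z m → IsAlgSup (x + y) (x + z) (x + m)
  locallyConvex : ∃ B : Set (Set C), TopologicalSpace.IsTopologicalBasis B ∧ ∀ U ∈ B, Convex ℝ≥0 U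

/-- The idempotents of a cone: the elements `w` with `2w = w`. -/
def Idem (C : Type*) [AddCommMonoid C] : Type _ := {w : C // w + w = w}

/-- `Idem C` carries the algebraic order of `C`, which is always antisymmetric on idempotents. -/
instance Idem.instPartialOrder (C : Type*) [AddCommMonoid C] : PartialOrder (Idem C) where
  le v w := AlgLE v.1 w.1
  le_refl v := ⟨0, add_zero _⟩
  le_trans := by
    rintro a b c ⟨x, hx⟩ ⟨y, hy⟩
    exact ⟨x + y, by rw [← hy, ← hx, add_assoc]⟩
  le_antisymm := by
    rintro ⟨a, ha⟩ ⟨b, hb⟩ ⟨x, hx⟩ ⟨y, hy⟩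
    apply Subtype.ext
    dsimp only at *
    have h1 : a + b = b := by
      calc a + b = (a + a) + x := by rw [← hx, add_assoc]
        _ = b := by rw [ha, hx]
    have h2 : a + b = a := by
      calc a + b = (b + b) + y := by rw [← hy]; abel
        _ = a := by rw [hb, hy]
    rw [← h1, h2]

/-- A complete lattice is algebraic if each of its elements is a supremum of compact elements. -/
def IsAlgebraicLattice (L : Type*) [PartialOrder L] : Prop :=
  (∀ A : Set L, ∃ u, IsLUB A u) ∧
    ∀ x : L, ∃ K : Set L, (∀ k ∈ K, IsCompactElement k) ∧ IsLUB K x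

/-- Abundance of compact idempotents: the idempotents form an algebraic lattice under the opposite
of the algebraic order. -/
def HasAbundanceOfCompactIdempotents (C : Type*) [AddCommMonoid C] : Prop :=
  IsAlgebraicLattice (Idem C)ᵒᵈ

section Cu

/-- The sequential way-below relation `a ≪ b`. -/
def SeqWayBelow {S : Type*} [PartialOrder S] (a b : S) : Prop :=
  ∀ (y : ℕ → S) (z : S), Monotone y → IsLUB (range y) z → b ≤ z → ∃ n, a ≤ y n

theorem SeqWayBelow.le {S : Type*} [PartialOrder S] {a b : S} (h : SeqWayBelow a b) : a ≤ b := by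
  obtain ⟨_, h⟩ := h (fun _ => b) b monotone_const (by simp) le_rfl
  exact h

theorem SeqWayBelow.trans_le {S : Type*} [PartialOrder S] {a b c : S} (h : SeqWayBelow a b) (h' : b ≤ c) :
    SeqWayBelow a c := fun y z hy hz hc => h y z hy hz (h'.trans hc)

theorem SeqWayBelow.of_le {S : Type*} [PartialOrder S] {a b c : S} (h : a ≤ b) (h' : SeqWayBelow b c) :
    SeqWayBelow a c := fun y z hy hz hc => by
  obtain ⟨n, hn⟩ := h' y z hy hz hc
  exact ⟨n, h.trans hn⟩

/-- Cu-semigroups: positively ordered monoids satisfying the axioms O1-O4. -/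
class CuSemigroup (S : Type*) [AddCommMonoid S] [PartialOrder S] : Prop
    extends IsOrderedAddMonoid S where
  zero_le' : ∀ x : S, 0 ≤ x
  o1 : ∀ x : ℕ → S, Monotone x → ∃ y, IsLUB (range x) y
  o2 : ∀ x : S, ∃ a : ℕ → S, (∀ n, SeqWayBelow (a n) (a (n + 1))) ∧ IsLUB (range a) x
  o3 : ∀ (x y : ℕ → S) (a b : S), Monotone x → Monotone y → IsLUB (range x) a →
    IsLUB (range y) b → IsLUB (range fun n => x n + y n) (a + b)
  o4 : ∀ x₁ x₂ y₁ y₂ : S, SeqWayBelow x₁ y₁ → SeqWayBelow x₂ y₂ →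
    SeqWayBelow (x₁ + x₂) (y₁ + y₂)

/-- Cu-cones: Cu-semigroups with a compatible multiplication by positive scalars. -/
class CuCone (S : Type*) [AddCommMonoid S] [PartialOrder S] [Module ℝ≥0 S] : Prop
    extends CuSemigroup S where
  smul_le_smul' : ∀ (t₁ t₂ : ℝ≥0) (s₁ s₂ : S), 0 < t₁ → t₁ ≤ t₂ → s₁ ≤ s₂ → t₁ • s₁ ≤ t₂ • s₂
  isLUB_smul : ∀ (t : ℕ → ℝ≥0) (s : ℕ → S) (t₀ : ℝ≥0) (s₀ : S), (∀ n, 0 < t n) → Monotone t →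
    Monotone s → IsLUB (range t) t₀ → IsLUB (range s) s₀ →
    IsLUB (range fun n => t n • s n) (t₀ • s₀)

/-- Axiom O5. -/
def AxiomO5 (S : Type*) [AddCommMonoid S] [PartialOrder S] : Prop :=
  ∀ x' x y : S, SeqWayBelow x' x → x ≤ y → ∃ z, x' + z ≤ y ∧ y ≤ x + z

/-- Axiom O6. -/
def AxiomO6 (S : Type*) [AddCommMonoid S] [PartialOrder S] : Prop :=
  ∀ x y z : S, x ≤ y + z → ∀ x', SeqWayBelow x' x →
    ∃ y' z', x' ≤ y' + z' ∧ y' ≤ x ∧ y' ≤ y ∧ z' ≤ x ∧ z' ≤ z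

/-- The ideals of a Cu-cone: the subcones that are hereditary (order ideals) and closed under
suprema of increasing sequences, ordered by inclusion. -/
def CuIdeal (S : Type*) [AddCommMonoid S] [PartialOrder S] [Module ℝ≥0 S] : Type _ :=
  {I : Submodule ℝ≥0 S // (∀ x y, x ≤ y → y ∈ I → x ∈ I) ∧
    ∀ (x : ℕ → S) (y : S), Monotone x → (∀ n, x n ∈ I) → IsLUB (range x) y → y ∈ I}

instance CuIdeal.instPartialOrder (S : Type*) [AddCommMonoid S] [PartialOrder S]
    [Module ℝ≥0 S] : PartialOrder (CuIdeal S) :=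
  PartialOrder.lift (fun I => I.1) Subtype.val_injective

/-- Abundance of compact ideals: the lattice of ideals is algebraic. -/
def HasAbundanceOfCompactIdeals (S : Type*) [AddCommMonoid S] [PartialOrder S]
    [Module ℝ≥0 S] : Prop :=
  IsAlgebraicLattice (CuIdeal S)

end Cu

section FunctionalCone

variable (S : Type*) [AddCommMonoid S] [PartialOrder S]

/-- The functionals, as a subcone (with pointwise operations) of the additive maps
`S → [0, ∞]`: they are monotone and preserve suprema of increasing sequences. -/
def functionalSubmodule : Submodule ℝ≥0 (S →+ ℝ≥0∞) where
  carrier := {l | Monotone l ∧ ∀ (x : ℕ → S) (y : S), Monotone x → IsLUB (range x) y →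
    IsLUB (range fun n => l (x n)) (l y)}
  zero_mem' := ⟨fun _ _ _ => le_rfl, fun x y _ _ => by simp⟩
  add_mem' := by
    rintro a b ⟨ha, ha'⟩ ⟨hb, hb'⟩
    refine ⟨fun x y h => add_le_add (ha h) (hb h), fun x y hx hy => ?_⟩
    have h1 := (ha' x y hx hy).iSup_eq
    have h2 := (hb' x y hx hy).iSup_eq
    have h3 := ENNReal.iSup_add_iSup_of_monotone (ha.comp hx) (hb.comp hx)
    change (⨆ n, a (x n)) + (⨆ n, b (x n)) = ⨆ n, (a (x n) + b (x n)) at h3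
    rw [h1, h2] at h3
    simp only [AddMonoidHom.add_apply]
    rw [h3]
    exact isLUB_iSup
  smul_mem' := by
    rintro t a ⟨ha, ha'⟩
    refine ⟨fun x y h => ?_, fun x y hx hy => ?_⟩
    · simp only [AddMonoidHom.smul_apply, ENNReal.smul_def, smul_eq_mul]
      gcongr
      exact ha h
    · have h1 := (ha' x y hx hy).iSup_eq
      simp only [AddMonoidHom.smul_apply, ENNReal.smul_def, smul_eq_mul]
      rw [← h1, ENNReal.mul_iSup]
      exact isLUB_iSup

/-- The cone `F(S)` of functionals on `S`. -/
def FunctionalCone : Type _ := functionalSubmodule S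

namespace FunctionalCone

noncomputable instance instAddCommMonoid : AddCommMonoid (FunctionalCone S) :=
  inferInstanceAs (AddCommMonoid (functionalSubmodule S))

noncomputable instance instModule : Module ℝ≥0 (FunctionalCone S) :=
  inferInstanceAs (Module ℝ≥0 (functionalSubmodule S))

instance instFunLike : FunLike (FunctionalCone S) S ℝ≥0∞ where
  coe l := l.1
  coe_injective _ _ h := Subtype.ext (DFunLike.coe_injective h)

/-- The topology of `F(S)`. For a Cu-semigroup it is the one for which `l i → l` if and only if
`limsup l i s' ≤ l s ≤ liminf l i s` for all `s' ≪ s`: see `FunctionalCone.tendsto_iff`. -/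
instance instTopologicalSpace : TopologicalSpace (FunctionalCone S) :=
  TopologicalSpace.generateFrom
    ({U | ∃ (s : S) (a : ℝ≥0∞), U = {l : FunctionalCone S | a < l s}} ∪
      {U | ∃ (s' : S) (a : ℝ≥0∞),
        U = {l : FunctionalCone S | ∃ s, SeqWayBelow s' s ∧ l s < a}})

variable {S}

theorem isOpen_lt (s : S) (a : ℝ≥0∞) : IsOpen {l : FunctionalCone S | a < l s} :=
  TopologicalSpace.isOpen_generateFrom_of_mem (Or.inl ⟨s, a, rfl⟩)

theorem isOpen_gt (s' : S) (a : ℝ≥0∞) :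
    IsOpen {l : FunctionalCone S | ∃ s, SeqWayBelow s' s ∧ l s < a} :=
  TopologicalSpace.isOpen_generateFrom_of_mem (Or.inr ⟨s', a, rfl⟩)

theorem mono (l : FunctionalCone S) : Monotone l := l.2.1

end FunctionalCone

variable {S}

theorem SeqWayBelow.exists_between [CuSemigroup S] {a c : S} (h : SeqWayBelow a c) :
    ∃ b, SeqWayBelow a b ∧ SeqWayBelow b c := by
  obtain ⟨x, hx, hl⟩ := CuSemigroup.o2 c
  obtain ⟨n, hn⟩ := h x c (monotone_nat_of_le_succ fun n => (hx n).le) hl le_rfl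
  exact ⟨x (n + 1), (hx n).of_le hn, (hx (n + 1)).trans_le (hl.1 ⟨_, rfl⟩)⟩

theorem FunctionalCone.exists_lt_of_lt [CuSemigroup S] (l : FunctionalCone S) {s : S} {a : ℝ≥0∞}
    (h : a < l s) : ∃ s', SeqWayBelow s' s ∧ a < l s' := by
  obtain ⟨x, hx, hl⟩ := CuSemigroup.o2 s
  have h1 := l.2.2 x s (monotone_nat_of_le_succ fun n => (hx n).le) hl
  obtain ⟨_, ⟨n, rfl⟩, hn⟩ := (lt_isLUB_iff h1).1 h
  exact ⟨x n, (hx n).trans_le (hl.1 ⟨_, rfl⟩), hn⟩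

theorem FunctionalCone.tendsto_iff [CuSemigroup S] {ι : Type*} (f : Filter ι)
    (l : ι → FunctionalCone S) (l₀ : FunctionalCone S) :
    Tendsto l f (𝓝 l₀) ↔ ∀ s' s : S, SeqWayBelow s' s →
      limsup (fun i => l i s') f ≤ l₀ s ∧ l₀ s ≤ liminf (fun i => l i s) f := by
  constructor
  · intro h s' s hs
    constructor
    · refine le_of_forall_gt_imp_ge_of_dense fun a ha => ?_
      have h1 := h.eventually ((FunctionalCone.isOpen_gt s' a).mem_nhds ⟨s, hs, ha⟩)
      refine limsup_le_of_le (by isBoundedDefault) (h1.mono ?_)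
      rintro i ⟨t, ht, hlt⟩
      exact ((l i).mono ht.le).trans hlt.le
    · refine le_of_forall_lt_imp_le_of_dense fun a ha => ?_
      have h1 := h.eventually ((FunctionalCone.isOpen_lt s a).mem_nhds ha)
      exact le_liminf_of_le (by isBoundedDefault) (h1.mono fun i hi => le_of_lt hi)
  · intro h
    refine TopologicalSpace.tendsto_nhds_generateFrom_iff.2 ?_
    rintro U (⟨s, a, rfl⟩ | ⟨s', a, rfl⟩) hU
    · obtain ⟨s', hs', -⟩ := l₀.exists_lt_of_lt hU
      exact eventually_lt_of_lt_liminf (lt_of_lt_of_le hU (h s' s hs').2)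
    · obtain ⟨s, hs, hlt⟩ := hU
      obtain ⟨t, h1, h2⟩ := hs.exists_between
      refine (eventually_lt_of_limsup_lt (lt_of_le_of_lt (h t s h2).1 hlt)).mono ?_
      exact fun i hi => ⟨t, h1, hi⟩

instance FunctionalCone.instT2Space [CuSemigroup S] : T2Space (FunctionalCone S) := by
  have key : ∀ (l m : FunctionalCone S) (s : S), l s < m s →
      ∃ U V : Set (FunctionalCone S), IsOpen U ∧ IsOpen V ∧ l ∈ U ∧ m ∈ V ∧ Disjoint U V := by
    intro l m s h
    obtain ⟨a, h1, h2⟩ := exists_between h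
    obtain ⟨s', hs', h3⟩ := m.exists_lt_of_lt h2
    refine ⟨_, _, FunctionalCone.isOpen_gt s' a, FunctionalCone.isOpen_lt s' a, ⟨s, hs', h1⟩, h3,
      Set.disjoint_left.2 ?_⟩
    rintro n ⟨t, ht, hlt⟩ hn
    exact absurd (hn.trans_le ((n.mono ht.le).trans hlt.le)) (lt_irrefl _)
  refine ⟨fun l m hne => ?_⟩
  obtain ⟨s, hs⟩ := DFunLike.ne_iff.1 hne
  rcases lt_or_gt_of_ne hs with h | h
  · exact key l m s h
  · obtain ⟨U, V, h1, h2, h3, h4, h5⟩ := key m l s h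
    exact ⟨V, U, h2, h1, h4, h3, h5.symm⟩

end FunctionalCone

section LscSigma

theorem IsSigmaCompact.inter_of_t2 {X : Type*} [TopologicalSpace X] [T2Space X] {s t : Set X}
    (hs : IsSigmaCompact s) (ht : IsSigmaCompact t) : IsSigmaCompact (s ∩ t) := by
  obtain ⟨K, hK, rfl⟩ := hs
  obtain ⟨L, hL, rfl⟩ := ht
  simp only [iUnion_inter, inter_iUnion]
  exact isSigmaCompact_iUnion _ fun i =>
    isSigmaCompact_iUnion_of_isCompact _ fun j => (hK j).inter (hL i)

variable (C : Type*) [AddCommMonoid C] [Module ℝ≥0 C] [TopologicalSpace C]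

/-- `Lsc_σ(C)`: the linear, lower semicontinuous functions `f : C → [0, ∞]` such that
`{x | a < f x}` is σ-compact for every `a ∈ [0, ∞)`, with pointwise operations. -/
def LscSigma [T2Space C] : Submodule ℝ≥0 (C →ₗ[ℝ≥0] ℝ≥0∞) where
  carrier := {f | LowerSemicontinuous f ∧ ∀ a : ℝ≥0, IsSigmaCompact {x | (a : ℝ≥0∞) < f x}}
  zero_mem' := ⟨lowerSemicontinuous_const, fun a => by simp [isSigmaCompact_empty]⟩
  add_mem' := by
    rintro f g ⟨hf, hf'⟩ ⟨hg, hg'⟩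
    refine ⟨hf.add hg, fun a => ?_⟩
    have h : {x | (a : ℝ≥0∞) < (f + g) x} =
        ({x | (a : ℝ≥0∞) < f x} ∪ {x | (a : ℝ≥0∞) < g x}) ∪
        ⋃ p : {p : ℚ × ℚ // a ≤ Real.toNNReal p.1 + Real.toNNReal p.2},
          ({x | ((Real.toNNReal p.1.1 : ℝ≥0) : ℝ≥0∞) < f x} ∩
            {x | ((Real.toNNReal p.1.2 : ℝ≥0) : ℝ≥0∞) < g x}) := by
      ext x
      simp only [mem_ofPred_eq, LinearMap.add_apply, mem_union, mem_iUnion, mem_inter_iff]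
      constructor
      · intro hx
        by_cases h0 : f x = 0
        · exact Or.inl (Or.inr (by simpa [h0] using hx))
        by_cases h1 : g x = 0
        · exact Or.inl (Or.inl (by simpa [h1] using hx))
        obtain ⟨y, hy, z, hz, hyz⟩ := ENNReal.exists_lt_add_of_lt_add hx h0 h1
        obtain ⟨p, -, hp, hp'⟩ := ENNReal.lt_iff_exists_rat_btwn.1 hy
        obtain ⟨q, -, hq, hq'⟩ := ENNReal.lt_iff_exists_rat_btwn.1 hz
        refine Or.inr ⟨⟨(p, q), ?_⟩, hp', hq'⟩
        have := (hyz.trans (ENNReal.add_lt_add hp hq)).le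
        exact_mod_cast this
      · rintro ((h | h) | ⟨⟨⟨p, q⟩, hpq⟩, hp, hq⟩)
        · exact h.trans_le le_self_add
        · exact h.trans_le le_add_self
        · refine lt_of_le_of_lt ?_ (ENNReal.add_lt_add hp hq)
          exact_mod_cast hpq
    have hU : ∀ {A B : Set C}, IsSigmaCompact A → IsSigmaCompact B → IsSigmaCompact (A ∪ B) := by
      intro A B hA hB
      rw [union_eq_iUnion]
      exact isSigmaCompact_iUnion _ fun b => by cases b <;> assumption
    rw [h]
    exact hU (hU (hf' a) (hg' a))
      (isSigmaCompact_iUnion _ fun p => (hf' _).inter_of_t2 (hg' _))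
  smul_mem' := by
    rintro t f ⟨hf, hf'⟩
    rcases eq_or_ne t 0 with rfl | ht
    · simp only [zero_smul]
      exact ⟨lowerSemicontinuous_const, fun a => by simp [isSigmaCompact_empty]⟩
    have key : ∀ (b : ℝ≥0∞) (x : C), b < (t • f) x ↔ b / t < f x := by
      intro b x
      rw [LinearMap.smul_apply, ENNReal.smul_def, smul_eq_mul, mul_comm,
        ENNReal.div_lt_iff (Or.inl (by simpa using ht)) (Or.inl ENNReal.coe_ne_top)]
    refine ⟨fun x b hb => ?_, fun a => ?_⟩
    · exact (hf x _ ((key b x).1 hb)).mono fun y hy => (key b y).2 hy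
    · have h := hf' (a / t)
      rw [ENNReal.coe_div ht] at h
      simpa only [key] using h

/-- The pointwise order on `Lsc_σ(C)`. -/
noncomputable instance LscSigma.instPartialOrder [T2Space C] : PartialOrder (LscSigma C) :=
  PartialOrder.lift (fun f => (f.1 : C → ℝ≥0∞)) fun _ _ h => Subtype.ext (DFunLike.coe_injective h)

end LscSigma

/-! The theorem is a duality, and the point is to produce enough functionals on both sides. Their
algebraic source is a Hahn-Banach theorem for pre-ordered cones (`IsConePreorder.exists_linear`): a
sublinear `[0, ∞]`-valued gauge that is minimal subject to a prescribed slope in one direction is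
additive.

On an extended Choquet cone `C` the functionals must also be continuous. Compactness gives each `x`
a support idempotent `eps x`, the limit of `x / n`; cancellation holds up to supports, and Riesz
decomposition holds. Barycentres in a compact convex subset of a face are unique modulo the
idempotent of that face. No continuous functionals are available yet to see this, so it is proved by
sampling: conditioning independent draws on the cell of a finite cover that contains their mean
changes the averaged weights only slightly (`exists_close_pair`). Uniqueness allows the relations `x
≤ y + 2u`, for pairs `(x, y)` close to the diagonal, to be added to the Hahn-Banach pre-order
without destroying separation, and these relations force continuity on the face. Abundance of
compact idempotents allows the face to be taken open; adding a small multiple of a function that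
blows up at its boundary then gives a continuous extension by `∞`. The outcome is
`exists_continuous_between`: a continuous linear function fits between a compact set and an open set
`{f > 1}` containing it, for `f` linear and lower semicontinuous.

Hence `f ≪ g` in `LscSigma C` means `f ≤ c` and `η c ≤ g` for some continuous `c` and some `η > 1`.
The axioms O1-O4 follow, O5 comes from subtracting `c`, and O6 from infimal convolutions. Continuous
functions separate points, and a functional on `LscSigma C` is a point evaluation by separation in
finite dimensions and compactness.

For a Cu-cone `S`, O5 makes the difference of comparable functionals monotone, and O5 with O6 makes
the positive part of a difference additive. Once regularized, these are the residuals of addition in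
`F(S)`, and they give the lattice structure and its distributivity. Ideals of `S` are the zero sets
of idempotent functionals, which exchanges the two abundance conditions. The map `s ↦ ŝ` is an order
embedding by Hahn-Banach. For surjectivity, if no `ŝ` lay between `a` and `r b`, where `a ≪ b` and
`r > 1`, Hahn-Banach on pairs of functions would give two functionals on `LscSigma (F(S))`; by the
duality for `C = F(S)` they are points of `F(S)`, and comparing these points gives a contradiction.
-/

/-! ### Hahn-Banach for pre-ordered cones. -/

section HahnBanach

variable {P : Type*} [AddCommMonoid P] [Module ℝ≥0 P]

/-- A pre-order on a cone that is compatible with the operations and for which all elements are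
positive. -/
structure IsConePreorder (le : P → P → Prop) : Prop where
  refl : ∀ x, le x x
  trans : ∀ x y z, le x y → le y z → le x z
  add : ∀ x y z, le x y → le (x + z) (y + z)
  smul : ∀ (t : ℝ≥0) (x y), 0 < t → le x y → le (t • x) (t • y)
  nonneg : ∀ x, le 0 x

namespace IsConePreorder

variable {le : P → P → Prop}

theorem le_add_left (h : IsConePreorder le) (x y : P) : le x (y + x) := by
  simpa using h.add 0 y x (h.nonneg y)

theorem le_add_right (h : IsConePreorder le) (x y : P) : le x (x + y) := by
  rw [add_comm]; exact h.le_add_left x y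

theorem add_add (h : IsConePreorder le) {a b c d : P} (h1 : le a b) (h2 : le c d) :
    le (a + c) (b + d) := by
  refine h.trans _ _ _ (h.add _ _ c h1) ?_
  rw [add_comm b c, add_comm b d]
  exact h.add _ _ b h2

end IsConePreorder

/-- Monotone sublinear functions with values in `[0, ∞]`. -/
structure IsSublinearGauge (le : P → P → Prop) (p : P → ℝ≥0∞) : Prop where
  mono : ∀ x y, le x y → p x ≤ p y
  zero : p 0 = 0
  smul_le : ∀ (t : ℝ≥0) (x : P), 0 < t → p (t • x) ≤ t * p x
  add_le : ∀ x y, p (x + y) ≤ p x + p y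

namespace IsSublinearGauge

variable {le : P → P → Prop} {p : P → ℝ≥0∞}

theorem smul_eq (hp : IsSublinearGauge le p) (t : ℝ≥0) (x : P) : p (t • x) = t * p x := by
  rcases eq_or_ne t 0 with rfl | ht
  · simp [hp.zero]
  have htp : 0 < t := pos_iff_ne_zero.2 ht
  refine le_antisymm (hp.smul_le t x htp) ?_
  have h := hp.smul_le t⁻¹ (t • x) (inv_pos.2 htp)
  rw [smul_smul, inv_mul_cancel₀ ht, one_smul] at h
  calc (t : ℝ≥0∞) * p x ≤ t * (((t⁻¹ : ℝ≥0) : ℝ≥0∞) * p (t • x)) := by gcongr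
    _ = p (t • x) := by
      rw [← mul_assoc, ← ENNReal.coe_mul, mul_inv_cancel₀ ht, ENNReal.coe_one, one_mul]

end IsSublinearGauge

/-- The largest modification of `p` below `p` that is additive in the direction of `x`, where it
has slope `κ`. -/
noncomputable def gaugeShear (p : P → ℝ≥0∞) (x : P) (κ : ℝ≥0) (y : P) : ℝ≥0∞ :=
  ⨅ r : ℝ≥0, (p (y + r • x) - r * κ)

section Shear

variable {le : P → P → Prop} {p : P → ℝ≥0∞}

theorem gaugeShear_le (p : P → ℝ≥0∞) (x : P) (κ : ℝ≥0) (y : P) : gaugeShear p x κ y ≤ p y := by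
  refine (iInf_le _ 0).trans ?_
  simp

theorem IsSublinearGauge.mul_le_add (h : IsConePreorder le) (hp : IsSublinearGauge le p) {x : P}
    {κ : ℝ≥0} (hκ : κ ≤ p x) (y : P) (r : ℝ≥0) : (r : ℝ≥0∞) * κ ≤ p (y + r • x) :=
  calc (r : ℝ≥0∞) * κ ≤ r * p x := by gcongr
    _ = p (r • x) := (hp.smul_eq r x).symm
    _ ≤ _ := hp.mono _ _ (h.le_add_left _ _)

theorem IsSublinearGauge.shear (h : IsConePreorder le) (hp : IsSublinearGauge le p) (x : P)
    (κ : ℝ≥0) : IsSublinearGauge le (gaugeShear p x κ) where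
  mono y z hyz := iInf_mono fun r => tsub_le_tsub_right (hp.mono _ _ (h.add _ _ _ hyz)) _
  zero := le_antisymm ((gaugeShear_le p x κ 0).trans hp.zero.le) bot_le
  smul_le t y ht := by
    unfold gaugeShear
    rw [ENNReal.mul_iInf_of_ne (by simpa using ht.ne') ENNReal.coe_ne_top]
    refine le_iInf fun r => (iInf_le _ (t * r)).trans ?_
    rw [mul_smul, ← smul_add, hp.smul_eq, ENNReal.mul_sub (fun _ _ => ENNReal.coe_ne_top)]
    simp [mul_assoc]
  add_le y z := by
    unfold gaugeShear
    refine ENNReal.le_iInf_add_iInf fun r s => ?_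
    refine (iInf_le _ (r + s)).trans ?_
    refine le_trans ?_ add_tsub_add_le_tsub_add_tsub
    have : y + z + (r + s) • x = (y + r • x) + (z + s • x) := by rw [add_smul]; abel
    rw [this]
    push_cast
    rw [add_mul]
    exact tsub_le_tsub_right (hp.add_le _ _) _

/-- Shifting the parameter of the infimum from `r` to `k + r` costs exactly `k * κ`. The bound `κ ≤
p x` ensures that the truncated subtractions do not truncate. -/
theorem gaugeShear_add_le (h : IsConePreorder le) (hp : IsSublinearGauge le p) {x : P}
    {κ : ℝ≥0} (hκ : κ ≤ p x) (y : P) (k : ℝ≥0) :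
    gaugeShear p x κ y + k * κ ≤ gaugeShear p x κ (y + k • x) := by
  refine le_iInf fun r => ?_
  refine (add_le_add_left (iInf_le _ (k + r)) _).trans ?_
  have e : y + k • x + r • x = y + (k + r) • x := by rw [add_smul, add_assoc]
  rw [e]
  have h1 := hp.mul_le_add h hκ y (k + r)
  push_cast at h1 ⊢
  rw [add_mul] at h1 ⊢
  refine ENNReal.le_sub_of_add_le_right (by finiteness) ?_
  rw [add_assoc, tsub_add_cancel_of_le h1]

/-- A slope already imposed in direction `a` survives a shear in direction `x`; thus the shear of a
minimal gauge competes with it in the minimality property. -/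
theorem gaugeShear_add_le' (h : IsConePreorder le) (hp : IsSublinearGauge le p) {x a : P}
    {κ c : ℝ≥0} (hκ : κ ≤ p x) (ha : ∀ (y : P) (k : ℝ≥0), p y + k * c ≤ p (y + k • a))
    (y : P) (k : ℝ≥0) : gaugeShear p x κ y + k * c ≤ gaugeShear p x κ (y + k • a) := by
  refine le_iInf fun r => ?_
  refine (add_le_add_left (iInf_le _ r) _).trans ?_
  have e : y + k • a + r • x = y + r • x + k • a := by abel
  rw [e]
  refine ENNReal.le_sub_of_add_le_right (by finiteness) ?_
  rw [add_assoc, add_comm ((k : ℝ≥0∞) * c), ← add_assoc,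
    tsub_add_cancel_of_le (hp.mul_le_add h hκ y r)]
  exact ha _ _

end Shear

/-- The gauge of the order interval below `b`. -/
noncomputable def orderGauge (le : P → P → Prop) (b x : P) : ℝ≥0∞ :=
  ⨅ r : {r : ℝ≥0 // le x (r • b)}, ((r : ℝ≥0) : ℝ≥0∞)

theorem isSublinearGauge_orderGauge {le : P → P → Prop} (h : IsConePreorder le) (b : P) :
    IsSublinearGauge le (orderGauge le b) where
  mono x y hxy := le_iInf fun r => iInf_le_of_le ⟨r.1, h.trans _ _ _ hxy r.2⟩ le_rfl
  zero := le_antisymm (iInf_le_of_le ⟨0, by simpa using h.refl 0⟩ (by simp)) bot_le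
  smul_le t x ht := by
    unfold orderGauge
    rw [ENNReal.mul_iInf_of_ne (by simpa using ht.ne') ENNReal.coe_ne_top]
    refine le_iInf fun r => iInf_le_of_le ⟨t * r.1, ?_⟩ (by simp)
    rw [mul_smul]
    exact h.smul _ _ _ ht r.2
  add_le x y := by
    refine ENNReal.le_iInf_add_iInf fun r s => iInf_le_of_le ⟨r.1 + s.1, ?_⟩ (by simp)
    rw [add_smul]
    exact h.add_add r.2 s.2

/-- Zorn's lemma in the reversed pointwise order. Infima of chains remain subadditive because two
members of a chain are comparable. Without the slope condition in direction `a` the only minimal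
gauge would be `0`. -/
theorem exists_minimal_gauge {le : P → P → Prop} (p₀ : P → ℝ≥0∞)
    (hp₀ : IsSublinearGauge le p₀) (a : P) (c : ℝ≥0)
    (hdir : ∀ (y : P) (k : ℝ≥0), p₀ y + k * c ≤ p₀ (y + k • a)) :
    ∃ p : P → ℝ≥0∞, p ≤ p₀ ∧ IsSublinearGauge le p ∧
      (∀ (y : P) (k : ℝ≥0), p y + k * c ≤ p (y + k • a)) ∧
      ∀ q : P → ℝ≥0∞, IsSublinearGauge le q →
        (∀ (y : P) (k : ℝ≥0), q y + k * c ≤ q (y + k • a)) → q ≤ p → p ≤ q := by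
  let G : Set (P → ℝ≥0∞)ᵒᵈ := {p | IsSublinearGauge le (OrderDual.ofDual p) ∧
    ∀ (y : P) (k : ℝ≥0), OrderDual.ofDual p y + k * c ≤ OrderDual.ofDual p (y + k • a)}
  obtain ⟨m, hm1, hm2⟩ := zorn_le_nonempty₀ G (by
    intro C hC hchain q hq
    refine ⟨OrderDual.toDual fun x => ⨅ p : C, OrderDual.ofDual p.1 x, ⟨⟨?_, ?_, ?_, ?_⟩, ?_⟩,
      fun z hz x => iInf_le_of_le ⟨z, hz⟩ le_rfl⟩
    · exact fun x y hxy => iInf_mono fun p => (hC p.2).1.mono x y hxy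
    · exact le_antisymm (iInf_le_of_le ⟨q, hq⟩ (hC hq).1.zero.le) bot_le
    · intro t x ht
      simp only [OrderDual.ofDual_toDual]
      rw [ENNReal.mul_iInf_of_ne (by simpa using ht.ne') ENNReal.coe_ne_top]
      exact iInf_mono fun p => (hC p.2).1.smul_le t x ht
    · intro x y
      refine ENNReal.le_iInf_add_iInf fun p q => ?_
      rcases hchain.total p.2 q.2 with hpq | hpq
      · refine (iInf_le _ q).trans (((hC q.2).1.add_le x y).trans ?_)
        exact add_le_add (hpq x) le_rfl
      · refine (iInf_le _ p).trans (((hC p.2).1.add_le x y).trans ?_)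
        exact add_le_add le_rfl (hpq y)
    · intro y k
      refine le_iInf fun p => ?_
      exact (add_le_add (iInf_le _ p) le_rfl).trans ((hC p.2).2 y k))
    (OrderDual.toDual p₀) ⟨hp₀, hdir⟩
  refine ⟨OrderDual.ofDual m, hm1, hm2.1.1, hm2.1.2, fun q hq hq' hqm => ?_⟩
  exact hm2.2 (y := OrderDual.toDual q) ⟨hq, hq'⟩ hqm

/-- A Hahn-Banach theorem for pre-ordered cones. -/
theorem IsConePreorder.exists_linear {le : P → P → Prop} (h : IsConePreorder le) {a b : P}
    {r : ℝ≥0} (hr : 1 < r) (hab : ¬ le a (r • b)) :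
    ∃ l : P →ₗ[ℝ≥0] ℝ≥0∞, (∀ x y, le x y → l x ≤ l y) ∧ l b ≤ 1 ∧ 1 < l a := by
  have h0 := isSublinearGauge_orderGauge h b
  have hc : (r : ℝ≥0∞) ≤ orderGauge le b a := by
    refine le_iInf fun s => ?_
    by_contra! hs
    have hs' : s.1 ≤ r := by exact_mod_cast hs.le
    refine hab (h.trans _ _ _ s.2 ?_)
    rw [← add_tsub_cancel_of_le hs', add_smul]
    exact h.le_add_right _ _
  obtain ⟨p, hp1, hp2, hp3, hp4⟩ := exists_minimal_gauge _ (h0.shear h a r) a r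
    (gaugeShear_add_le h h0 hc)
  have hadd : ∀ x y, p (x + y) = p x + p y := by
    intro x y
    refine le_antisymm (hp2.add_le x y) ?_
    rcases eq_or_ne (p x) ∞ with hx | hx
    · rw [hx, top_add, ← hx]
      exact hp2.mono _ _ (h.le_add_right _ _)
    lift p x to ℝ≥0 using hx with κ hκ
    -- By minimality `p` lies below its own shear in direction `x` with slope `p x`; the term `r =
    -- 1` of the infimum is the missing superadditivity.
    have h1 := hp4 (gaugeShear p x κ) (hp2.shear h x κ)
      (gaugeShear_add_le' h hp2 hκ.le hp3) (gaugeShear_le p x κ)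
    have h2 : p y ≤ p (y + x) - κ := by
      refine (h1 y).trans ((iInf_le _ 1).trans ?_)
      simp
    have h3 : (κ : ℝ≥0∞) ≤ p (y + x) := by
      rw [hκ]; exact hp2.mono _ _ (h.le_add_left _ _)
    rw [add_comm x y, add_comm (κ : ℝ≥0∞)]
    calc p y + κ ≤ p (y + x) - κ + κ := by gcongr
      _ = _ := tsub_add_cancel_of_le h3
  refine ⟨{ toFun := p, map_add' := hadd, map_smul' := fun t x => ?_ }, hp2.mono, ?_, ?_⟩
  · rw [hp2.smul_eq, RingHom.id_apply, ENNReal.smul_def, smul_eq_mul]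
  · refine ((hp1 b).trans (gaugeShear_le _ _ _ _)).trans ?_
    exact iInf_le_of_le ⟨1, by rw [one_smul]; exact h.refl b⟩ (by simp)
  · have h1 : (1 : ℝ≥0∞) < r := by exact_mod_cast hr
    have h2 : (r : ℝ≥0∞) ≤ p a := le_trans (by simp) ((hp3 0 1).trans (by simp))
    exact h1.trans_le h2

end HahnBanach

/-! ### The algebraic order of a cone. -/

section AlgOrder

variable {C : Type*} [AddCommMonoid C]

theorem AlgLE.refl (x : C) : AlgLE x x := ⟨0, add_zero _⟩

theorem AlgLE.trans {x y z : C} (h : AlgLE x y) (h' : AlgLE y z) : AlgLE x z := by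
  obtain ⟨a, rfl⟩ := h
  obtain ⟨b, rfl⟩ := h'
  exact ⟨a + b, (add_assoc _ _ _).symm⟩

theorem AlgLE.add {a b c d : C} (h : AlgLE a b) (h' : AlgLE c d) : AlgLE (a + c) (b + d) := by
  obtain ⟨x, rfl⟩ := h
  obtain ⟨y, rfl⟩ := h'
  exact ⟨x + y, by abel⟩

theorem AlgLE.zero_le (x : C) : AlgLE 0 x := ⟨x, zero_add x⟩

theorem AlgLE.self_add (x y : C) : AlgLE x (x + y) := ⟨y, rfl⟩

theorem AlgLE.add_self (x y : C) : AlgLE x (y + x) := ⟨y, add_comm _ _⟩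

theorem AlgLE.sum {ι : Type*} {s : Finset ι} {x y : ι → C} (h : ∀ i ∈ s, AlgLE (x i) (y i)) :
    AlgLE (∑ i ∈ s, x i) (∑ i ∈ s, y i) := by
  classical
  induction s using Finset.induction_on with
  | empty => exact AlgLE.refl _
  | insert i s hi ih =>
    rw [Finset.sum_insert hi, Finset.sum_insert hi]
    exact (h i (Finset.mem_insert_self _ _)).add
      (ih fun j hj => h j (Finset.mem_insert_of_mem hj))

theorem AlgLE.single_le_sum {ι : Type*} {s : Finset ι} (x : ι → C) {i : ι} (hi : i ∈ s) :
    AlgLE (x i) (∑ i ∈ s, x i) := by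
  classical
  rw [← Finset.add_sum_erase s x hi]
  exact AlgLE.self_add _ _

variable [Module ℝ≥0 C]

theorem AlgLE.smul (t : ℝ≥0) {x y : C} (h : AlgLE x y) : AlgLE (t • x) (t • y) := by
  obtain ⟨z, rfl⟩ := h
  exact ⟨t • z, (smul_add _ _ _).symm⟩

theorem AlgLE.smul_le_smul {s t : ℝ≥0} (h : s ≤ t) (x : C) : AlgLE (s • x) (t • x) :=
  ⟨(t - s) • x, by rw [← add_smul, add_tsub_cancel_of_le h]⟩

theorem AlgLE.map {f : C →ₗ[ℝ≥0] ℝ≥0∞} {x y : C} (h : AlgLE x y) : f x ≤ f y := by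
  obtain ⟨z, rfl⟩ := h
  rw [map_add]
  exact le_self_add

theorem nsmul_idem {w : C} (hw : w + w = w) (n : ℕ) : ((n : ℝ≥0) + 1) • w = w := by
  induction n with
  | zero => simp
  | succ n ih => push_cast; rw [add_smul, ih, one_smul, hw]

/-- Since `(n + 1) • w = w`, every multiple `s • w` is below `w`; applied to `t` and to `t⁻¹`, this
gives both inequalities. -/
theorem smul_idem [hanti : Fact (∀ x y : C, AlgLE x y → AlgLE y x → x = y)] {w : C}
    (hw : w + w = w) {t : ℝ≥0} (ht : 0 < t) : t • w = w := by
  have h1 : ∀ s : ℝ≥0, AlgLE (s • w) w := fun s => by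
    obtain ⟨n, hn⟩ := exists_nat_ge s
    have := AlgLE.smul_le_smul (hn.trans (le_add_of_nonneg_right zero_le_one)) w
    rwa [nsmul_idem hw] at this
  refine hanti.out _ _ (h1 t) ?_
  have := (h1 t⁻¹).smul t
  rwa [smul_smul, mul_inv_cancel₀ ht.ne', one_smul] at this

end AlgOrder

/-! ### Compactness, support idempotents, Riesz decomposition and faces. -/

namespace IsExtendedChoquetCone

variable {C : Type*} [AddCommMonoid C] [Module ℝ≥0 C] [TopologicalSpace C]
  [IsExtendedChoquetCone C]

instance : Fact (∀ x y : C, AlgLE x y → AlgLE y x → x = y) := ⟨algLE_antisymm⟩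

theorem tendsto_smul {ι : Type*} {l : Filter ι} {t : ι → ℝ≥0} {x : ι → C} {t₀ : ℝ≥0} {x₀ : C}
    (h₀ : 0 < t₀) (ht : Tendsto t l (𝓝 t₀)) (hx : Tendsto x l (𝓝 x₀)) :
    Tendsto (fun i => t i • x i) l (𝓝 (t₀ • x₀)) := by
  have h := (continuousOn_smul (C := C)).continuousAt (x := (t₀, x₀))
    ((isOpen_lt continuous_const continuous_fst).mem_nhds h₀)
  exact h.tendsto.comp (ht.prodMk_nhds hx)

theorem continuous_smul_const {t : ℝ≥0} (ht : 0 < t) : Continuous fun x : C => t • x :=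
  continuous_iff_continuousAt.2 fun _ => tendsto_smul ht tendsto_const_nhds tendsto_id

/-- The order relation is the image of the compact space `C × C` under `(x, z) ↦ (x, x + z)`. -/
theorem isClosed_algLE : IsClosed {p : C × C | AlgLE p.1 p.2} := by
  have : {p : C × C | AlgLE p.1 p.2} = range fun q : C × C => (q.1, q.1 + q.2) := by
    ext ⟨x, y⟩
    constructor
    · rintro ⟨z, hz⟩
      exact ⟨(x, z), by simp only at hz; simp [hz]⟩
    · rintro ⟨⟨a, b⟩, h⟩
      simp only [Prod.mk.injEq] at h
      exact ⟨b, by rw [← h.1, ← h.2]⟩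
  rw [this]
  exact (isCompact_range (by fun_prop)).isClosed

theorem algLE_of_tendsto {ι : Type*} {l : Filter ι} [l.NeBot] {x y : ι → C} {x₀ y₀ : C}
    (hx : Tendsto x l (𝓝 x₀)) (hy : Tendsto y l (𝓝 y₀)) (h : ∀ᶠ i in l, AlgLE (x i) (y i)) :
    AlgLE x₀ y₀ :=
  isClosed_algLE.mem_of_tendsto (hx.prodMk_nhds hy) h

theorem isClosed_le (x : C) : IsClosed {y | AlgLE y x} :=
  isClosed_algLE.preimage (f := fun y => (y, x)) (by fun_prop)

theorem isClosed_ge (x : C) : IsClosed {y | AlgLE x y} :=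
  isClosed_algLE.preimage (f := fun y => (x, y)) (by fun_prop)

/-- By compactness some point of the closure is below all of `A`; since upper sets are closed, it is
above every lower bound of `A`. That it lies in the closure lets closed conditions pass to the
infimum. -/
theorem exists_glb_of_directed {A : Set C} (hne : A.Nonempty)
    (hdir : ∀ a ∈ A, ∀ b ∈ A, ∃ c ∈ A, AlgLE c a ∧ AlgLE c b) :
    ∃ m ∈ closure A, (∀ a ∈ A, AlgLE m a) ∧ ∀ v, (∀ a ∈ A, AlgLE v a) → AlgLE v m := by
  have : Nonempty A := hne.coe_sort
  obtain ⟨m, hm⟩ := IsCompact.nonempty_iInter_of_directed_nonempty_isCompact_isClosed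
    (fun a : A => closure A ∩ {y | AlgLE y a})
    (by
      intro a b
      obtain ⟨c, hc, h1, h2⟩ := hdir a a.2 b b.2
      exact ⟨⟨c, hc⟩, fun y hy => ⟨hy.1, AlgLE.trans hy.2 h1⟩,
        fun y hy => ⟨hy.1, AlgLE.trans hy.2 h2⟩⟩)
    (fun a => ⟨a, subset_closure a.2, AlgLE.refl _⟩)
    (fun a => (isClosed_closure.inter (isClosed_le _)).isCompact)
    (fun a => isClosed_closure.inter (isClosed_le _))
  rw [mem_iInter] at hm
  refine ⟨m, (hm ⟨_, hne.some_mem⟩).1, fun a ha => (hm ⟨a, ha⟩).2, fun v hv => ?_⟩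
  exact closure_minimal (fun a ha => hv a ha) (isClosed_ge v) (hm ⟨_, hne.some_mem⟩).1

theorem exists_lub_of_directed {A : Set C} (hne : A.Nonempty)
    (hdir : ∀ a ∈ A, ∀ b ∈ A, ∃ c ∈ A, AlgLE a c ∧ AlgLE b c) :
    ∃ m ∈ closure A, (∀ a ∈ A, AlgLE a m) ∧ ∀ v, (∀ a ∈ A, AlgLE a v) → AlgLE m v := by
  have : Nonempty A := hne.coe_sort
  obtain ⟨m, hm⟩ := IsCompact.nonempty_iInter_of_directed_nonempty_isCompact_isClosed
    (fun a : A => closure A ∩ {y : C | AlgLE (a : C) y})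
    (by
      intro a b
      obtain ⟨c, hc, h1, h2⟩ := hdir a a.2 b b.2
      exact ⟨⟨c, hc⟩, fun y hy => ⟨hy.1, h1.trans hy.2⟩,
        fun y hy => ⟨hy.1, h2.trans hy.2⟩⟩)
    (fun a => ⟨a, subset_closure a.2, AlgLE.refl _⟩)
    (fun a => (isClosed_closure.inter (isClosed_ge _)).isCompact)
    (fun a => isClosed_closure.inter (isClosed_ge _))
  rw [mem_iInter] at hm
  refine ⟨m, (hm ⟨_, hne.some_mem⟩).1, fun a ha => (hm ⟨a, ha⟩).2, fun v hv => ?_⟩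
  exact closure_minimal (fun a ha => hv a ha) (isClosed_le v) (hm ⟨_, hne.some_mem⟩).1

theorem exists_eps (x : C) : ∃ e : C, ∀ v, (∀ s : ℝ≥0, 0 < s → AlgLE v (s • x)) ↔ AlgLE v e := by
  obtain ⟨m, -, h1, h2⟩ := exists_glb_of_directed (A := {y | ∃ s : ℝ≥0, 0 < s ∧ y = s • x})
    ⟨x, 1, one_pos, (one_smul _ _).symm⟩ (by
      rintro _ ⟨s, hs, rfl⟩ _ ⟨t, ht, rfl⟩
      exact ⟨_, ⟨min s t, lt_min hs ht, rfl⟩, AlgLE.smul_le_smul (min_le_left _ _) _,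
        AlgLE.smul_le_smul (min_le_right _ _) _⟩)
  refine ⟨m, fun v => ⟨fun h => h2 v ?_, fun h s hs => h.trans (h1 _ ⟨s, hs, rfl⟩)⟩⟩
  rintro _ ⟨s, hs, rfl⟩
  exact h s hs

/-- The support idempotent of `x`: the infimum of its positive multiples. -/
noncomputable def eps (x : C) : C := (exists_eps x).choose

theorem le_eps_iff {v x : C} : AlgLE v (eps x) ↔ ∀ s : ℝ≥0, 0 < s → AlgLE v (s • x) :=
  ((exists_eps x).choose_spec v).symm

theorem eps_le_smul (x : C) {s : ℝ≥0} (hs : 0 < s) : AlgLE (eps x) (s • x) :=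
  le_eps_iff.1 (AlgLE.refl _) s hs

theorem eps_le (x : C) : AlgLE (eps x) x := by simpa using eps_le_smul x one_pos

theorem smul_eps (x : C) {t : ℝ≥0} (ht : 0 < t) : t • eps x = eps x := by
  have h : ∀ {t : ℝ≥0}, 0 < t → AlgLE (t • eps x) (eps x) := by
    intro t ht
    refine le_eps_iff.2 fun s hs => ?_
    have := (eps_le_smul x (s := t⁻¹ * s) (by positivity)).smul t
    rwa [smul_smul, ← mul_assoc, mul_inv_cancel₀ ht.ne', one_mul] at this
  refine algLE_antisymm _ _ (h ht) ?_
  have := (h (inv_pos.2 ht)).smul t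
  rwa [smul_smul, mul_inv_cancel₀ ht.ne', one_smul] at this

theorem eps_add_eps (x : C) : eps x + eps x = eps x := by
  rw [← two_smul ℝ≥0 (eps x), smul_eps x two_pos]

theorem eps_mono {x y : C} (h : AlgLE x y) : AlgLE (eps x) (eps y) :=
  le_eps_iff.2 fun s hs => (eps_le_smul x hs).trans (h.smul s)

theorem eps_idem {w : C} (hw : w + w = w) : eps w = w :=
  algLE_antisymm _ _ (eps_le w) (le_eps_iff.2 fun s hs => by
    rw [smul_idem hw hs]; exact AlgLE.refl _)

/-- Any cluster point is above `eps x`, because every term is, and below each `s • x` with `s > 0`,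
because the terms eventually are. -/
theorem tendsto_inv_smul (x : C) :
    Tendsto (fun n : ℕ => ((n : ℝ≥0) + 1)⁻¹ • x) atTop (𝓝 (eps x)) := by
  refine le_nhds_of_unique_clusterPt fun y hy => ?_
  obtain ⟨u, hu, hy⟩ := mapClusterPt_iff_ultrafilter.1 hy
  refine algLE_antisymm _ _ (le_eps_iff.2 fun s hs => ?_) ?_
  · refine algLE_of_tendsto hy tendsto_const_nhds (hu ?_)
    obtain ⟨N, hN⟩ := exists_nat_ge s⁻¹
    filter_upwards [eventually_ge_atTop N] with n hn
    refine AlgLE.smul_le_smul ?_ x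
    rw [inv_le_comm₀ (by positivity) hs]
    exact hN.trans ((Nat.cast_le.2 hn).trans (le_add_of_nonneg_right zero_le_one))
  · exact algLE_of_tendsto tendsto_const_nhds hy
      (Eventually.of_forall fun n => eps_le_smul x (by positivity))

theorem eps_add (x y : C) : eps (x + y) = eps x + eps y := by
  refine tendsto_nhds_unique (tendsto_inv_smul (x + y)) ?_
  simpa only [smul_add] using (tendsto_inv_smul x).add (tendsto_inv_smul y)

theorem eps_smul (x : C) {t : ℝ≥0} (ht : 0 < t) : eps (t • x) = eps x := by
  have h : ∀ (x : C) {t : ℝ≥0}, 0 < t → AlgLE (eps x) (eps (t • x)) := fun x t ht =>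
    le_eps_iff.2 fun s hs => by rw [smul_smul]; exact eps_le_smul x (mul_pos hs ht)
  refine algLE_antisymm _ _ ?_ (h x ht)
  have := h (t • x) (inv_pos.2 ht)
  rwa [smul_smul, inv_mul_cancel₀ ht.ne', one_smul] at this

/-- `x + eps x` is below `(1 + 1 / (n + 1)) • x` for every `n`, and these multiples tend to `x`. -/
theorem self_add_eps (x : C) : x + eps x = x := by
  refine algLE_antisymm _ _ ?_ (AlgLE.self_add _ _)
  have h1 : Tendsto (fun n : ℕ => (1 + ((n : ℝ≥0) + 1)⁻¹) • x) atTop (𝓝 ((1 : ℝ≥0) • x)) := by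
    refine tendsto_smul one_pos ?_ tendsto_const_nhds
    have := (tendsto_const_nhds (x := (1 : ℝ≥0))).add
      (tendsto_one_div_add_atTop_nhds_zero_nat (𝕜 := ℝ≥0))
    simpa using this
  rw [one_smul] at h1
  refine algLE_of_tendsto tendsto_const_nhds h1 (Eventually.of_forall fun n => ?_)
  rw [add_smul, one_smul]
  exact (AlgLE.refl x).add (eps_le_smul x (by positivity))

/-- Cancellation up to the support idempotent of the cancelled element. -/
theorem le_add_eps_of_add_le_add {a b z : C} (h : AlgLE (a + z) (b + z)) :
    AlgLE a (b + eps z) := by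
  -- One copy of `z` suffices to replace `n + 1` copies of `a` by copies of `b`, one at a time.
  -- After division by `n + 1` the error is `z / (n + 1)`, which tends to `eps z`.
  have h1 : ∀ n : ℕ, AlgLE (((n : ℝ≥0) + 1) • a + z) (((n : ℝ≥0) + 1) • b + z) := by
    intro n
    induction n with
    | zero => simpa using h
    | succ n ih =>
      push_cast
      rw [add_smul _ 1 a, add_smul _ 1 b, one_smul, one_smul]
      have e1 := (AlgLE.refl (((n : ℝ≥0) + 1) • a)).add h
      have e2 := ih.add (AlgLE.refl b)
      have e3 : ((n : ℝ≥0) + 1) • a + (b + z) = ((n : ℝ≥0) + 1) • a + z + b := by abel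
      rw [← add_assoc, e3] at e1
      convert e1.trans e2 using 1
      abel
  have h2 : ∀ n : ℕ, AlgLE a (b + ((n : ℝ≥0) + 1)⁻¹ • z) := by
    intro n
    have h0 : ((n : ℝ≥0) + 1) ≠ 0 := by positivity
    have := (h1 n).smul ((n : ℝ≥0) + 1)⁻¹
    rw [smul_add, smul_add, smul_smul, smul_smul, inv_mul_cancel₀ h0, one_smul, one_smul] at this
    exact (AlgLE.self_add _ _).trans this
  exact algLE_of_tendsto tendsto_const_nhds (tendsto_const_nhds.add (tendsto_inv_smul z))
    (Eventually.of_forall h2)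

/-- The Riesz decomposition property. -/
theorem riesz {x y z : C} (h : AlgLE z (x + y)) :
    ∃ z₁ z₂, z = z₁ + z₂ ∧ AlgLE z₁ x ∧ AlgLE z₂ y := by
  obtain ⟨m, hm⟩ := exists_inf z x
  obtain ⟨v, hv⟩ := hm.1
  -- Both `y + z` and `y + x` are above `z`, hence so is their infimum `y + m`. The same argument
  -- with the remainder `v` of `z` yields the second summand.
  have h1 : AlgLE z (m + y) := by
    have := add_inf y z x m hm
    rw [add_comm m y]
    exact this.2.2 z (AlgLE.add_self _ _) (by rwa [add_comm])
  obtain ⟨n, hn⟩ := exists_inf v y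
  refine ⟨m, n, ?_, hm.2.1, hn.2.1⟩
  have h2 := add_inf m v y n hn
  rw [hv] at h2
  exact algLE_antisymm _ _ (h2.2.2 z (AlgLE.refl _) h1) h2.1

/-- Riesz decomposition of `x` gives `a₁` and `b₁`. Cancelling `x` from the inequality costs `eps x
= eps a₁ + eps b₁`, which can be put into the remainders of `a` and `b` because `a₁` and `b₁` absorb
their own supports. -/
theorem refinement {x y a b : C} (h : AlgLE (x + y) (a + b)) :
    ∃ a₁ a₂ b₁ b₂, a = a₁ + a₂ ∧ b = b₁ + b₂ ∧ x = a₁ + b₁ ∧ AlgLE y (a₂ + b₂) := by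
  obtain ⟨a₁, b₁, hx, ⟨a', ha⟩, ⟨b', hb⟩⟩ := riesz ((AlgLE.self_add x y).trans h)
  refine ⟨a₁, a' + eps a₁, b₁, b' + eps b₁, ?_, ?_, hx, ?_⟩
  · rw [← ha]
    nth_rw 1 [← self_add_eps a₁]
    abel
  · rw [← hb]
    nth_rw 1 [← self_add_eps b₁]
    abel
  · have h1 : AlgLE (y + x) (a' + b' + x) := by
      rw [add_comm y x]
      convert h using 1
      rw [← ha, ← hb, hx]; abel
    have := le_add_eps_of_add_le_add h1
    rw [hx, eps_add] at this
    convert this using 1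
    abel

theorem isOpen_lowerClosure {V : Set C} (hV : IsOpen V) : IsOpen {x | ∃ y ∈ V, AlgLE x y} := by
  rw [isOpen_iff_mem_nhds]
  rintro x ⟨_, hy, ⟨v, rfl⟩⟩
  have h : Continuous fun z : C => z + v := by fun_prop
  filter_upwards [h.continuousAt.preimage_mem_nhds (hV.mem_nhds hy)] with z hz
  exact ⟨_, hz, AlgLE.self_add _ _⟩

theorem isClosed_lowerClosure {K : Set C} (hK : IsClosed K) :
    IsClosed {x | ∃ y ∈ K, AlgLE x y} := by
  have : {x | ∃ y ∈ K, AlgLE x y} = Prod.fst '' ({p : C × C | AlgLE p.1 p.2} ∩ Prod.snd ⁻¹' K) := by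
    ext x
    constructor
    · rintro ⟨y, hy, h⟩
      exact ⟨(x, y), ⟨h, hy⟩, rfl⟩
    · rintro ⟨⟨a, b⟩, ⟨h, hy⟩, rfl⟩
      exact ⟨b, hy, h⟩
  rw [this]
  exact ((isClosed_algLE.inter (hK.preimage continuous_snd)).isCompact.image continuous_fst).isClosed

theorem convex_lowerClosure {K : Set C} (hK : Convex ℝ≥0 K) :
    Convex ℝ≥0 {x | ∃ y ∈ K, AlgLE x y} := by
  rintro x ⟨x', hx, hx'⟩ y ⟨y', hy, hy'⟩ a b ha hb hab
  exact ⟨_, hK hx hy ha hb hab, (hx'.smul a).add (hy'.smul b)⟩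

theorem convex_closure {K : Set C} (hK : Convex ℝ≥0 K) : Convex ℝ≥0 (closure K) := by
  rintro x hx y hy a b ha hb hab
  rcases eq_or_lt_of_le ha with rfl | ha
  · rw [zero_add] at hab
    simpa [hab] using hy
  rcases eq_or_lt_of_le hb with rfl | hb
  · rw [add_zero] at hab
    simpa [hab] using hx
  refine map_mem_closure₂ (f := fun x y => a • x + b • y) ?_ hx hy
    fun x hx y hy => hK hx hy ha.le hb.le hab
  exact ((continuous_smul_const ha).comp continuous_fst).add
    ((continuous_smul_const hb).comp continuous_snd)

theorem exists_convex_nhd (x : C) {U : Set C} (hU : U ∈ 𝓝 x) :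
    ∃ V, IsOpen V ∧ Convex ℝ≥0 V ∧ x ∈ V ∧ closure V ⊆ U := by
  obtain ⟨B, hB, hconv⟩ := locallyConvex (C := C)
  obtain ⟨W, hW, hWc, hWU⟩ := exists_mem_nhds_isClosed_subset hU
  obtain ⟨V, hVB, hxV, hVW⟩ := hB.mem_nhds_iff.1 hW
  exact ⟨V, hB.isOpen hVB, hconv V hVB, hxV, (closure_minimal hVW hWc).trans hWU⟩

/-- The face of the elements whose support idempotent is below `w`. -/
noncomputable def face (w : C) (hw : w + w = w) : Submodule ℝ≥0 C where
  carrier := {x | AlgLE (eps x) w}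
  zero_mem' := (eps_le 0).trans (AlgLE.zero_le w)
  add_mem' := by
    intro x y hx hy
    have := AlgLE.add hx hy
    rwa [← eps_add, hw] at this
  smul_mem' := by
    intro t x hx
    rcases eq_or_ne t 0 with rfl | ht
    · rw [zero_smul]; exact (eps_le 0).trans (AlgLE.zero_le w)
    · change AlgLE _ _
      rw [eps_smul x (pos_iff_ne_zero.2 ht)]
      exact hx

theorem mem_face {w : C} {hw : w + w = w} {x : C} : x ∈ face w hw ↔ AlgLE (eps x) w := Iff.rfl

theorem face_lower {w : C} {hw : w + w = w} {x y : C} (h : AlgLE x y) (hy : y ∈ face w hw) :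
    x ∈ face w hw := (eps_mono h).trans hy

theorem self_mem_face {w : C} (hw : w + w = w) : w ∈ face w hw := eps_le w

theorem exists_ultrafilter_lim {ι : Type*} (u : Ultrafilter ι) (x : ι → C) :
    ∃ x₀, Tendsto x u (𝓝 x₀) := by
  obtain ⟨x₀, -, h⟩ := isCompact_univ.ultrafilter_le_nhds (u.map x) (by simp)
  exact ⟨x₀, h⟩

/-- Small multiples of elements of a compact subset of a face tend to be below the idempotent. -/
theorem le_of_tendsto_smul {ι : Type*} {u : Ultrafilter ι} {w : C} {hw : w + w = w} {X : Set C}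
    (hX : IsClosed X) (hXw : X ⊆ face w hw) {t : ι → ℝ≥0} {x : ι → C} {v : C}
    (hx : ∀ᶠ i in u, x i ∈ X) (ht : Tendsto t u (𝓝 0)) (h : Tendsto (fun i => t i • x i) u (𝓝 v)) :
    AlgLE v w := by
  obtain ⟨x₀, hx₀⟩ := exists_ultrafilter_lim u x
  have h1 : x₀ ∈ X := hX.mem_of_tendsto hx₀ hx
  -- Eventually `t i ≤ s`, so the limit is below `s • x₀` for each `s > 0`, hence below `eps x₀`.
  refine AlgLE.trans (le_eps_iff.2 fun s hs => ?_) (hXw h1)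
  refine algLE_of_tendsto h (tendsto_smul hs tendsto_const_nhds hx₀) ?_
  filter_upwards [ht.eventually (eventually_le_nhds hs)] with i hi
  exact AlgLE.smul_le_smul hi _

end IsExtendedChoquetCone

/-! ### Sampling with finitely many weights: a quantitative law of large numbers. -/

section Sampling

theorem sum_fin_succ_pi {κ : Type*} [Fintype κ] {m : ℕ} (F : (Fin (m + 1) → κ) → ℝ) :
    ∑ ω, F ω = ∑ k, ∑ ω : Fin m → κ, F (Fin.cons k ω) := by
  rw [← (Fin.consEquiv (fun _ : Fin (m + 1) => κ)).sum_comp, Fintype.sum_prod_type]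
  rfl

/-- The numbers `∏ r, t (ω r)` are the probabilities of `m` independent draws from `t`; the sums
over `ω` in this section are expectations. -/
theorem sum_prod_weights {κ : Type*} [Fintype κ] (t : κ → ℝ) (h1 : ∑ k, t k = 1) (m : ℕ) :
    ∑ ω : Fin m → κ, ∏ r, t (ω r) = 1 := by
  induction m with
  | zero => simp
  | succ m ih =>
    rw [sum_fin_succ_pi]
    simp only [Fin.prod_univ_succ, Fin.cons_zero, Fin.cons_succ, ← Finset.mul_sum, ih, mul_one, h1]

theorem sum_prod_weights_mul {κ : Type*} [Fintype κ] (t g : κ → ℝ) (h1 : ∑ k, t k = 1)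
    (hg : ∑ k, t k * g k = 0) (m : ℕ) :
    ∑ ω : Fin m → κ, (∏ r, t (ω r)) * ∑ r, g (ω r) = 0 := by
  induction m with
  | zero => simp
  | succ m ih =>
    rw [sum_fin_succ_pi]
    simp only [Fin.prod_univ_succ, Fin.sum_univ_succ, Fin.cons_zero, Fin.cons_succ]
    have : ∀ k, ∑ ω : Fin m → κ, (t k * ∏ r, t (ω r)) * (g k + ∑ r, g (ω r)) = t k * g k := by
      intro k
      have e : ∀ ω : Fin m → κ, (t k * ∏ r, t (ω r)) * (g k + ∑ r, g (ω r)) =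
          t k * g k * (∏ r, t (ω r)) + t k * ((∏ r, t (ω r)) * ∑ r, g (ω r)) := fun ω => by ring
      simp only [e, Finset.sum_add_distrib, ← Finset.mul_sum, ih, sum_prod_weights t h1]
      ring
    simp only [this, hg]

/-- The variance of a sum of independent bounded centred variables. -/
theorem sum_prod_weights_mul_sq_le {κ : Type*} [Fintype κ] (t g : κ → ℝ) (h0 : ∀ k, 0 ≤ t k)
    (h1 : ∑ k, t k = 1) (hg : ∑ k, t k * g k = 0) {B : ℝ} (hB : ∀ k, g k ^ 2 ≤ B) (m : ℕ) :
    ∑ ω : Fin m → κ, (∏ r, t (ω r)) * (∑ r, g (ω r)) ^ 2 ≤ m * B := by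
  induction m with
  | zero => simp
  | succ m ih =>
    rw [sum_fin_succ_pi]
    simp only [Fin.prod_univ_succ, Fin.sum_univ_succ, Fin.cons_zero, Fin.cons_succ]
    have : ∀ k, ∑ ω : Fin m → κ, (t k * ∏ r, t (ω r)) * (g k + ∑ r, g (ω r)) ^ 2 =
        t k * (g k ^ 2 + ∑ ω : Fin m → κ, (∏ r, t (ω r)) * (∑ r, g (ω r)) ^ 2) := by
      intro k
      have e : ∀ ω : Fin m → κ, (t k * ∏ r, t (ω r)) * (g k + ∑ r, g (ω r)) ^ 2 =
          t k * g k ^ 2 * (∏ r, t (ω r)) + 2 * t k * g k * ((∏ r, t (ω r)) * ∑ r, g (ω r)) +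
          t k * ((∏ r, t (ω r)) * (∑ r, g (ω r)) ^ 2) := fun ω => by ring
      simp only [e, Finset.sum_add_distrib, ← Finset.mul_sum, sum_prod_weights_mul t g h1 hg,
        sum_prod_weights t h1]
      ring
    simp only [this]
    calc ∑ k, t k * (g k ^ 2 + ∑ ω : Fin m → κ, (∏ r, t (ω r)) * (∑ r, g (ω r)) ^ 2)
        ≤ ∑ k, t k * (B + m * B) :=
          Finset.sum_le_sum fun k _ => mul_le_mul_of_nonneg_left (add_le_add (hB k) ih) (h0 k)
      _ = _ := by rw [← Finset.sum_mul, h1]; push_cast; ring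

/-- The inequality `|a| ≤ a² / (2N) + N / 2` reduces this to the variance of `N²` draws, which is at
most `4N²`; the result is `2N + N / 2 ≤ 3N`. -/
theorem sum_prod_weights_mul_abs_le {κ : Type*} [Fintype κ] (t h : κ → ℝ) (h0 : ∀ k, 0 ≤ t k)
    (h1 : ∑ k, t k = 1) (hh : ∀ k, |h k| ≤ 1) {N : ℕ} (hN : 0 < N) :
    ∑ ω : Fin (N ^ 2) → κ, (∏ r, t (ω r)) * |∑ r, h (ω r) - N ^ 2 * ∑ k, t k * h k| ≤ 3 * N := by
  set e := ∑ k, t k * h k with he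
  have he1 : |e| ≤ 1 := by
    rw [he]
    refine (Finset.abs_sum_le_sum_abs _ _).trans ?_
    rw [← h1]
    refine Finset.sum_le_sum fun k _ => ?_
    rw [abs_mul, abs_of_nonneg (h0 k)]
    exact mul_le_of_le_one_right (h0 k) (hh k)
  have hNr : (0 : ℝ) < N := by exact_mod_cast hN
  have hg : ∑ k, t k * (h k - e) = 0 := by
    simp only [mul_sub, Finset.sum_sub_distrib, ← Finset.sum_mul, h1, ← he]; ring
  have hB : ∀ k, (h k - e) ^ 2 ≤ 4 := by
    intro k
    have h2 := abs_le.1 (hh k)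
    have h3 := abs_le.1 he1
    nlinarith
  have hv := sum_prod_weights_mul_sq_le t (fun k => h k - e) h0 h1 hg hB (N ^ 2)
  have hW := sum_prod_weights t h1 (N ^ 2)
  have hS : ∀ ω : Fin (N ^ 2) → κ, ∑ r, h (ω r) - N ^ 2 * e = ∑ r, (h (ω r) - e) := by
    intro ω
    simp [Finset.sum_sub_distrib]
  simp only [hS]
  have key : ∀ ω : Fin (N ^ 2) → κ, (∏ r, t (ω r)) * |∑ r, (h (ω r) - e)| ≤
      (1 / (2 * N)) * ((∏ r, t (ω r)) * (∑ r, (h (ω r) - e)) ^ 2) + (N / 2) * ∏ r, t (ω r) := by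
    intro ω
    have hw : 0 ≤ ∏ r, t (ω r) := Finset.prod_nonneg fun r _ => h0 _
    set a := ∑ r, (h (ω r) - e)
    have : |a| ≤ (1 / (2 * N)) * a ^ 2 + N / 2 := by
      rw [← sq_abs a]
      have h4 : 0 ≤ (|a| - N) ^ 2 / (2 * N) := by positivity
      have h5 : (|a| - N) ^ 2 / (2 * N) = (1 / (2 * N)) * |a| ^ 2 + N / 2 - |a| := by
        field_simp; ring
      linarith
    calc _ ≤ (∏ r, t (ω r)) * ((1 / (2 * N)) * a ^ 2 + N / 2) := by gcongr
      _ = _ := by ring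
  refine (Finset.sum_le_sum fun ω _ => key ω).trans ?_
  rw [Finset.sum_add_distrib, ← Finset.mul_sum, ← Finset.mul_sum, hW]
  push_cast at hv
  calc _ ≤ (1 / (2 * (N : ℝ))) * (N ^ 2 * 4) + N / 2 * 1 := by gcongr
    _ ≤ 3 * N := by field_simp; linarith

/-- If independent samples of the weights `t` are divided into `card ι` classes, then the average
weights of the samples in some class are close to `t`. -/
theorem exists_conditional_weights {κ ι : Type*} [Fintype κ] [DecidableEq κ] [Fintype ι]
    [Nonempty ι] (t : κ → ℝ≥0) (ht : ∑ k, t k = 1) {N : ℕ} (hN : 0 < N)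
    (A : (Fin (N ^ 2) → κ) → ι) :
    ∃ (i : ι) (v : (Fin (N ^ 2) → κ) → ℝ≥0), (∀ ω, A ω ≠ i → v ω = 0) ∧ ∑ ω, v ω = 1 ∧
      ∑ k, (t k - ∑ ω, v ω * (((N : ℝ≥0) ^ 2)⁻¹ * ∑ r, if ω r = k then 1 else 0)) ≤
        3 * Fintype.card ι / N ∧
      ∑ k, ((∑ ω, v ω * (((N : ℝ≥0) ^ 2)⁻¹ * ∑ r, if ω r = k then 1 else 0)) - t k) ≤
        3 * Fintype.card ι / N := by
  classical
  set W : (Fin (N ^ 2) → κ) → ℝ≥0 := fun ω => ∏ r, t (ω r) with hW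
  have ht' : ∑ k, (t k : ℝ) = 1 := by exact_mod_cast ht
  have hW1 : ∑ ω, W ω = 1 := by
    have := sum_prod_weights (fun k => (t k : ℝ)) ht' (N ^ 2)
    exact_mod_cast this
  have hNr : (0 : ℝ) < N := by exact_mod_cast hN
  -- Some class has probability at least `1 / card ι`, so conditioning on it multiplies
  -- probabilities by at most `card ι`.
  obtain ⟨i, -, hi⟩ : ∃ i ∈ Finset.univ, ((Fintype.card ι : ℝ≥0))⁻¹ ≤
      ∑ ω with A ω = i, W ω := by
    by_contra! hcon
    have h2 : ∑ i : ι, ∑ ω with A ω = i, W ω < ∑ i : ι, ((Fintype.card ι : ℝ≥0))⁻¹ :=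
      Finset.sum_lt_sum_of_nonempty Finset.univ_nonempty hcon
    simp only [Finset.sum_filter] at h2
    rw [Finset.sum_comm] at h2
    simp [hW1] at h2
  set q := ∑ ω with A ω = i, W ω with hq
  have hcard : (0 : ℝ≥0) < Fintype.card ι := by exact_mod_cast Fintype.card_pos
  have hq0 : 0 < q := lt_of_lt_of_le (inv_pos.2 hcard) hi
  have hqi : q⁻¹ ≤ Fintype.card ι := by rwa [inv_le_comm₀ hq0 hcard]
  set v : (Fin (N ^ 2) → κ) → ℝ≥0 := fun ω => if A ω = i then q⁻¹ * W ω else 0 with hv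
  have hv1 : ∑ ω, v ω = 1 := by
    rw [hv, ← Finset.sum_filter, ← Finset.mul_sum, ← hq, inv_mul_cancel₀ hq0.ne']
  have hvW : ∀ ω, v ω ≤ Fintype.card ι * W ω := by
    intro ω
    simp only [hv]
    split_ifs
    · gcongr
    · positivity
  set s : κ → ℝ≥0 := fun k => ∑ ω, v ω * (((N : ℝ≥0) ^ 2)⁻¹ * ∑ r, if ω r = k then 1 else 0)
    with hs
  -- The two total differences are recovered by testing against indicators of the sign of `s k - t
  -- k`. The bound is the mean deviation `3N`, divided by the sample size `N²` and multiplied by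
  -- `card ι`.
  have key : ∀ h : κ → ℝ, (∀ k, |h k| ≤ 1) → ∑ k, ((s k : ℝ) - t k) * h k ≤
      3 * Fintype.card ι / N := by
    intro h hh
    have e1 : ∑ k, (s k : ℝ) * h k = ∑ ω, (v ω : ℝ) * (((N : ℝ) ^ 2)⁻¹ * ∑ r, h (ω r)) := by
      simp only [hs]
      push_cast
      simp only [Finset.sum_mul]
      rw [Finset.sum_comm]
      refine Finset.sum_congr rfl fun ω _ => ?_
      simp only [mul_assoc, ← Finset.mul_sum]
      congr 2
      rw [Finset.sum_congr rfl fun k _ => Finset.sum_mul _ _ (h k), Finset.sum_comm]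
      refine Finset.sum_congr rfl fun r _ => ?_
      rw [Finset.sum_eq_single (ω r)] <;> simp +contextual [eq_comm]
    have e2 : ∑ k, (t k : ℝ) * h k = ∑ ω, (v ω : ℝ) * ∑ k, (t k : ℝ) * h k := by
      rw [← Finset.sum_mul]
      have : ∑ ω, (v ω : ℝ) = 1 := by exact_mod_cast hv1
      rw [this, one_mul]
    simp only [sub_mul, Finset.sum_sub_distrib]
    rw [e1, e2, ← Finset.sum_sub_distrib]
    have h3 := sum_prod_weights_mul_abs_le (fun k => (t k : ℝ)) h (fun k => (t k).2) ht' hh hN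
    calc ∑ ω, ((v ω : ℝ) * (((N : ℝ) ^ 2)⁻¹ * ∑ r, h (ω r)) - v ω * ∑ k, (t k : ℝ) * h k)
        ≤ ∑ ω : Fin (N ^ 2) → κ, (Fintype.card ι * ((N : ℝ) ^ 2)⁻¹) * ((∏ r, (t (ω r) : ℝ)) *
            |∑ r, h (ω r) - N ^ 2 * ∑ k, (t k : ℝ) * h k|) := by
          refine Finset.sum_le_sum fun ω _ => ?_
          have h4 : (v ω : ℝ) ≤ Fintype.card ι * ∏ r, (t (ω r) : ℝ) := by exact_mod_cast hvW ω
          have h5 : (v ω : ℝ) * (((N : ℝ) ^ 2)⁻¹ * ∑ r, h (ω r)) - v ω * ∑ k, (t k : ℝ) * h k =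
              v ω * (((N : ℝ) ^ 2)⁻¹ * (∑ r, h (ω r) - N ^ 2 * ∑ k, (t k : ℝ) * h k)) := by
            field_simp
          rw [h5]
          calc _ ≤ (v ω : ℝ) * (((N : ℝ) ^ 2)⁻¹ * |∑ r, h (ω r) - N ^ 2 * ∑ k, (t k : ℝ) * h k|) := by
                gcongr; exact le_abs_self _
            _ ≤ (Fintype.card ι * ∏ r, (t (ω r) : ℝ)) *
                (((N : ℝ) ^ 2)⁻¹ * |∑ r, h (ω r) - N ^ 2 * ∑ k, (t k : ℝ) * h k|) := by gcongr
            _ = _ := by ring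
      _ ≤ (Fintype.card ι * ((N : ℝ) ^ 2)⁻¹) * (3 * N) := by
          rw [← Finset.mul_sum]; gcongr
      _ = _ := by field_simp
  refine ⟨i, v, fun ω hω => by simp [hv, hω], hv1, ?_, ?_⟩
  · have := key (fun k => if s k ≤ t k then -1 else 0) (fun k => by split_ifs <;> simp)
    have e : ∀ k, ((s k : ℝ) - t k) * (if s k ≤ t k then -1 else 0) = ((t k - s k : ℝ≥0) : ℝ) := by
      intro k
      split_ifs with h
      · rw [NNReal.coe_sub h]; ring
      · rw [tsub_eq_zero_of_le (le_of_not_ge h)]; simp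
    simp only [e] at this
    rw [← NNReal.coe_le_coe]
    push_cast
    exact this
  · have := key (fun k => if t k ≤ s k then 1 else 0) (fun k => by split_ifs <;> simp)
    have e : ∀ k, ((s k : ℝ) - t k) * (if t k ≤ s k then 1 else 0) = ((s k - t k : ℝ≥0) : ℝ) := by
      intro k
      split_ifs with h
      · rw [NNReal.coe_sub h]; ring
      · rw [tsub_eq_zero_of_le (le_of_not_ge h)]; simp
    simp only [e] at this
    rw [← NNReal.coe_le_coe]
    push_cast
    exact this

end Sampling

/-! ### Finite convex combinations with coefficients in `ℝ≥0`. -/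

section ConvexCombinations

variable {E : Type*} [AddCommMonoid E] [Module ℝ≥0 E]

theorem Convex.exists_sum_eq_smul {ι : Type*} {s : Set E} (hs : Convex ℝ≥0 s) (S : Finset ι)
    (t : ι → ℝ≥0) (z : ι → E) (hz : ∀ i ∈ S, t i ≠ 0 → z i ∈ s) (h : ∑ i ∈ S, t i ≠ 0) :
    ∃ x ∈ s, ∑ i ∈ S, t i • z i = (∑ i ∈ S, t i) • x := by
  classical
  induction S using Finset.induction_on with
  | empty => simp at h
  | insert i S hi ih =>
    rw [Finset.sum_insert hi] at h
    rw [Finset.sum_insert hi, Finset.sum_insert hi]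
    by_cases h2 : ∑ i ∈ S, t i = 0
    · have h3 : ∀ j ∈ S, t j = 0 := fun j hj => by
        simpa using (Finset.sum_eq_zero_iff.1 h2) j hj
      rw [h2, add_zero] at h ⊢
      refine ⟨z i, hz i (Finset.mem_insert_self _ _) h, ?_⟩
      rw [Finset.sum_eq_zero fun j hj => by rw [h3 j hj, zero_smul], add_zero]
    obtain ⟨x, hx, hx'⟩ := ih (fun j hj => hz j (Finset.mem_insert_of_mem hj)) h2
    by_cases h3 : t i = 0
    · exact ⟨x, hx, by rw [h3, zero_smul, zero_add, zero_add, hx']⟩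
    have h4 := hs (hz i (Finset.mem_insert_self _ _) h3) hx
      (a := t i / (t i + ∑ j ∈ S, t j)) (b := (∑ j ∈ S, t j) / (t i + ∑ j ∈ S, t j))
      (by positivity) (by positivity) (by rw [← add_div, div_self h])
    refine ⟨_, h4, ?_⟩
    rw [hx', smul_add, smul_smul, smul_smul, mul_div_cancel₀ _ h, mul_div_cancel₀ _ h]

theorem Convex.nnreal_sum_mem {ι : Type*} {s : Set E} (hs : Convex ℝ≥0 s) (S : Finset ι)
    (t : ι → ℝ≥0) (z : ι → E) (hz : ∀ i ∈ S, t i ≠ 0 → z i ∈ s) (h : ∑ i ∈ S, t i = 1) :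
    ∑ i ∈ S, t i • z i ∈ s := by
  obtain ⟨x, hx, hx'⟩ := hs.exists_sum_eq_smul S t z hz (by rw [h]; exact one_ne_zero)
  rw [hx', h, one_smul]
  exact hx

theorem exists_sum_eq_smul_of_convex {ι : Type*} {s : Set E} (hs : Convex ℝ≥0 s)
    (hne : s.Nonempty) (S : Finset ι) (t : ι → ℝ≥0) (z : ι → E) (hz : ∀ i ∈ S, z i ∈ s) :
    ∃ x ∈ s, ∑ i ∈ S, t i • z i = (∑ i ∈ S, t i) • x := by
  by_cases h : ∑ i ∈ S, t i = 0
  · refine ⟨hne.some, hne.some_mem, ?_⟩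
    rw [h, zero_smul]
    exact Finset.sum_eq_zero fun i hi => by rw [(Finset.sum_eq_zero_iff.1 h) i hi, zero_smul]
  · exact hs.exists_sum_eq_smul S t z (fun i hi _ => hz i hi) h

theorem exists_fin_of_mem_convexHull {s : Set E} {x : E} (hx : x ∈ convexHull ℝ≥0 s) :
    ∃ (n : ℕ) (t : Fin n → ℝ≥0) (z : Fin n → E), ∑ k, t k = 1 ∧ (∀ k, z k ∈ s) ∧
      x = ∑ k, t k • z k := by
  refine convexHull_min (t := {x | ∃ (n : ℕ) (t : Fin n → ℝ≥0) (z : Fin n → E), ∑ k, t k = 1 ∧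
    (∀ k, z k ∈ s) ∧ x = ∑ k, t k • z k}) (fun y hy => ⟨1, fun _ => 1, fun _ => y, by simp,
      fun _ => hy, by simp⟩) ?_ hx
  rintro x ⟨n, t, z, ht, hz, rfl⟩ y ⟨m, t', z', ht', hz', rfl⟩ a b ha hb hab
  refine ⟨n + m, Fin.append (fun k => a * t k) (fun k => b * t' k), Fin.append z z', ?_, ?_, ?_⟩
  · simp [Fin.sum_univ_add, ← Finset.mul_sum, ht, ht', hab]
  · intro k
    refine Fin.addCases (fun i => ?_) (fun i => ?_) k
    · simpa using hz i
    · simpa using hz' i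
  · simp [Fin.sum_univ_add, Finset.smul_sum, mul_smul]

end ConvexCombinations

/-! ### Uniqueness of barycentres. -/

namespace IsExtendedChoquetCone

variable {C : Type*} [AddCommMonoid C] [Module ℝ≥0 C] [TopologicalSpace C]
  [IsExtendedChoquetCone C]

/-- Uniform continuity of finite sums, with neighbourhoods of the diagonal as entourages; the tube
lemma on the compact diagonal handles one addition. -/
theorem exists_nhd_diag_sum (m : ℕ) {G : Set (C × C)} (hG : IsOpen G) (hd : ∀ x, (x, x) ∈ G) :
    ∃ O : Set (C × C), IsOpen O ∧ (∀ x, (x, x) ∈ O) ∧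
      ∀ a b : Fin m → C, (∀ r, (a r, b r) ∈ O) → (∑ r, a r, ∑ r, b r) ∈ G := by
  induction m generalizing G with
  | zero => exact ⟨univ, isOpen_univ, fun _ => mem_univ _, fun a b _ => by simpa using hd 0⟩
  | succ m ih =>
    have hcd : IsCompact (diagonal C) := isClosed_diagonal.isCompact
    obtain ⟨u, v, hu, hv, hdu, hdv, huv⟩ := generalized_tube_lemma hcd hcd
      (n := (fun p : (C × C) × (C × C) => p.1 + p.2) ⁻¹' G)
      (hG.preimage (by fun_prop)) (by
        rintro ⟨⟨a, b⟩, ⟨c, d⟩⟩ ⟨h1, h2⟩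
        simp only [mem_diagonal_iff] at h1 h2
        subst h1 h2
        exact hd _)
    obtain ⟨O, hO, hOd, h⟩ := ih hv fun x => hdv rfl
    refine ⟨u ∩ O, hu.inter hO, fun x => ⟨hdu rfl, hOd x⟩, fun a b hab => ?_⟩
    rw [Fin.sum_univ_succ, Fin.sum_univ_succ]
    exact huv (mk_mem_prod (hab 0).1 (h _ _ fun r => (hab r.succ).2))

theorem exists_nhd_diag_average {m : ℕ} (hm : 0 < m) {G : Set (C × C)} (hG : IsOpen G)
    (hd : ∀ x, (x, x) ∈ G) : ∃ O : Set (C × C), IsOpen O ∧ (∀ x, (x, x) ∈ O) ∧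
      ∀ a b : Fin m → C, (∀ r, (a r, b r) ∈ O) →
        ((m : ℝ≥0)⁻¹ • ∑ r, a r, (m : ℝ≥0)⁻¹ • ∑ r, b r) ∈ G := by
  have hc : Continuous fun x : C => (m : ℝ≥0)⁻¹ • x := continuous_smul_const (by positivity)
  exact exists_nhd_diag_sum m (G := Prod.map (fun x : C => (m : ℝ≥0)⁻¹ • x)
    (fun x : C => (m : ℝ≥0)⁻¹ • x) ⁻¹' G) (hG.preimage (hc.prodMap hc)) fun x => hd _

theorem convexHull_prod_subset {X : Set C} (hX : Convex ℝ≥0 X) (hXc : IsClosed X)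
    (O : Set (C × C)) : closure (convexHull ℝ≥0 (O ∩ X ×ˢ X)) ⊆ X ×ˢ X :=
  closure_minimal (convexHull_min inter_subset_right (hX.prod hX)) (hXc.prod hXc)

/-- The finite form of the law of large numbers used to identify barycentres: if `(x, y)` is a
convex combination of sufficiently close pairs, then up to small elements it agrees with a pair in
one of the sets of a given cover. -/
theorem exists_close_pair {X : Set C} (hX : Convex ℝ≥0 X) {ι : Type*} [Fintype ι] [Nonempty ι]
    (U' U : ι → Set C) (hU' : ∀ i, Convex ℝ≥0 (U' i)) (hU : ∀ i, Convex ℝ≥0 (U i))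
    (hcov : ∀ x, ∃ i, x ∈ U' i) {N : ℕ} (hN : 0 < N) {O : Set (C × C)}
    (hO : ∀ a b : Fin (N ^ 2) → C, (∀ r, (a r, b r) ∈ O) → ∀ i,
      ((N ^ 2 : ℕ) : ℝ≥0)⁻¹ • ∑ r, a r ∈ U' i → ((N ^ 2 : ℕ) : ℝ≥0)⁻¹ • ∑ r, b r ∈ U i)
    {z : C × C} (hz : z ∈ convexHull ℝ≥0 (O ∩ X ×ˢ X)) :
    ∃ (i : ι) (x y a b a' b' : C) (η η' : ℝ≥0), x ∈ U' i ∧ y ∈ U i ∧ x ∈ X ∧ y ∈ X ∧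
      a ∈ X ∧ b ∈ X ∧ a' ∈ X ∧ b' ∈ X ∧ η ≤ 3 * Fintype.card ι / N ∧ η' ≤ 3 * Fintype.card ι / N ∧
      x + η • a = z.1 + η' • b ∧ y + η • a' = z.2 + η' • b' := by
  obtain ⟨n, t, p, ht, hp, rfl⟩ := exists_fin_of_mem_convexHull hz
  -- Samples are classified by a cell containing the mean of their first coordinates; `hO` then puts
  -- the mean of the second coordinates into the enlarged cell.
  choose A hA using fun ω : Fin (N ^ 2) → Fin n =>
    hcov (((N ^ 2 : ℕ) : ℝ≥0)⁻¹ • ∑ r, (p (ω r)).1)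
  obtain ⟨i, v, hv0, hv1, h1, h2⟩ := exists_conditional_weights t ht hN A
  set s : Fin n → ℝ≥0 := fun k =>
    ∑ ω, v ω * (((N : ℝ≥0) ^ 2)⁻¹ * ∑ r, if ω r = k then 1 else 0) with hs
  have hne : X.Nonempty := by
    have hn : 0 < n := by
      rcases Nat.eq_zero_or_pos n with rfl | h
      · simp at ht
      · exact h
    exact ⟨_, (hp ⟨0, hn⟩).2.1⟩
  have hsum : ∀ f : Fin n → C, ∑ k, s k • f k =
      ∑ ω, v ω • (((N ^ 2 : ℕ) : ℝ≥0)⁻¹ • ∑ r, f (ω r)) := by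
    intro f
    simp only [hs, Finset.sum_smul]
    rw [Finset.sum_comm]
    refine Finset.sum_congr rfl fun ω _ => ?_
    simp only [mul_smul, ← Finset.smul_sum]
    push_cast
    congr 2
    rw [Finset.sum_congr rfl fun k _ => Finset.sum_smul, Finset.sum_comm]
    refine Finset.sum_congr rfl fun r _ => ?_
    rw [Finset.sum_eq_single (ω r)]
    · simp
    · intro k _ hk
      simp [hk.symm]
    · simp
  -- In both sums the coefficient of `f k` is `max (s k) (t k)`. This replaces a subtraction of the
  -- two convex combinations.
  have hs1 : ∀ f : Fin n → C, ∑ k, s k • f k + ∑ k, (t k - s k) • f k =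
      ∑ k, t k • f k + ∑ k, (s k - t k) • f k := by
    intro f
    rw [← Finset.sum_add_distrib, ← Finset.sum_add_distrib]
    refine Finset.sum_congr rfl fun k _ => ?_
    rw [← add_smul, ← add_smul, add_tsub_eq_max, add_tsub_eq_max, max_comm]
  have hNm : ((N ^ 2 : ℕ) : ℝ≥0) ≠ 0 := by positivity
  have hmean : ∀ f : Fin (N ^ 2) → C, (∀ r, f r ∈ X) →
      ((N ^ 2 : ℕ) : ℝ≥0)⁻¹ • ∑ r, f r ∈ X := by
    intro f hf
    rw [Finset.smul_sum]
    refine hX.nnreal_sum_mem _ _ _ (fun r _ _ => hf r) ?_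
    rw [Finset.sum_const, Finset.card_univ, Fintype.card_fin, nsmul_eq_mul,
      mul_inv_cancel₀ hNm]
  obtain ⟨a, ha, ha'⟩ := exists_sum_eq_smul_of_convex hX hne Finset.univ (fun k => t k - s k)
    (fun k => (p k).1) fun k _ => (hp k).2.1
  obtain ⟨b, hb, hb'⟩ := exists_sum_eq_smul_of_convex hX hne Finset.univ (fun k => s k - t k)
    (fun k => (p k).1) fun k _ => (hp k).2.1
  obtain ⟨c, hc, hc'⟩ := exists_sum_eq_smul_of_convex hX hne Finset.univ (fun k => t k - s k)
    (fun k => (p k).2) fun k _ => (hp k).2.2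
  obtain ⟨d, hd, hd'⟩ := exists_sum_eq_smul_of_convex hX hne Finset.univ (fun k => s k - t k)
    (fun k => (p k).2) fun k _ => (hp k).2.2
  have hAi : ∀ ω, v ω ≠ 0 → A ω = i := fun ω h => by
    by_contra h'
    exact h (hv0 ω h')
  refine ⟨i, ∑ k, s k • (p k).1, ∑ k, s k • (p k).2, a, b, c, d, _, _, ?_, ?_, ?_, ?_,
    ha, hb, hc, hd, h1, h2, ?_, ?_⟩
  · rw [hsum]
    refine (hU' i).nnreal_sum_mem _ _ _ (fun ω _ h => ?_) hv1
    rw [← hAi ω h]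
    exact hA ω
  · rw [hsum]
    refine (hU i).nnreal_sum_mem _ _ _ (fun ω _ h => ?_) hv1
    refine hO (fun r => (p (ω r)).1) _ (fun r => (hp (ω r)).1) i ?_
    rw [← hAi ω h]
    exact hA ω
  · rw [hsum]
    exact hX.nnreal_sum_mem _ _ _ (fun ω _ _ => hmean _ fun r => (hp _).2.1) hv1
  · rw [hsum]
    exact hX.nnreal_sum_mem _ _ _ (fun ω _ _ => hmean _ fun r => (hp _).2.2) hv1
  · have := hs1 fun k => (p k).1
    rw [ha', hb'] at this
    rw [this, Prod.fst_sum]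
    simp [hs]
  · have := hs1 fun k => (p k).2
    rw [hc', hd'] at this
    rw [this, Prod.snd_sum]
    simp [hs]

theorem add_eq_of_le_idem {v w : C} (hw : w + w = w) (h : AlgLE v w) : v + w = w :=
  algLE_antisymm _ _ (by simpa [hw] using h.add (AlgLE.refl w)) (AlgLE.add_self _ _)

/-- Barycentres are unique: a pair in the closed convex hull of every neighbourhood of the
diagonal is on the diagonal. -/
theorem eq_of_forall_mem_closure_convexHull {w : C} {hw : w + w = w} {X : Set C}
    (hXc : IsClosed X) (hX : Convex ℝ≥0 X) (hXw : X ⊆ face w hw) (hXa : ∀ x ∈ X, x + w = x)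
    {x y : C} (h : ∀ O : Set (C × C), IsOpen O → (∀ z, (z, z) ∈ O) →
      (x, y) ∈ closure (convexHull ℝ≥0 (O ∩ X ×ˢ X))) : x = y := by
  by_contra hxy
  have hxyX : (x, y) ∈ X ×ˢ X := convexHull_prod_subset hX hXc univ
    (h univ isOpen_univ fun _ => mem_univ _)
  -- The cells are so small that the closure of none of them contains both `x` and `y`.
  have hcell : ∀ p : C, ∃ V' V : Set C, IsOpen V' ∧ Convex ℝ≥0 V' ∧ p ∈ V' ∧ IsOpen V ∧
      Convex ℝ≥0 V ∧ closure V' ⊆ V ∧ ¬ (x ∈ closure V ∧ y ∈ closure V) := by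
    intro p
    have : ∃ V : Set C, IsOpen V ∧ Convex ℝ≥0 V ∧ p ∈ V ∧ ¬ (x ∈ closure V ∧ y ∈ closure V) := by
      by_cases hp : p = x
      · obtain ⟨V, h1, h2, h3, h4⟩ := exists_convex_nhd p (U := {y}ᶜ)
          (isOpen_compl_singleton.mem_nhds (by rw [hp]; exact hxy))
        exact ⟨V, h1, h2, h3, fun h => h4 h.2 rfl⟩
      · obtain ⟨V, h1, h2, h3, h4⟩ := exists_convex_nhd p (U := {x}ᶜ)
          (isOpen_compl_singleton.mem_nhds hp)
        exact ⟨V, h1, h2, h3, fun h => h4 h.1 rfl⟩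
    obtain ⟨V, h1, h2, h3, h4⟩ := this
    obtain ⟨V', h5, h6, h7, h8⟩ := exists_convex_nhd p (h1.mem_nhds h3)
    exact ⟨V', V, h5, h6, h7, h1, h2, h8, h4⟩
  choose V' V hV'o hV'c hpV' hVo hVc hV'V hxyV using hcell
  obtain ⟨F, -, hF⟩ := isCompact_univ.elim_nhds_subcover V'
    fun p _ => (hV'o p).mem_nhds (hpV' p)
  have hcov : ∀ z, ∃ p : F, z ∈ V' p := fun z => by
    have := hF (mem_univ z)
    simp only [mem_iUnion] at this
    obtain ⟨p, hp, hz⟩ := this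
    exact ⟨⟨p, hp⟩, hz⟩
  have : Nonempty F := ⟨(hcov x).choose⟩
  set G : Set (C × C) := ⋂ p : F, {z | z.1 ∉ closure (V' p) ∨ z.2 ∈ V p} with hG
  have hGo : IsOpen G := by
    refine isOpen_iInter_of_finite fun p => ?_
    exact (isClosed_closure.isOpen_compl.preimage continuous_fst).union
      ((hVo p).preimage continuous_snd)
  have hGd : ∀ z, (z, z) ∈ G := fun z => mem_iInter.2 fun p => by
    by_cases hz : z ∈ closure (V' p)
    · exact Or.inr (hV'V p hz)
    · exact Or.inl hz
  choose O hOo hOd hO using fun N : ℕ => exists_nhd_diag_average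
    (m := (N + 1) ^ 2) (by positivity) hGo hGd
  have hclose : ∀ (N : ℕ) (z : C × C), z ∈ convexHull ℝ≥0 (O N ∩ X ×ˢ X) → _ := fun N z hz =>
    exists_close_pair hX (fun p : F => V' p) (fun p : F => V p) (fun p => hV'c p)
      (fun p => hVc p) hcov N.succ_pos (fun a b hab p hp =>
        ((mem_iInter.1 (hO N a b hab) p).resolve_left fun hn => hn (subset_closure hp))) hz
  -- The neighbourhood `O N` depends on the sample size, so one ultrafilter on pairs `(N, z)` is
  -- used to let `N` tend to infinity and `z` to `(x, y)` simultaneously.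
  let I := {q : ℕ × (C × C) // q.2 ∈ convexHull ℝ≥0 (O q.1 ∩ X ×ˢ X)}
  let l : Filter I := comap Subtype.val (atTop ×ˢ 𝓝 (x, y))
  have hl : l.NeBot := by
    refine comap_neBot fun s hs => ?_
    obtain ⟨s₁, h1, s₂, h2, h12⟩ := mem_prod_iff.1 hs
    obtain ⟨N, hN⟩ := (mem_atTop_sets.1 h1)
    obtain ⟨z, hz, hz'⟩ := mem_closure_iff_nhds.1 (h (O N) (hOo N) (hOd N)) s₂ h2
    exact ⟨⟨(N, z), hz'⟩, h12 (mk_mem_prod (hN N le_rfl) hz)⟩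
  let u : Ultrafilter I := Ultrafilter.of l
  have hu : (u : Filter I) ≤ l := Ultrafilter.of_le l
  have hlim : Tendsto (Subtype.val : I → ℕ × (C × C)) u (atTop ×ˢ 𝓝 (x, y)) :=
    tendsto_comap.mono_left hu
  have hN : Tendsto (fun q : I => q.1.1) u atTop := tendsto_fst.comp hlim
  have hz : Tendsto (fun q : I => q.1.2) u (𝓝 (x, y)) := tendsto_snd.comp hlim
  choose p x' y' a b a' b' η η' h1 h2 h3 h4 h5 h6 h7 h8 h9 h10 h11 h12 using
    fun q : I => hclose q.1.1 q.1.2 q.2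
  obtain ⟨x₀, hx₀⟩ := exists_ultrafilter_lim u x'
  obtain ⟨y₀, hy₀⟩ := exists_ultrafilter_lim u y'
  have hbound : Tendsto (fun q : I => 3 * (Fintype.card F : ℝ≥0) / (q.1.1.succ : ℕ)) u (𝓝 0) := by
    have := ((tendsto_one_div_add_atTop_nhds_zero_nat (𝕜 := ℝ≥0)).const_mul
      (3 * (Fintype.card F : ℝ≥0))).comp hN
    rw [mul_zero] at this
    refine this.congr fun q => ?_
    simp [div_eq_mul_inv]
  have hη : Tendsto η u (𝓝 0) := tendsto_of_tendsto_of_tendsto_of_le_of_le tendsto_const_nhds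
    hbound (fun _ => bot_le) h9
  have hη' : Tendsto η' u (𝓝 0) := tendsto_of_tendsto_of_tendsto_of_le_of_le tendsto_const_nhds
    hbound (fun _ => bot_le) h10
  -- The error terms tend to elements below `w`, not to `0`; they disappear because elements of `X`
  -- absorb `w`.
  have key : ∀ {f g c d : I → C} {f₀ g₀ : C}, Tendsto f u (𝓝 f₀) → Tendsto g u (𝓝 g₀) →
      (∀ q, c q ∈ X) → (∀ q, d q ∈ X) → f₀ ∈ X → g₀ ∈ X →
      (∀ q, f q + η q • c q = g q + η' q • d q) → f₀ = g₀ := by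
    intro f g c d f₀ g₀ hf hg hc hd hfX hgX heq
    obtain ⟨c₀, hc₀⟩ := exists_ultrafilter_lim u fun q => η q • c q
    obtain ⟨d₀, hd₀⟩ := exists_ultrafilter_lim u fun q => η' q • d q
    have e1 := le_of_tendsto_smul hXc hXw (Eventually.of_forall hc) hη hc₀
    have e2 := le_of_tendsto_smul hXc hXw (Eventually.of_forall hd) hη' hd₀
    have e3 : f₀ + c₀ = g₀ + d₀ := by
      refine tendsto_nhds_unique (hf.add hc₀) ?_
      simpa only [heq] using hg.add hd₀
    calc f₀ = f₀ + c₀ + w := by rw [add_assoc, add_eq_of_le_idem hw e1, hXa _ hfX]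
      _ = g₀ := by rw [e3, add_assoc, add_eq_of_le_idem hw e2, hXa _ hgX]
  have hx₀X : x₀ ∈ X := hXc.mem_of_tendsto hx₀ (Eventually.of_forall h3)
  have hy₀X : y₀ ∈ X := hXc.mem_of_tendsto hy₀ (Eventually.of_forall h4)
  have ex : x₀ = x := key hx₀ ((continuous_fst.tendsto _).comp hz) h5 h6 hx₀X hxyX.1 h11
  have ey : y₀ = y := key hy₀ ((continuous_snd.tendsto _).comp hz) h7 h8 hy₀X hxyX.2 h12
  -- There are finitely many cells, so the limit pair lies in the closure of one of them, contrary
  -- to their choice.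
  have hA : (x₀, y₀) ∈ ⋃ p : F, closure (V' p) ×ˢ closure (V p) := by
    refine IsClosed.mem_of_tendsto (b := (u : Filter I)) ?_ (hx₀.prodMk_nhds hy₀)
      (Eventually.of_forall fun q => mem_iUnion.2 ⟨p q, subset_closure (h1 q),
        subset_closure (h2 q)⟩)
    exact isClosed_iUnion_of_finite fun p => isClosed_closure.prod isClosed_closure
  obtain ⟨p, hp1, hp2⟩ := mem_iUnion.1 hA
  rw [ex] at hp1
  rw [ey] at hp2
  exact hxyV p ⟨subset_closure (hV'V p hp1), hp2⟩

end IsExtendedChoquetCone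

theorem Convex.exists_smul_add_smul {E : Type*} [AddCommMonoid E] [Module ℝ≥0 E] {s : Set E}
    (hs : Convex ℝ≥0 s) {x y : E} (hx : x ∈ s) (hy : y ∈ s) (a b : ℝ≥0) :
    ∃ z ∈ s, a • x + b • y = (a + b) • z := by
  obtain ⟨z, hz, h⟩ := exists_sum_eq_smul_of_convex hs ⟨x, hx⟩ Finset.univ ![a, b] ![x, y]
    (by intro i _; fin_cases i <;> simpa)
  exact ⟨z, hz, by simpa using h⟩

/-! ### Separation by linear functions that are continuous on a face. -/

section Separation

variable {C : Type*} [AddCommMonoid C] [Module ℝ≥0 C]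

/-- The pre-order on `C × ℝ≥0 × ℝ≥0` generated by the order of `C` modulo `w` and the relations
`t ≤ u` for `t ∈ T`, `x ≤ y + 2u` for `(x, y) ∈ R`, and `v ≤ k` for `k ∈ K`, where `u` and `v` are
the generators of the last two factors. -/
def SepLE (w : C) (T K : Set C) (R : Set (C × C)) (p q : C × ℝ≥0 × ℝ≥0) : Prop :=
  ∃ (τ ρ σ : ℝ≥0), ∃ t ∈ T, ∃ r ∈ R, ∃ k ∈ K,
    AlgLE (p.1 + σ • k + ρ • r.2) (q.1 + τ • t + ρ • r.1 + w) ∧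
      p.2.1 + τ + 2 * ρ ≤ q.2.1 ∧ p.2.2 ≤ q.2.2 + σ

/-- Transitivity is where convexity enters: `τ • t + τ' • t'` is again `τ + τ'` times an element of
`T`, and likewise for `K` and `R`; the two copies of `w` merge into one. -/
theorem isConePreorder_sepLE {w : C} (hw : ∀ t : ℝ≥0, 0 < t → t • w = w) {T K : Set C}
    {R : Set (C × C)} (hT : Convex ℝ≥0 T) (hK : Convex ℝ≥0 K) (hR : Convex ℝ≥0 R)
    (hTn : T.Nonempty) (hKn : K.Nonempty) (hRn : R.Nonempty) : IsConePreorder (SepLE w T K R) where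
  refl p := ⟨0, 0, 0, _, hTn.some_mem, _, hRn.some_mem, _, hKn.some_mem, by
    simpa using AlgLE.self_add _ _, by simp, by simp⟩
  trans := by
    rintro ⟨a, α, β⟩ ⟨a', α', β'⟩ ⟨a'', α'', β''⟩ ⟨τ, ρ, σ, t, ht, r, hr, k, hk, h1, h2, h3⟩
      ⟨τ', ρ', σ', t', ht', r', hr', k', hk', h1', h2', h3'⟩
    obtain ⟨t₀, ht₀, et⟩ := hT.exists_smul_add_smul ht ht' τ τ'
    obtain ⟨r₀, hr₀, er⟩ := hR.exists_smul_add_smul hr hr' ρ ρ'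
    obtain ⟨k₀, hk₀, ek⟩ := hK.exists_smul_add_smul hk hk' σ σ'
    refine ⟨τ + τ', ρ + ρ', σ + σ', t₀, ht₀, r₀, hr₀, k₀, hk₀, ?_, ?_, ?_⟩
    · have er1 := congrArg Prod.fst er
      have er2 := congrArg Prod.snd er
      simp only [Prod.fst_add, Prod.smul_fst, Prod.snd_add, Prod.smul_snd] at er1 er2
      rw [← et, ← er1, ← er2, ← ek]
      have hww : w + w = w := by
        have := hw 2 two_pos
        rwa [two_smul] at this
      have e1 := h1.add (AlgLE.refl (σ' • k' + ρ' • r'.2))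
      have e2 := h1'.add (AlgLE.refl (τ • t + ρ • r.1 + w))
      simp only at e1 e2 ⊢
      have e3 : a' + τ • t + ρ • r.1 + w + (σ' • k' + ρ' • r'.2) =
        a' + σ' • k' + ρ' • r'.2 + (τ • t + ρ • r.1 + w) := by abel
      rw [e3] at e1
      have e4 := e1.trans e2
      have e5 : a'' + τ' • t' + ρ' • r'.1 + w + (τ • t + ρ • r.1 + w) =
        a'' + (τ • t + τ' • t') + (ρ • r.1 + ρ' • r'.1) + (w + w) := by abel
      rw [e5, hww] at e4
      convert e4 using 1
      abel
    · simp only at h2 h2' ⊢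
      calc α + (τ + τ') + 2 * (ρ + ρ') = (α + τ + 2 * ρ) + τ' + 2 * ρ' := by ring
        _ ≤ α' + τ' + 2 * ρ' := by gcongr
        _ ≤ α'' := h2'
    · simp only at h3 h3' ⊢
      calc β ≤ β' + σ := h3
        _ ≤ β'' + σ' + σ := by gcongr
        _ = _ := by ring
  add := by
    rintro ⟨a, α, β⟩ ⟨a', α', β'⟩ ⟨b, γ, δ⟩ ⟨τ, ρ, σ, t, ht, r, hr, k, hk, h1, h2, h3⟩
    refine ⟨τ, ρ, σ, t, ht, r, hr, k, hk, ?_, ?_, ?_⟩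
    · simp only [Prod.mk_add_mk] at h1 ⊢
      have := h1.add (AlgLE.refl b)
      convert this using 1 <;> abel
    · simp only [Prod.mk_add_mk] at h2 ⊢
      calc α + γ + τ + 2 * ρ = (α + τ + 2 * ρ) + γ := by ring
        _ ≤ _ := by gcongr
    · simp only [Prod.mk_add_mk] at h3 ⊢
      calc β + δ ≤ β' + σ + δ := by gcongr
        _ = _ := by ring
  smul := by
    rintro s ⟨a, α, β⟩ ⟨a', α', β'⟩ hs ⟨τ, ρ, σ, t, ht, r, hr, k, hk, h1, h2, h3⟩
    refine ⟨s * τ, s * ρ, s * σ, t, ht, r, hr, k, hk, ?_, ?_, ?_⟩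
    · have := h1.smul s
      simpa [smul_add, mul_smul, hw s hs] using this
    · simp only [Prod.smul_mk, smul_eq_mul] at h2 ⊢
      calc s * α + s * τ + 2 * (s * ρ) = s * (α + τ + 2 * ρ) := by ring
        _ ≤ _ := by gcongr
    · simp only [Prod.smul_mk, smul_eq_mul] at h3 ⊢
      rw [← mul_add]
      gcongr
  nonneg p := ⟨0, 0, 0, _, hTn.some_mem, _, hRn.some_mem, _, hKn.some_mem, by
    simpa using AlgLE.zero_le _, by simp, by simp⟩

/-- Hahn-Banach applied to the two generators `v = (0, 0, 1)` and `u = (0, 1, 0)`: a relation `v ≤ s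
u` unwinds to one of the inequalities excluded by hypothesis. The constant `c` is the value at `v`.
-/
theorem exists_linear_separating {w : C} (hw : ∀ t : ℝ≥0, 0 < t → t • w = w) {T K : Set C}
    {R : Set (C × C)} (hT : Convex ℝ≥0 T) (hK : Convex ℝ≥0 K) (hR : Convex ℝ≥0 R)
    (hTn : T.Nonempty) (hKn : K.Nonempty) (hR0 : (0, 0) ∈ R) {s : ℝ≥0} (hs : 1 < s) (hs2 : s ≤ 2)
    (h : ∀ k ∈ K, ∀ t ∈ T, ∀ r ∈ R, ∀ τ ≤ s, ¬ AlgLE (k + r.2) (τ • t + r.1 + w)) :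
    ∃ (l : C →ₗ[ℝ≥0] ℝ≥0∞) (c : ℝ≥0∞), 1 < c ∧ (∀ t ∈ T, l t ≤ 1) ∧ (∀ k ∈ K, c ≤ l k) ∧
      ∀ r ∈ R, l r.1 ≤ l r.2 + 2 := by
  have hle := isConePreorder_sepLE hw hT hK hR hTn hKn ⟨_, hR0⟩
  obtain ⟨f, hf, hf1, hf2⟩ := hle.exists_linear (a := (0, 0, 1)) (b := (0, 1, 0)) hs (by
    rintro ⟨τ, ρ, σ, t, ht, r, hr, k, hk, h1, h2, h3⟩
    simp only [Prod.smul_mk, smul_zero, smul_eq_mul, mul_one, zero_add] at h1 h2 h3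
    -- The coefficient `2` in the relations `x ≤ y + 2u`, together with `s ≤ 2`, keeps `ρ • r`
    -- inside the convex set `R`, which contains `0`.
    have hρ : ρ ≤ 1 := by
      have h4 : 2 * ρ ≤ 2 := le_trans (le_trans le_add_self h2) hs2
      exact le_of_mul_le_mul_left (by simpa using h4) (two_pos : (0 : ℝ≥0) < 2)
    have hr' : ρ • r ∈ R := by
      have := hR hr hR0 (a := ρ) (b := 1 - ρ) bot_le bot_le (add_tsub_cancel_of_le hρ)
      rwa [Prod.mk_zero_zero, smul_zero, add_zero] at this
    refine h k hk t ht _ hr' τ (le_self_add.trans h2) ?_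
    refine AlgLE.trans (AlgLE.add ?_ (AlgLE.refl _)) h1
    simpa using AlgLE.smul_le_smul h3 k)
  refine ⟨f.comp (LinearMap.inl ℝ≥0 C (ℝ≥0 × ℝ≥0)), f (0, 0, 1), hf2, fun t ht => ?_,
    fun k hk => ?_, fun r hr => ?_⟩
  · refine (hf _ (0, 1, 0) ⟨1, 0, 0, t, ht, _, hR0, _, hKn.some_mem, ?_, ?_, ?_⟩).trans hf1
    · simpa using AlgLE.self_add _ _
    · simp
    · simp
  · refine hf _ _ ⟨0, 0, 1, _, hTn.some_mem, _, hR0, k, hk, ?_, ?_, ?_⟩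
    · simpa using AlgLE.self_add _ _
    · simp
    · simp
  · have h4 : f (r.2, 2, 0) = f (r.2, 0, 0) + (2 : ℝ≥0) • f (0, 1, 0) := by
      rw [← map_smul, ← map_add]
      simp
    have h5 : f (r.1, 0, 0) ≤ f (r.2, 2, 0) := by
      refine hf _ _ ⟨0, 1, 0, _, hTn.some_mem, r, hr, _, hKn.some_mem, ?_, ?_, ?_⟩
      · simp only [zero_smul, one_smul, add_zero]
        rw [add_comm r.1]
        exact AlgLE.self_add _ _
      · simp
      · simp
    refine h5.trans ?_
    rw [h4]
    simp only [LinearMap.comp_apply, LinearMap.inl_apply, ENNReal.smul_def, smul_eq_mul]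
    refine add_le_add le_rfl ?_
    calc ((2 : ℝ≥0) : ℝ≥0∞) * f (0, 1, 0) ≤ (2 : ℝ≥0) * 1 := by gcongr
      _ = 2 := by simp

end Separation

namespace IsExtendedChoquetCone

variable {C : Type*} [AddCommMonoid C] [Module ℝ≥0 C] [TopologicalSpace C]
  [IsExtendedChoquetCone C]

/-- Translation by `w` moves `X` to a set that absorbs `w`, where barycentres are unique. -/
theorem add_eq_add_of_forall_mem_closure_convexHull {w : C} {hw : w + w = w} {X : Set C}
    (hXc : IsClosed X) (hX : Convex ℝ≥0 X) (hXw : X ⊆ face w hw)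
    {x y : C} (h : ∀ O : Set (C × C), IsOpen O → (∀ z, (z, z) ∈ O) →
      (x, y) ∈ closure (convexHull ℝ≥0 (O ∩ X ×ˢ X))) : x + w = y + w := by
  have hwab : ∀ a b : ℝ≥0, a + b = 1 → a • w + b • w = w := fun a b hab => by
    rw [← add_smul, hab, one_smul]
  have hcont : Continuous fun z : C => z + w := by fun_prop
  refine eq_of_forall_mem_closure_convexHull (w := w) (hw := hw) (X := (fun z => z + w) '' X)
    (hXc.isCompact.image hcont).isClosed ?_ ?_ ?_ ?_
  · rintro _ ⟨x, hx, rfl⟩ _ ⟨y, hy, rfl⟩ a b ha hb hab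
    refine ⟨_, hX hx hy ha hb hab, ?_⟩
    simp only [smul_add]
    rw [add_add_add_comm, hwab a b hab]
  · rintro _ ⟨x, hx, rfl⟩
    exact (face w hw).add_mem (hXw hx) (self_mem_face hw)
  · rintro _ ⟨x, hx, rfl⟩
    rw [add_assoc, hw]
  · intro O hO hd
    have h1 := h ((Prod.map (fun z => z + w) (fun z => z + w)) ⁻¹' O)
      (hO.preimage (hcont.prodMap hcont)) (fun z => hd _)
    refine map_mem_closure (f := Prod.map (fun z => z + w) (fun z => z + w))
      (hcont.prodMap hcont) h1 ?_
    refine convexHull_min (t := Prod.map (fun z => z + w) (fun z => z + w) ⁻¹' _) ?_ ?_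
    · rintro ⟨a, b⟩ ⟨hab, ha, hb⟩
      exact subset_convexHull _ _ ⟨hab, ⟨a, ha, rfl⟩, ⟨b, hb, rfl⟩⟩
    · rintro ⟨x, x'⟩ hx ⟨y, y'⟩ hy a b ha hb hab
      have := convex_convexHull ℝ≥0 _ hx hy ha hb hab
      have e : ∀ x y : C, a • (x + w) + b • (y + w) = a • x + b • y + w := fun x y => by
        rw [smul_add, smul_add, add_add_add_comm, hwab a b hab]
      simp only [Prod.map_apply, Prod.smul_mk, Prod.mk_add_mk, e] at this
      exact this

/-- Otherwise compactness gives a violation with one pair `o` lying in the closed convex hulls for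
all `O`. Its coordinates agree modulo `w`, and cancelling them costs only an element below `w`,
which contradicts `h`. -/
theorem exists_nhd_diag_separating {w : C} {hw : w + w = w} {K T X : Set C} {R : Set (C × C)}
    (hK : IsClosed K) (hT : IsClosed T) (hXc : IsClosed X) (hX : Convex ℝ≥0 X)
    (hXw : X ⊆ face w hw) (hRc : IsClosed R)
    (h : ∀ k ∈ K, ∀ t ∈ T, ∀ r ∈ R, ¬ AlgLE (k + r.2) (t + r.1 + w)) :
    ∃ O : Set (C × C), IsOpen O ∧ (∀ z, (z, z) ∈ O) ∧ ∀ k ∈ K, ∀ t ∈ T, ∀ r ∈ R,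
      ∀ o ∈ closure (convexHull ℝ≥0 (O ∩ X ×ˢ X)),
        ¬ AlgLE (k + (r + o).2) (t + (r + o).1 + w) := by
  by_contra! hcon
  let I := {O : Set (C × C) // IsOpen O ∧ ∀ z, (z, z) ∈ O}
  have : Nonempty I := ⟨⟨univ, isOpen_univ, fun _ => mem_univ _⟩⟩
  let S : I → Set ((C × C) × (C × C) × (C × C)) := fun O =>
    ((K ×ˢ T) ×ˢ (R ×ˢ closure (convexHull ℝ≥0 (O.1 ∩ X ×ˢ X)))) ∩
      {z | AlgLE (z.1.1 + (z.2.1 + z.2.2).2) (z.1.2 + (z.2.1 + z.2.2).1 + w)}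
  have hS : ∀ O, IsClosed (S O) := fun O =>
    ((hK.prod hT).prod (hRc.prod isClosed_closure)).inter
      (isClosed_algLE.preimage (f := fun z : (C × C) × (C × C) × (C × C) =>
        (z.1.1 + (z.2.1 + z.2.2).2, z.1.2 + (z.2.1 + z.2.2).1 + w)) (by fun_prop))
  obtain ⟨⟨⟨k, t⟩, r, o⟩, hz⟩ := IsCompact.nonempty_iInter_of_directed_nonempty_isCompact_isClosed S
    (by
      rintro ⟨O, hO, hOd⟩ ⟨O', hO', hOd'⟩
      have hsub : ∀ {A B : Set (C × C)}, A ⊆ B → closure (convexHull ℝ≥0 (A ∩ X ×ˢ X)) ⊆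
          closure (convexHull ℝ≥0 (B ∩ X ×ˢ X)) := fun hAB =>
        closure_mono (convexHull_mono (inter_subset_inter_left _ hAB))
      refine ⟨⟨O ∩ O', hO.inter hO', fun z => ⟨hOd z, hOd' z⟩⟩, ?_, ?_⟩
      · rintro ⟨⟨k, t⟩, r, o⟩ ⟨⟨h1, h2, h3⟩, h4⟩
        exact ⟨⟨h1, h2, hsub inter_subset_left h3⟩, h4⟩
      · rintro ⟨⟨k, t⟩, r, o⟩ ⟨⟨h1, h2, h3⟩, h4⟩
        exact ⟨⟨h1, h2, hsub inter_subset_right h3⟩, h4⟩)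
    (fun O => by
      obtain ⟨k, hk, t, ht, r, hr, o, ho, hle⟩ := hcon O.1 O.2.1 O.2.2
      exact ⟨((k, t), r, o), ⟨⟨hk, ht⟩, hr, ho⟩, hle⟩)
    (fun O => (hS O).isCompact) hS
  rw [mem_iInter] at hz
  obtain ⟨⟨⟨hk, ht⟩, hr, ho0⟩, hle⟩ := hz this.some
  have ho : ∀ O : Set (C × C), IsOpen O → (∀ z, (z, z) ∈ O) →
      (o.1, o.2) ∈ closure (convexHull ℝ≥0 (O ∩ X ×ˢ X)) := fun O hO hd =>
    (hz ⟨O, hO, hd⟩).1.2.2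
  have hoX := convexHull_prod_subset hX hXc _ ho0
  have h1 := add_eq_add_of_forall_mem_closure_convexHull hXc hX hXw ho
  refine h k hk t ht r hr ?_
  simp only [Prod.fst_add, Prod.snd_add] at hle
  have h2 : AlgLE (k + r.2 + (o.1 + w)) (t + r.1 + w + (o.1 + w)) := by
    rw [h1]
    convert hle.add (AlgLE.refl w) using 1
    · abel
    · rw [← h1]; abel
  refine (le_add_eps_of_add_le_add h2).trans ?_
  have h3 : AlgLE (eps (o.1 + w)) w :=
    mem_face.1 ((face w hw).add_mem (hXw hoX.1) (self_mem_face hw))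
  refine ((AlgLE.refl _).add h3).trans ?_
  rw [add_assoc, hw]
  exact AlgLE.refl _

/-- `R` is the increasing union of closed convex sets, each obtained from the previous one by adding
the closed convex hull of a small neighbourhood of the diagonal of `X n`. Each stage is closed, so
the compactness argument applies to it; the union need not be closed. -/
theorem exists_relation_separating {w : C} {hw : w + w = w} {K T : Set C} {X : ℕ → Set C}
    (hK : IsClosed K) (hT : IsClosed T) (hXc : ∀ n, IsClosed (X n))
    (hX : ∀ n, Convex ℝ≥0 (X n)) (hXw : ∀ n, X n ⊆ face w hw) (hX0 : ∀ n, 0 ∈ X n)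
    (h : ∀ k ∈ K, ∀ t ∈ T, ¬ AlgLE k (t + w)) :
    ∃ R : Set (C × C), Convex ℝ≥0 R ∧ (0, 0) ∈ R ∧
      (∀ k ∈ K, ∀ t ∈ T, ∀ r ∈ R, ¬ AlgLE (k + r.2) (t + r.1 + w)) ∧
      ∀ n, ∃ O : Set (C × C), IsOpen O ∧ (∀ z, (z, z) ∈ O) ∧ O ∩ X n ×ˢ X n ⊆ R := by
  let G : Set (Set (C × C)) := {R | IsClosed R ∧ Convex ℝ≥0 R ∧ (0, 0) ∈ R ∧
    ∀ k ∈ K, ∀ t ∈ T, ∀ r ∈ R, ¬ AlgLE (k + r.2) (t + r.1 + w)}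
  have step : ∀ (n : ℕ) (R : G), ∃ R' : G, R.1 ⊆ R'.1 ∧
      ∃ O : Set (C × C), IsOpen O ∧ (∀ z, (z, z) ∈ O) ∧ O ∩ X n ×ˢ X n ⊆ R'.1 := by
    rintro n ⟨R, hRc, hR, hR0, hRs⟩
    obtain ⟨O, hO, hd, hs⟩ := exists_nhd_diag_separating hK hT (hXc n) (hX n) (hXw n) hRc hRs
    have h0 : ((0, 0) : C × C) ∈ closure (convexHull ℝ≥0 (O ∩ X n ×ˢ X n)) :=
      subset_closure (subset_convexHull _ _ ⟨hd 0, hX0 n, hX0 n⟩)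
    have hcl : Convex ℝ≥0 (closure (convexHull ℝ≥0 (O ∩ X n ×ˢ X n))) := by
      rintro x hx y hy a b ha hb hab
      rcases eq_or_lt_of_le ha with rfl | ha
      · rw [zero_add] at hab
        simpa [hab] using hy
      rcases eq_or_lt_of_le hb with rfl | hb
      · rw [add_zero] at hab
        simpa [hab] using hx
      have hc : ∀ {t : ℝ≥0}, 0 < t → Continuous fun z : C × C => t • z := fun ht =>
        (((continuous_smul_const ht).comp continuous_fst).prodMk
          ((continuous_smul_const ht).comp continuous_snd))
      refine map_mem_closure₂ (f := fun x y => a • x + b • y) ?_ hx hy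
        fun x hx y hy => convex_convexHull ℝ≥0 _ hx hy ha.le hb.le hab
      exact ((hc ha).comp continuous_fst).add ((hc hb).comp continuous_snd)
    refine ⟨⟨(fun p : (C × C) × (C × C) => p.1 + p.2) ''
      (R ×ˢ closure (convexHull ℝ≥0 (O ∩ X n ×ˢ X n))), ?_, ?_, ?_, ?_⟩, ?_, O, hO, hd, ?_⟩
    · exact ((hRc.prod isClosed_closure).isCompact.image (by fun_prop)).isClosed
    · rintro _ ⟨⟨r, o⟩, ⟨hr, ho⟩, rfl⟩ _ ⟨⟨r', o'⟩, ⟨hr', ho'⟩, rfl⟩ a b ha hb hab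
      refine ⟨(a • r + b • r', a • o + b • o'), ⟨hR hr hr' ha hb hab, hcl ho ho' ha hb hab⟩, ?_⟩
      simp only [smul_add]
      abel
    · exact ⟨((0, 0), (0, 0)), ⟨hR0, h0⟩, by simp⟩
    · rintro k hk t ht _ ⟨⟨r, o⟩, ⟨hr, ho⟩, rfl⟩
      exact hs k hk t ht r hr o ho
    · intro r hr
      exact ⟨(r, (0, 0)), ⟨hr, h0⟩, by simp [Prod.mk_zero_zero]⟩
    · intro o ho
      exact ⟨((0, 0), o), ⟨hR0, subset_closure (subset_convexHull _ _ ho)⟩, by simp [Prod.mk_zero_zero]⟩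
  choose next hnext hnextO using step
  have hinit : ({((0 : C), (0 : C))} : Set (C × C)) ∈ G := by
    refine ⟨isClosed_singleton, convex_singleton _, rfl, ?_⟩
    rintro k hk t ht _ rfl
    simpa using h k hk t ht
  let R : ℕ → G := fun n => Nat.rec ⟨_, hinit⟩ (fun n R => next n R) n
  have hmono : Monotone fun n => (R n).1 := monotone_nat_of_le_succ fun n => hnext n (R n)
  refine ⟨⋃ n, (R n).1, ?_, ?_, ?_, fun n => ?_⟩
  · exact hmono.directed_le.convex_iUnion fun n => (R n).2.2.1
  · exact mem_iUnion.2 ⟨0, (R 0).2.2.2.1⟩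
  · intro k hk t ht r hr
    obtain ⟨n, hn⟩ := mem_iUnion.1 hr
    exact (R n).2.2.2.2 k hk t ht r hn
  · obtain ⟨O, h1, h2, h3⟩ := hnextO n (R n)
    exact ⟨O, h1, h2, h3.trans (subset_iUnion (fun n => (R n).1) (n + 1))⟩

theorem isClosed_smul {t : ℝ≥0} (ht : 0 < t) {T : Set C} (hT : IsClosed T) :
    IsClosed ((fun x => t • x) '' T) :=
  (hT.isCompact.image (continuous_smul_const ht)).isClosed

theorem exists_smul_disjoint {T K : Set C} (hT : IsClosed T) (hK : IsClosed K)
    (hTK : Disjoint T K) : ∃ s : ℝ≥0, 1 < s ∧ s ≤ 2 ∧ ∀ t ∈ T, s • t ∉ K := by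
  by_contra! hcon
  have hs : ∀ n : ℕ, (1 : ℝ≥0) < 1 + 1 / ((n : ℝ≥0) + 1) := fun n =>
    lt_add_of_pos_right _ (by positivity)
  choose t ht htK using fun n : ℕ => hcon (1 + 1 / ((n : ℝ≥0) + 1)) (hs n) (by
    rw [← one_add_one_eq_two]
    gcongr
    rw [div_le_one (by positivity)]
    exact le_add_self)
  obtain ⟨t₀, ht₀⟩ := exists_ultrafilter_lim (hyperfilter ℕ) t
  have h1 : Tendsto (fun n : ℕ => 1 + 1 / ((n : ℝ≥0) + 1)) (hyperfilter ℕ : Filter ℕ) (𝓝 1) := by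
    have := (tendsto_const_nhds (x := (1 : ℝ≥0))).add
      (tendsto_one_div_add_atTop_nhds_zero_nat (𝕜 := ℝ≥0))
    rw [add_zero] at this
    exact this.mono_left Nat.hyperfilter_le_atTop
  have h2 := tendsto_smul one_pos h1 ht₀
  rw [one_smul] at h2
  exact hTK.le_bot ⟨hT.mem_of_tendsto ht₀ (Eventually.of_forall ht),
    hK.mem_of_tendsto h2 (Eventually.of_forall htK)⟩

/-- Separation by a linear function that is finite and continuous on a face. -/
theorem exists_linear_continuousAt_face {w : C} {hw : w + w = w} {T K V : Set C}
    (hTc : IsClosed T) (hT : Convex ℝ≥0 T) (hTl : ∀ x y, AlgLE x y → y ∈ T → x ∈ T)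
    (hTw : T ⊆ face w hw) (hTa : ∀ x ∈ T, x + w ∈ T) (hVo : IsOpen V) (hwV : w ∈ V) (hVT : V ⊆ T)
    (hKc : IsClosed K) (hK : Convex ℝ≥0 K) (hKn : K.Nonempty) (hTK : Disjoint T K) :
    ∃ (l : C →ₗ[ℝ≥0] ℝ≥0∞) (c : ℝ≥0∞), 1 < c ∧ (∀ t ∈ T, l t ≤ 1) ∧ (∀ k ∈ K, c ≤ l k) ∧
      ∀ x ∈ face w hw, l x ≠ ∞ ∧ ContinuousAt l x := by
  obtain ⟨s, hs1, hs2, hsK⟩ := exists_smul_disjoint hTc hKc hTK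
  have hs0 : 0 < s := zero_lt_one.trans hs1
  have h0T : (0 : C) ∈ T := hTl 0 w (AlgLE.zero_le _) (hVT hwV)
  have hn0 : ∀ n : ℕ, (0 : ℝ≥0) < (n : ℝ≥0) + 1 := fun n => by positivity
  -- The sets `X n` are the multiples `(n + 1) • T`, which exhaust the face. The target `T` is
  -- enlarged by the factor `s > 1` that Hahn-Banach requires.
  obtain ⟨R, hR, hR0, hRs, hRO⟩ := exists_relation_separating (w := w) (hw := hw) (K := K)
    (T := (fun x => s • x) '' T) (X := fun n => (fun x => ((n : ℝ≥0) + 1) • x) '' T) hKc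
    (isClosed_smul hs0 hTc) (fun n => isClosed_smul (hn0 n) hTc)
    (fun n => hT.smul ((n : ℝ≥0) + 1))
    (by
      rintro n _ ⟨x, hx, rfl⟩
      exact (face w hw).smul_mem _ (hTw hx))
    (fun n => ⟨0, h0T, smul_zero _⟩)
    (by
      rintro k hk _ ⟨t, ht, rfl⟩ hle
      obtain ⟨v, hv⟩ : ∃ v ∈ T, s • v = k := by
        refine ⟨s⁻¹ • k, hTl _ _ ?_ (hTa t ht), by
          rw [smul_smul, mul_inv_cancel₀ hs0.ne', one_smul]⟩
        have := hle.smul s⁻¹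
        rwa [smul_add, smul_smul, inv_mul_cancel₀ hs0.ne', one_smul,
          smul_idem hw (inv_pos.2 hs0)] at this
      exact hsK v hv.1 (hv.2 ▸ hk))
  obtain ⟨l, c, hc, hl1, hl2, hl3⟩ := exists_linear_separating (w := w)
    (fun t ht => smul_idem hw ht) hT hK hR ⟨0, h0T⟩ hKn hR0 hs1 hs2 (by
      intro k hk t ht r hr τ hτ hle
      refine hRs k hk _ ⟨t, ht, rfl⟩ r hr (hle.trans ?_)
      exact ((AlgLE.smul_le_smul hτ t).add (AlgLE.refl _)).add (AlgLE.refl _))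
  refine ⟨l, c, hc, hl1, hl2, fun x hx => ?_⟩
  set V' := {x | ∃ y ∈ V, AlgLE x y} with hV'
  have hV'o : IsOpen V' := isOpen_lowerClosure hVo
  have hV'T : V' ⊆ T := fun y ⟨z, hz, hyz⟩ => hTl _ _ hyz (hVT hz)
  have habs : ∀ x ∈ face w hw, ∃ n : ℕ, ((n : ℝ≥0) + 1)⁻¹ • x ∈ V' := by
    intro x hx
    exact ((tendsto_inv_smul x).eventually (hV'o.mem_nhds ⟨w, hwV, hx⟩)).exists
  have hfin : ∀ x ∈ face w hw, l x ≠ ∞ := by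
    intro x hx
    obtain ⟨n, hn⟩ := habs x hx
    have h1 := hl1 _ (hV'T hn)
    rw [map_smul] at h1
    intro h2
    rw [h2, ENNReal.smul_def, smul_eq_mul, ENNReal.mul_top (by simp)] at h1
    simp at h1
  refine ⟨hfin x hx, (ENNReal.tendsto_nhds (hfin x hx)).2 fun ε hε => ?_⟩
  -- Near `δ⁻¹ • x` the relation `R` bounds the oscillation of `l` by `2`; rescaling bounds it near
  -- `x` by `2δ ≤ ε`.
  obtain ⟨δ, hδ0, hδ⟩ : ∃ δ : ℝ≥0, 0 < δ ∧ (δ : ℝ≥0∞) * 2 ≤ ε := by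
    obtain ⟨δ, hδ0, hδ⟩ := ENNReal.lt_iff_exists_nnreal_btwn.1 (ENNReal.half_pos hε.ne')
    refine ⟨δ, by exact_mod_cast hδ0, ?_⟩
    calc (δ : ℝ≥0∞) * 2 ≤ ε / 2 * 2 := by gcongr
      _ = ε := ENNReal.div_mul_cancel (by simp) (by simp)
  obtain ⟨n, hn⟩ := habs (δ⁻¹ • x) ((face w hw).smul_mem _ hx)
  obtain ⟨O, hO, hd, hOR⟩ := hRO n
  have hc1 : Continuous fun z : C => δ⁻¹ • z := continuous_smul_const (inv_pos.2 hδ0)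
  have hc2 : Continuous fun z : C => ((n : ℝ≥0) + 1)⁻¹ • δ⁻¹ • z :=
    (continuous_smul_const (inv_pos.2 (hn0 n))).comp hc1
  have e1 : ∀ᶠ z in 𝓝 x, ((n : ℝ≥0) + 1)⁻¹ • δ⁻¹ • z ∈ V' :=
    hc2.continuousAt.eventually (hV'o.mem_nhds hn)
  have e2 : ∀ᶠ z in 𝓝 x, (δ⁻¹ • x, δ⁻¹ • z) ∈ O :=
    ((continuous_const (y := δ⁻¹ • x)).prodMk hc1).continuousAt.eventually (hO.mem_nhds (hd _))
  have e3 : ∀ᶠ z in 𝓝 x, (δ⁻¹ • z, δ⁻¹ • x) ∈ O :=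
    (hc1.prodMk (continuous_const (y := δ⁻¹ • x))).continuousAt.eventually (hO.mem_nhds (hd _))
  have hXn : ∀ z, ((n : ℝ≥0) + 1)⁻¹ • z ∈ V' → z ∈ (fun x => ((n : ℝ≥0) + 1) • x) '' T :=
    fun z hz => ⟨_, hV'T hz, by
      simp only; rw [smul_smul, mul_inv_cancel₀ (hn0 n).ne', one_smul]⟩
  have hscale : ∀ a b : C, l (δ⁻¹ • a) ≤ l (δ⁻¹ • b) + 2 → l a ≤ l b + ε := by
    intro a b hab
    have h1 : (δ : ℝ≥0∞) * l (δ⁻¹ • a) ≤ δ * (l (δ⁻¹ • b) + 2) := by gcongr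
    have h2 : ∀ a : C, (δ : ℝ≥0∞) * l (δ⁻¹ • a) = l a := fun a => by
      rw [← smul_eq_mul, ← ENNReal.smul_def, ← map_smul, smul_smul, mul_inv_cancel₀ hδ0.ne',
        one_smul]
    rw [mul_add, h2, h2] at h1
    exact h1.trans (by gcongr)
  filter_upwards [e1, e2, e3] with z h1 h2 h3
  refine ⟨tsub_le_iff_right.2 (hscale _ _ (hl3 _ (hOR ⟨h2, hXn _ hn, hXn _ h1⟩))),
    hscale _ _ (hl3 _ (hOR ⟨h3, hXn _ h1, hXn _ hn⟩))⟩

end IsExtendedChoquetCone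

/-! ### Compact idempotents, open faces and separation. -/

namespace IsExtendedChoquetCone

variable {C : Type*} [AddCommMonoid C] [Module ℝ≥0 C] [TopologicalSpace C]
  [IsExtendedChoquetCone C]

theorem isClosed_idem : IsClosed {w : C | w + w = w} :=
  isClosed_eq (by fun_prop) continuous_id

theorem exists_top : ∃ m : C, ∀ x, AlgLE x m := by
  obtain ⟨m, -, h, -⟩ := exists_lub_of_directed (A := (univ : Set C)) ⟨0, mem_univ _⟩
    fun a _ b _ => ⟨a + b, mem_univ _, AlgLE.self_add _ _, AlgLE.add_self _ _⟩
  exact ⟨m, fun x => h x (mem_univ _)⟩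

theorem face_univ {m : C} (h : ∀ x, AlgLE x m) (hm : m + m = m) : (face m hm : Set C) = univ :=
  eq_univ_of_forall fun _ => h _

/-- A small multiple of a point of the face lies in the open lower closure of a neighbourhood of
`w`, and supports do not change under scaling. -/
theorem isOpen_face_of_mem_nhds {w : C} {hw : w + w = w} (h : (face w hw : Set C) ∈ 𝓝 w) :
    IsOpen (face w hw : Set C) := by
  obtain ⟨V, hVs, hVo, hwV⟩ := mem_nhds_iff.1 h
  have hV'o := isOpen_lowerClosure hVo
  rw [isOpen_iff_mem_nhds]
  intro x hx
  obtain ⟨n, hn⟩ := ((tendsto_inv_smul x).eventually (hV'o.mem_nhds ⟨w, hwV, hx⟩)).exists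
  have hn0 : (0 : ℝ≥0) < ((n : ℝ≥0) + 1)⁻¹ := by positivity
  filter_upwards [(continuous_smul_const hn0).continuousAt.preimage_mem_nhds
    (hV'o.mem_nhds hn)] with z hz
  obtain ⟨y, hy, hzy⟩ := hz
  have h1 : ((n : ℝ≥0) + 1)⁻¹ • z ∈ face w hw := face_lower hzy (hVs hy)
  rw [mem_face, eps_smul _ hn0] at h1
  exact h1

/-- As `x` tends to `w`, the limits of `eps x` are below `w`, so the idempotents `eps x + w` tend to
`w`. If those in `U` were all below `w`, every `x` near `w` would be in the face. -/
theorem exists_idem_of_not_mem_nhds {w : C} {hw : w + w = w} (h : (face w hw : Set C) ∉ 𝓝 w)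
    {U : Set C} (hU : U ∈ 𝓝 w) : ∃ v ∈ U, v + v = v ∧ AlgLE w v ∧ ¬ AlgLE v w := by
  by_contra! hcon
  apply h
  have h1 : ∀ᶠ x in 𝓝 w, eps x + w ∈ U := by
    refine mem_iff_ultrafilter.2 fun u hu => ?_
    obtain ⟨e, he⟩ := exists_ultrafilter_lim u (fun x : C => eps x)
    have hew : AlgLE e w := algLE_of_tendsto (l := (u : Filter C)) (y := id) he hu
      (Eventually.of_forall eps_le)
    refine (he.add_const w).eventually ?_
    rw [add_eq_of_le_idem hw hew]
    exact hU
  filter_upwards [h1] with x hx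
  refine mem_face.2 ((AlgLE.self_add _ _).trans (hcon _ hx ?_ (AlgLE.add_self _ _)))
  rw [add_add_add_comm, eps_add_eps, hw]

/-- For each open convex neighbourhood of `w`, take the supremum of the idempotents above `w` in it.
These suprema have infimum `w`, so by compactness of `w` one of them is below `w`; then the face is
a neighbourhood of `w`. Convexity makes the idempotents in `U` directed, since `a + b = a / 2 + b /
2` for idempotents. -/
theorem isOpen_face_of_isCompactElement {w : C} (hw : w + w = w)
    (h : IsCompactElement (@OrderDual.toDual (Idem C) ⟨w, hw⟩)) : IsOpen (face w hw : Set C) := by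
  refine isOpen_face_of_mem_nhds ?_
  by_contra hn
  have hsup : ∀ U : {U : Set C // IsOpen U ∧ Convex ℝ≥0 U ∧ w ∈ U}, ∃ m : Idem C, m.1 ∈ closure U.1 ∧
      (∀ v ∈ U.1, v + v = v → AlgLE w v → AlgLE v m.1) ∧
      ∀ z, (∀ v ∈ U.1, v + v = v → AlgLE w v → AlgLE v z) → AlgLE m.1 z := by
    rintro ⟨U, hU, hUc, hwU⟩
    obtain ⟨m, hm, h1, h2⟩ := exists_lub_of_directed (A := {v | v ∈ U ∧ v + v = v ∧ AlgLE w v})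
      ⟨w, hwU, hw, AlgLE.refl _⟩ (by
        rintro a ⟨ha, ha', haw⟩ b ⟨hb, hb', hbw⟩
        refine ⟨a + b, ⟨?_, ?_, haw.trans (AlgLE.self_add _ _)⟩, AlgLE.self_add _ _,
          AlgLE.add_self _ _⟩
        · have := hUc ha hb (a := 2⁻¹) (b := 2⁻¹) bot_le bot_le
            (by rw [← two_mul, mul_inv_cancel₀ two_ne_zero])
          rwa [smul_idem ha' (by positivity), smul_idem hb' (by positivity)] at this
        · rw [add_add_add_comm, ha', hb'])
    refine ⟨⟨m, closure_minimal (fun v hv => hv.2.1) isClosed_idem hm⟩,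
      closure_mono (fun v hv => hv.1) hm, fun v h3 h4 h5 => h1 v ⟨h3, h4, h5⟩,
      fun z hz => h2 z fun v hv => hz v hv.1 hv.2.1 hv.2.2⟩
  choose m hmU hm1 hm2 using hsup
  obtain ⟨_, ⟨U, rfl⟩, hU⟩ := h (range fun U => OrderDual.toDual (m U))
    (@OrderDual.toDual (Idem C) ⟨w, hw⟩) ⟨_, ⟨univ, isOpen_univ, convex_univ, mem_univ _⟩, rfl⟩
    (by
      rintro _ ⟨⟨U, hU, hUc, hwU⟩, rfl⟩ _ ⟨⟨V, hV, hVc, hwV⟩, rfl⟩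
      refine ⟨_, ⟨⟨U ∩ V, hU.inter hV, hUc.inter hVc, hwU, hwV⟩, rfl⟩, ?_, ?_⟩
      · exact hm2 _ _ fun v hv h1 h2 => hm1 _ v hv.1 h1 h2
      · exact hm2 _ _ fun v hv h1 h2 => hm1 _ v hv.2 h1 h2)
    (by
      constructor
      · rintro _ ⟨U, rfl⟩
        exact hm1 U w U.2.2.2 hw (AlgLE.refl _)
      · intro v hv
        refine (isClosed_ge (OrderDual.ofDual v).1).closure_subset (mem_closure_iff_nhds.2 ?_)
        intro W hW
        obtain ⟨V, hV, hVc, hwV, hVW⟩ := exists_convex_nhd w hW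
        exact ⟨_, hVW (hmU ⟨V, hV, hVc, hwV⟩), hv ⟨_, rfl⟩⟩)
    le_rfl
  obtain ⟨v, hv, hvi, hwv, hvw⟩ := exists_idem_of_not_mem_nhds hn (U.2.1.mem_nhds U.2.2.2)
  exact hvw ((hm1 U v hv hvi hwv).trans hU)

/-- With an abundance of compact idempotents, an idempotent can be replaced by one with an open
face in strict inequalities. -/
theorem exists_isOpen_face (hC : HasAbundanceOfCompactIdempotents C) {w : C} (hw : w + w = w)
    {K T : Set C} (hK : IsClosed K) (hT : IsClosed T)
    (h : ∀ k ∈ K, ∀ t ∈ T, ¬ AlgLE k (t + w)) :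
    ∃ (v : C) (hv : v + v = v), AlgLE w v ∧ IsOpen (face v hv : Set C) ∧
      ∀ k ∈ K, ∀ t ∈ T, ¬ AlgLE k (t + v) := by
  let A : Set C := {v | ∃ hv : v + v = v, AlgLE w v ∧ IsOpen (face v hv : Set C)}
  have hAne : A.Nonempty := by
    obtain ⟨m, hm⟩ := exists_top (C := C)
    have hmm : m + m = m := algLE_antisymm _ _ (hm _) (AlgLE.self_add _ _)
    exact ⟨m, hmm, hm w, by rw [face_univ hm hmm]; exact isOpen_univ⟩
  have hAdir : ∀ a ∈ A, ∀ b ∈ A, ∃ c ∈ A, AlgLE c a ∧ AlgLE c b := by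
    rintro a ⟨ha, hwa, hao⟩ b ⟨hb, hwb, hbo⟩
    obtain ⟨m, h1, h2, h3⟩ := exists_inf a b
    refine ⟨eps m, ⟨eps_add_eps m, ?_, ?_⟩, (eps_le m).trans h1, (eps_le m).trans h2⟩
    · rw [← eps_idem hw]
      exact eps_mono (h3 _ hwa hwb)
    · convert hao.inter hbo using 1
      ext x
      refine ⟨fun hx => ⟨?_, ?_⟩, fun hx => ?_⟩
      · exact AlgLE.trans hx ((eps_le m).trans h1)
      · exact AlgLE.trans hx ((eps_le m).trans h2)
      · have h4 := eps_mono (h3 _ hx.1 hx.2)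
        rwa [eps_idem (eps_add_eps x)] at h4
  obtain ⟨m, hm, hm1, hm2⟩ := exists_glb_of_directed hAne hAdir
  -- Here the abundance of compact idempotents is used: `w` is the infimum of the compact ones above
  -- it, and their faces are open.
  have hmw : AlgLE m w := by
    obtain ⟨K, hKc, hKw⟩ := hC.2 (@OrderDual.toDual (Idem C) ⟨w, hw⟩)
    refine hKw.2 (show @OrderDual.toDual (Idem C)
      ⟨m, closure_minimal (fun v hv => hv.1) isClosed_idem hm⟩ ∈ _ from fun k hk => ?_)
    exact hm1 _ ⟨(OrderDual.ofDual k).2, hKw.1 hk, isOpen_face_of_isCompactElement _ (hKc k hk)⟩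
  by_contra! hcon
  have : Nonempty A := hAne.coe_sort
  let S : A → Set (C × C) := fun v => (K ×ˢ T) ∩ {p | AlgLE p.1 (p.2 + v)}
  have hS : ∀ v, IsClosed (S v) := fun v => (hK.prod hT).inter
    (isClosed_algLE.preimage (f := fun p : C × C => (p.1, p.2 + v.1)) (by fun_prop))
  obtain ⟨⟨k, t⟩, hz⟩ := IsCompact.nonempty_iInter_of_directed_nonempty_isCompact_isClosed S
    (by
      intro a b
      obtain ⟨c, hc, h1, h2⟩ := hAdir a a.2 b b.2
      exact ⟨⟨c, hc⟩, fun p hp => ⟨hp.1, AlgLE.trans hp.2 ((AlgLE.refl _).add h1)⟩,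
        fun p hp => ⟨hp.1, AlgLE.trans hp.2 ((AlgLE.refl _).add h2)⟩⟩)
    (fun v => by
      obtain ⟨hv, hwv, hvo⟩ := v.2
      obtain ⟨k, hk, t, ht, hle⟩ := hcon v hv hwv hvo
      exact ⟨(k, t), ⟨hk, ht⟩, hle⟩)
    (fun v => (hS v).isCompact) hS
  rw [mem_iInter] at hz
  have h1 : m ∈ {v | AlgLE k (t + v)} := closure_minimal (fun v hv => (hz ⟨v, hv⟩).2)
    (isClosed_algLE.preimage (f := fun v : C => (k, t + v)) (by fun_prop)) hm
  exact h k (hz this.some).1.1 t (hz this.some).1.2 (AlgLE.trans h1 ((AlgLE.refl _).add hmw))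

theorem exists_convex_lower_nhd {w : C} {hw : w + w = w} (ho : IsOpen (face w hw : Set C)) :
    ∃ B V : Set C, IsClosed B ∧ Convex ℝ≥0 B ∧ B ⊆ face w hw ∧ (∀ x ∈ B, x + w ∈ B) ∧
      IsOpen V ∧ w ∈ V ∧ V ⊆ B := by
  obtain ⟨V, hVo, hVc, hwV, hV⟩ := exists_convex_nhd w (ho.mem_nhds (self_mem_face hw))
  refine ⟨{x | ∃ y ∈ (fun z => z + w) '' closure V, AlgLE x y}, V, ?_, ?_, ?_, ?_, hVo, hwV, ?_⟩
  · exact isClosed_lowerClosure (isClosed_closure.isCompact.image (by fun_prop)).isClosed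
  · refine convex_lowerClosure ?_
    rintro _ ⟨x, hx, rfl⟩ _ ⟨y, hy, rfl⟩ a b ha hb hab
    refine ⟨_, convex_closure hVc hx hy ha hb hab, ?_⟩
    simp only [smul_add]
    rw [add_add_add_comm, ← add_smul, hab, one_smul]
  · rintro x ⟨_, ⟨y, hy, rfl⟩, h⟩
    exact face_lower h ((face w hw).add_mem (hV hy) (self_mem_face hw))
  · rintro x ⟨_, ⟨y, hy, rfl⟩, h⟩
    refine ⟨_, ⟨y, hy, rfl⟩, ?_⟩
    have := h.add (AlgLE.refl w)
    rwa [add_assoc, hw] at this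
  · exact fun x hx => ⟨_, ⟨x, subset_closure hx, rfl⟩, AlgLE.self_add _ _⟩

/-- Separation of a closed convex subset of an open face, modulo the idempotent of that face, from
a closed convex set. -/
theorem exists_linear_separating_face {w : C} {hw : w + w = w} (ho : IsOpen (face w hw : Set C))
    {T K : Set C} (hTc : IsClosed T) (hT : Convex ℝ≥0 T) (hTn : T.Nonempty)
    (hTw : T ⊆ face w hw) (hKc : IsClosed K) (hK : Convex ℝ≥0 K) (hKn : K.Nonempty)
    (hTK : ∀ k ∈ K, ∀ t ∈ T, ¬ AlgLE k (t + w)) :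
    ∃ (l : C →ₗ[ℝ≥0] ℝ≥0∞) (c : ℝ≥0∞), 1 < c ∧ (∀ t ∈ T, l t ≤ 1) ∧ (∀ k ∈ K, c ≤ l k) ∧
      ∀ x ∈ face w hw, l x ≠ ∞ ∧ ContinuousAt l x := by
  obtain ⟨B, V, hBc, hB, hBw, hBa, hVo, hwV, hVB⟩ := exists_convex_lower_nhd ho
  -- The separation theorem needs a set containing a neighbourhood of `w`, so `T` is thickened by `δ
  -- • B`. If no `δ` worked, the limit of the terms `δ • b` as `δ → 0` would be below `w`,
  -- contradicting `hTK`.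
  have hδ : ∃ δ : ℝ≥0, 0 < δ ∧ ∀ k ∈ K, ∀ t ∈ T, ∀ b ∈ B, ¬ AlgLE k (t + δ • b) := by
    by_contra! hcon
    have hn0 : ∀ n : ℕ, (0 : ℝ≥0) < 1 / ((n : ℝ≥0) + 1) := fun n => by positivity
    choose k hk t ht b hb hle using fun n : ℕ => hcon _ (hn0 n)
    obtain ⟨k₀, hk₀⟩ := exists_ultrafilter_lim (hyperfilter ℕ) k
    obtain ⟨t₀, ht₀⟩ := exists_ultrafilter_lim (hyperfilter ℕ) t
    obtain ⟨b₀, hb₀⟩ := exists_ultrafilter_lim (hyperfilter ℕ)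
      (fun n : ℕ => (1 / ((n : ℝ≥0) + 1)) • b n)
    have hb₀w := le_of_tendsto_smul hBc hBw (Eventually.of_forall hb)
      ((tendsto_one_div_add_atTop_nhds_zero_nat (𝕜 := ℝ≥0)).mono_left
        Nat.hyperfilter_le_atTop) hb₀
    refine hTK k₀ (hKc.mem_of_tendsto hk₀ (Eventually.of_forall hk)) t₀
      (hTc.mem_of_tendsto ht₀ (Eventually.of_forall ht)) ?_
    exact (algLE_of_tendsto hk₀ (ht₀.add hb₀) (Eventually.of_forall hle)).trans
      ((AlgLE.refl _).add hb₀w)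
  obtain ⟨δ, hδ0, hδ⟩ := hδ
  obtain ⟨t₀, ht₀⟩ := hTn
  set T' := {x | ∃ y ∈ (fun p : C × C => p.1 + δ • p.2) '' (T ×ˢ B), AlgLE x y} with hT'
  have hc : Continuous (fun p : C × C => p.1 + δ • p.2) :=
    continuous_fst.add ((continuous_smul_const hδ0).comp continuous_snd)
  obtain ⟨l, c, h1, h2, h3, h4⟩ := exists_linear_continuousAt_face (w := w) (hw := hw) (T := T')
    (K := K) (V := (fun x => δ⁻¹ • x) ⁻¹' V)
    (isClosed_lowerClosure ((hTc.prod hBc).isCompact.image hc).isClosed)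
    (by
      refine convex_lowerClosure ?_
      rintro _ ⟨⟨x, x'⟩, ⟨hx, hx'⟩, rfl⟩ _ ⟨⟨y, y'⟩, ⟨hy, hy'⟩, rfl⟩ a b ha hb hab
      refine ⟨(a • x + b • y, a • x' + b • y'), ⟨hT hx hy ha hb hab, hB hx' hy' ha hb hab⟩, ?_⟩
      simp only [smul_add, smul_comm δ]
      abel)
    (by
      rintro x y hxy ⟨z, hz, hyz⟩
      exact ⟨z, hz, hxy.trans hyz⟩)
    (by
      rintro x ⟨_, ⟨⟨t, b⟩, ⟨ht, hb⟩, rfl⟩, hx⟩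
      exact face_lower hx ((face w hw).add_mem (hTw ht) ((face w hw).smul_mem _ (hBw hb))))
    (by
      rintro x ⟨_, ⟨⟨t, b⟩, ⟨ht, hb⟩, rfl⟩, hx⟩
      refine ⟨_, ⟨(t, b + w), ⟨ht, hBa _ hb⟩, rfl⟩, ?_⟩
      have := hx.add (AlgLE.refl w)
      simp only [smul_add, smul_idem hw hδ0]
      rwa [add_assoc] at this)
    (hVo.preimage (continuous_smul_const (inv_pos.2 hδ0)))
    (by rw [mem_preimage, smul_idem hw (inv_pos.2 hδ0)]; exact hwV)
    (by
      intro x hx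
      refine ⟨_, ⟨(t₀, δ⁻¹ • x), ⟨ht₀, hVB hx⟩, rfl⟩, ?_⟩
      simp only [smul_smul, mul_inv_cancel₀ hδ0.ne', one_smul]
      exact AlgLE.add_self _ _)
    hKc hK hKn
    (by
      rw [Set.disjoint_left]
      rintro k ⟨_, ⟨⟨t, b⟩, ⟨ht, hb⟩, rfl⟩, hx⟩ hk
      exact hδ k hk t ht b hb hx)
  obtain ⟨b₀, hb₀⟩ : B.Nonempty := ⟨w, hVB hwV⟩
  exact ⟨l, c, h1, fun t ht => h2 t ⟨_, ⟨(t, b₀), ⟨ht, hb₀⟩, rfl⟩, AlgLE.self_add _ _⟩, h3, h4⟩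

/-- An element of the closed convex hull of a closed set dominates a convex combination of points
of any given neighbourhood of that set. -/
theorem exists_sum_le_of_mem_closure_convexHull {X U : Set C} (hX : IsClosed X) (hU : IsOpen U)
    (hXU : X ⊆ U) {x : C} (hx : x ∈ closure (convexHull ℝ≥0 X)) :
    ∃ (n : ℕ) (a : Fin n → ℝ≥0) (y : Fin n → C), ∑ i, a i = 1 ∧ (∀ i, y i ∈ U) ∧
      AlgLE (∑ i, a i • y i) x := by
  classical
  choose! V hVo hVc hxV hVU using fun (y : C) (hy : y ∈ X) =>
    exists_convex_nhd y (hU.mem_nhds (hXU hy))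
  obtain ⟨s, hsX, hs⟩ := hX.isCompact.elim_nhds_subcover V fun y hy => (hVo y hy).mem_nhds (hxV y hy)
  have key : ∀ z ∈ convexHull ℝ≥0 X, ∃ (a : C → ℝ≥0) (y : C → C), ∑ i ∈ s, a i = 1 ∧
      (∀ i ∈ s, y i ∈ V i) ∧ z = ∑ i ∈ s, a i • y i := by
    intro z hz
    obtain ⟨n, t, p, ht, hp, rfl⟩ := exists_fin_of_mem_convexHull hz
    choose c hc using fun k => mem_iUnion₂.1 (hs (hp k))
    choose! y hy hysum using fun (i : C) (hi : i ∈ s) =>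
      exists_sum_eq_smul_of_convex (hVc i (hsX i hi)) ⟨i, hxV i (hsX i hi)⟩
        (Finset.univ.filter fun k => c k = i) t p (by
          intro k hk
          rw [← (Finset.mem_filter.1 hk).2]
          exact (hc k).2)
    refine ⟨fun i => ∑ k with c k = i, t k, y, ?_, hy, ?_⟩
    · rw [Finset.sum_fiberwise_of_maps_to (fun k _ => (hc k).1), ht]
    · rw [← Finset.sum_fiberwise_of_maps_to (s := Finset.univ) (t := s) (fun k _ => (hc k).1)]
      exact Finset.sum_congr rfl fun i hi => hysum i hi
  obtain ⟨u, hu, hux⟩ := mem_closure_iff_ultrafilter.1 hx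
  have key' : ∀ z, ∃ (a : C → ℝ≥0) (y : C → C), z ∈ convexHull ℝ≥0 X → ∑ i ∈ s, a i = 1 ∧
      (∀ i ∈ s, y i ∈ V i) ∧ z = ∑ i ∈ s, a i • y i := fun z => by
    by_cases hz : z ∈ convexHull ℝ≥0 X
    · obtain ⟨a, y, h⟩ := key z hz
      exact ⟨a, y, fun _ => h⟩
    · exact ⟨0, id, fun h => absurd h hz⟩
  choose a y hay using key'
  have hay' : ∀ᶠ z in (u : Filter C), ∑ i ∈ s, a z i = 1 ∧
      (∀ i ∈ s, y z i ∈ V i) ∧ z = ∑ i ∈ s, a z i • y z i := by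
    filter_upwards [hu] with z hz using hay z hz
  have hlim_a : ∀ i ∈ s, ∃ a₀, Tendsto (fun z => a z i) u (𝓝 a₀) := by
    intro i hi
    obtain ⟨a₀, -, h⟩ := (isCompact_Icc (a := (0 : ℝ≥0)) (b := 1)).ultrafilter_le_nhds
      (u.map fun z => a z i) (by
        rw [le_principal_iff]
        change ∀ᶠ z in (u : Filter C), a z i ∈ Icc 0 1
        filter_upwards [hay'] with z hz
        exact ⟨bot_le, hz.1 ▸ Finset.single_le_sum (fun _ _ => bot_le) hi⟩)
    exact ⟨a₀, h⟩
  choose! a₀ ha₀ using hlim_a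
  have hlim_y : ∀ i, ∃ y₀, Tendsto (fun z => y z i) u (𝓝 y₀) := fun i =>
    exists_ultrafilter_lim u _
  choose y₀ hy₀ using hlim_y
  have hlim_v : ∀ i, ∃ v, Tendsto (fun z => a z i • y z i) u (𝓝 v) := fun i =>
    exists_ultrafilter_lim u _
  choose v hv using hlim_v
  have hyU : ∀ i ∈ s, y₀ i ∈ U := fun i hi => hVU i (hsX i hi) (mem_closure_of_tendsto (hy₀ i)
    (hay'.mono fun z hz => hz.2.1 i hi))
  have hsum : ∑ i ∈ s, a₀ i = 1 := tendsto_nhds_unique_of_eventuallyEq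
    (tendsto_finsetSum s fun i hi => ha₀ i hi) tendsto_const_nhds (hay'.mono fun z hz => hz.1)
  have hxv : x = ∑ i ∈ s, v i := by
    refine (tendsto_nhds_unique_of_eventuallyEq (tendsto_finsetSum s fun i _ => hv i)
      (show Tendsto id (u : Filter C) (𝓝 x) from hux) (hay'.mono fun z hz => hz.2.2.symm)).symm
  refine ⟨s.card, fun k => a₀ (s.equivFin.symm k), fun k => y₀ (s.equivFin.symm k), ?_,
    fun k => hyU _ (s.equivFin.symm k).2, ?_⟩
  · rw [s.equivFin.symm.sum_comp (fun i => a₀ i), Finset.sum_coe_sort s a₀, hsum]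
  · rw [s.equivFin.symm.sum_comp (fun i => a₀ (i : C) • y₀ (i : C)),
      Finset.sum_coe_sort s fun i => a₀ i • y₀ i, hxv]
    -- If a weight tends to `0`, the corresponding summand may still have a nonzero limit, of which
    -- only positivity is used. This is why the convex combination is merely dominated by `x`.
    refine AlgLE.sum fun i hi => ?_
    rcases eq_or_lt_of_le (zero_le : 0 ≤ a₀ i) with h | h
    · rw [← h, zero_smul]
      exact AlgLE.zero_le _
    · rw [tendsto_nhds_unique (tendsto_smul h (ha₀ i hi) (hy₀ i)) (hv i)]
      exact AlgLE.refl _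

end IsExtendedChoquetCone

/-! ### Globally continuous linear functions and interpolation. -/

instance : ContinuousConstSMul ℝ≥0 ℝ≥0∞ where
  continuous_const_smul _ := ENNReal.continuous_const_mul ENNReal.coe_ne_top

namespace IsExtendedChoquetCone

variable {C : Type*} [AddCommMonoid C] [Module ℝ≥0 C] [TopologicalSpace C]
  [IsExtendedChoquetCone C]

/-- Separates `0` from the closed convex hull of the complement of a lower neighbourhood `V` of `w`.
A point of that hull below `w` would dominate a combination of points not below `w`, which rescaling
rules out. By homogeneity `m` is large off large multiples of `V`. -/
theorem exists_coercive {w : C} {hw : w + w = w} (ho : IsOpen (face w hw : Set C)) :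
    ∃ (m : C →ₗ[ℝ≥0] ℝ≥0∞) (V : Set C), closure V ⊆ face w hw ∧
      (∀ x ∉ V, 1 < m x) ∧ ∀ x ∈ face w hw, m x ≠ ∞ ∧ ContinuousAt m x := by
  obtain ⟨V₀, hVo, -, hwV, hV⟩ := exists_convex_nhd w (ho.mem_nhds (self_mem_face hw))
  set V := {x | ∃ y ∈ V₀, AlgLE x y} with hVdef
  have hV'o : IsOpen V := isOpen_lowerClosure hVo
  have hclV : closure V ⊆ face w hw := by
    refine (closure_minimal (t := {x | ∃ y ∈ closure V₀, AlgLE x y})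
      (fun x (⟨y, hy, hxy⟩ : ∃ y ∈ V₀, AlgLE x y) => ⟨y, subset_closure hy, hxy⟩)
      (isClosed_lowerClosure isClosed_closure)).trans ?_
    rintro x ⟨y, hy, hxy⟩
    exact face_lower hxy (hV hy)
  rcases (Vᶜ).eq_empty_or_nonempty with hE | hE
  · refine ⟨0, V, hclV, fun x hx => absurd hx ?_, fun x _ => ⟨by simp, ?_⟩⟩
    · simp [compl_empty_iff.1 hE]
    · exact continuousAt_const
  obtain ⟨m, c, hc, -, hm, hmc⟩ := exists_linear_separating_face (hw := hw) ho (T := {0})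
    (K := closure (convexHull ℝ≥0 Vᶜ)) isClosed_singleton (convex_singleton 0) ⟨0, rfl⟩
    (by rintro _ rfl; exact (face w hw).zero_mem)
    isClosed_closure (convex_closure (convex_convexHull ℝ≥0 _))
    (hE.mono ((subset_convexHull ℝ≥0 _).trans subset_closure))
    (by
      rintro k hk _ rfl hkw
      rw [zero_add] at hkw
      obtain ⟨n, a, y, ha, hy, hle⟩ := exists_sum_le_of_mem_closure_convexHull hV'o.isClosed_compl
        (isClosed_le w).isOpen_compl (fun x hx hxw => hx ⟨w, hwV, hxw⟩) hk
      obtain ⟨i, -, hi⟩ := Finset.exists_ne_zero_of_sum_ne_zero (ha ▸ one_ne_zero : ∑ i, a i ≠ 0)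
      have h1 := ((AlgLE.single_le_sum (fun i => a i • y i) (Finset.mem_univ i)).trans
        (hle.trans hkw)).smul (a i)⁻¹
      rw [smul_smul, inv_mul_cancel₀ hi, one_smul, smul_idem hw
        (inv_pos.2 (pos_iff_ne_zero.2 hi))] at h1
      exact hy i h1)
  exact ⟨m, V, hclV, fun x hx => hc.trans_le
    (hm x (subset_closure (subset_convexHull ℝ≥0 _ hx))), hmc⟩

open Classical in
/-- The extension of a linear function on a face by the value `∞`. -/
noncomputable def extendTop (w : C) (hw : w + w = w) (l : C →ₗ[ℝ≥0] ℝ≥0∞) : C →ₗ[ℝ≥0] ℝ≥0∞ where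
  toFun x := if x ∈ face w hw then l x else ∞
  map_add' x y := by
    by_cases hx : x ∈ face w hw
    · by_cases hy : y ∈ face w hw
      · rw [if_pos hx, if_pos hy, if_pos ((face w hw).add_mem hx hy), map_add]
      · rw [if_neg hy, if_neg fun h => hy (face_lower (AlgLE.add_self _ _) h), add_top]
    · rw [if_neg hx, if_neg fun h => hx (face_lower (AlgLE.self_add _ _) h), top_add]
  map_smul' t x := by
    rcases eq_or_ne t 0 with rfl | ht
    · simp
    · by_cases hx : x ∈ face w hw
      · rw [if_pos hx, if_pos ((face w hw).smul_mem _ hx), map_smul, RingHom.id_apply]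
      · rw [if_neg hx, if_neg fun h => hx ?_, RingHom.id_apply, ENNReal.smul_def, smul_eq_mul,
          ENNReal.mul_top (by simpa)]
        have := (face w hw).smul_mem t⁻¹ h
        rwa [smul_smul, inv_mul_cancel₀ ht, one_smul] at this

theorem extendTop_of_mem {w : C} {hw : w + w = w} (l : C →ₗ[ℝ≥0] ℝ≥0∞) {x : C}
    (hx : x ∈ face w hw) : extendTop w hw l x = l x := if_pos hx

theorem extendTop_of_notMem {w : C} {hw : w + w = w} (l : C →ₗ[ℝ≥0] ℝ≥0∞) {x : C}
    (hx : x ∉ face w hw) : extendTop w hw l x = ∞ := if_neg hx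

/-- A point outside the face has, for every `N`, a neighbourhood that misses a large multiple of the
compact set `closure V`; there `η • m` exceeds `N`, so the value `∞` fits continuously. -/
theorem continuous_extendTop {w : C} {hw : w + w = w} (ho : IsOpen (face w hw : Set C))
    {l m : C →ₗ[ℝ≥0] ℝ≥0∞} {V : Set C} (hV : closure V ⊆ face w hw) (hm : ∀ x ∉ V, 1 < m x)
    (hmc : ∀ x ∈ face w hw, ContinuousAt m x) (hlc : ∀ x ∈ face w hw, ContinuousAt l x)
    {η : ℝ≥0} (hη : 0 < η) : Continuous (extendTop w hw (l + η • m)) := by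
  rw [continuous_iff_continuousAt]
  intro x
  by_cases hx : x ∈ face w hw
  · have h1 : (l + η • m : C →ₗ[ℝ≥0] ℝ≥0∞) =ᶠ[𝓝 x] extendTop w hw (l + η • m) := by
      filter_upwards [ho.mem_nhds hx] with y hy
      rw [extendTop_of_mem _ hy]
    refine ContinuousAt.congr ?_ h1
    exact (hlc x hx).add ((hmc x hx).const_smul η)
  · rw [ContinuousAt, extendTop_of_notMem _ hx, ENNReal.tendsto_nhds_top_iff_nnreal]
    intro N
    have hN : 0 < (N / η + 1) := by positivity
    have h1 : IsClosed ((fun x => (N / η + 1) • x) '' closure V) := isClosed_smul hN isClosed_closure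
    have h2 : (fun x => (N / η + 1) • x) '' closure V ⊆ face w hw := by
      rintro _ ⟨y, hy, rfl⟩
      exact (face w hw).smul_mem _ (hV hy)
    filter_upwards [h1.isOpen_compl.mem_nhds fun h => hx (h2 h)] with y hy
    by_cases hyw : y ∈ face w hw
    · rw [extendTop_of_mem _ hyw, LinearMap.add_apply, LinearMap.smul_apply]
      have h3 : (N / η + 1)⁻¹ • y ∉ V := fun h => hy ⟨_, subset_closure h, by
        simp only; rw [smul_smul, mul_inv_cancel₀ hN.ne', one_smul]⟩
      have h4 : ((N / η + 1 : ℝ≥0) : ℝ≥0∞) < m y := by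
        have h5 := hm _ h3
        rw [map_smul, ENNReal.smul_def, smul_eq_mul, ENNReal.coe_inv hN.ne', mul_comm,
          ← div_eq_mul_inv, ENNReal.lt_div_iff_mul_lt (by simp) (by simp), one_mul] at h5
        exact h5
      calc (N : ℝ≥0∞) ≤ η • ((N / η + 1 : ℝ≥0) : ℝ≥0∞) := by
            rw [ENNReal.smul_def, smul_eq_mul, ← ENNReal.coe_mul, ENNReal.coe_le_coe, mul_add,
              mul_div_cancel₀ _ hη.ne']
            exact le_self_add
        _ < η • m y := by
            rw [ENNReal.smul_def, ENNReal.smul_def, smul_eq_mul, smul_eq_mul]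
            exact ENNReal.mul_lt_mul_right (by simpa using hη.ne') ENNReal.coe_ne_top h4
        _ ≤ _ := le_add_self
    · rw [extendTop_of_notMem _ hyw]
      exact ENNReal.coe_lt_top

/-- Separation of closed convex sets by a continuous linear function. -/
theorem exists_continuous_separating (hC : HasAbundanceOfCompactIdempotents C) {w : C}
    {hw : w + w = w} {T K : Set C} (hTc : IsClosed T) (hT : Convex ℝ≥0 T) (hTn : T.Nonempty)
    (hTw : T ⊆ face w hw) (hKc : IsClosed K) (hK : Convex ℝ≥0 K)
    (hTK : ∀ k ∈ K, ∀ t ∈ T, ¬ AlgLE k (t + w)) :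
    ∃ g : C →ₗ[ℝ≥0] ℝ≥0∞, Continuous g ∧ (∀ t ∈ T, g t < 1) ∧ ∀ k ∈ K, 1 < g k := by
  rcases K.eq_empty_or_nonempty with rfl | hKn
  · exact ⟨0, continuous_const, by simp, by simp⟩
  obtain ⟨v, hv, hwv, ho, hTK'⟩ := exists_isOpen_face hC hw hKc hTc hTK
  have hTv : T ⊆ face v hv := fun t ht => AlgLE.trans (hTw ht) hwv
  obtain ⟨l, c, hc, h1, h2, h3⟩ := exists_linear_separating_face (hw := hv) ho hTc hT hTn hTv hKc
    hK hKn hTK'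
  obtain ⟨m, V, hV, hmV, hm⟩ := exists_coercive (hw := hv) ho
  obtain ⟨M, hM0, hM⟩ : ∃ M : ℝ≥0, 0 < M ∧ ∀ t ∈ T, m t ≤ M := by
    obtain ⟨t, ht, hmax⟩ := hTc.isCompact.exists_isMaxOn hTn
      (f := m) (fun x hx => (hm x (hTv hx)).2.continuousWithinAt)
    refine ⟨(m t).toNNReal + 1, by positivity, fun s hs => (hmax hs).trans ?_⟩
    rw [ENNReal.coe_add, ENNReal.coe_toNNReal (hm t (hTv ht)).1]
    exact le_self_add
  -- With `1 < q < r < c`, the multiple `η` of `m` is chosen so that `l + η • m` is at most `q` on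
  -- `T`; it is at least `c` on the part of `K` in the face, and division by `r` separates the two.
  obtain ⟨r, hr1, hrc⟩ := ENNReal.lt_iff_exists_nnreal_btwn.1 hc
  obtain ⟨q, hq1, hqr⟩ := exists_between (show (1 : ℝ≥0) < r by exact_mod_cast hr1)
  have hr0 : 0 < r := zero_lt_one.trans (hq1.trans hqr)
  set η : ℝ≥0 := (q - 1) / M with hη
  have hη0 : 0 < η := div_pos (tsub_pos_of_lt hq1) hM0
  have hscale : ∀ x : ℝ≥0∞, (r⁻¹ • x : ℝ≥0∞) = x / r := fun x => by
    rw [ENNReal.smul_def, smul_eq_mul, ENNReal.coe_inv hr0.ne', mul_comm, div_eq_mul_inv]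
  have hr0' : (r : ℝ≥0∞) ≠ 0 := by exact_mod_cast hr0.ne'
  refine ⟨r⁻¹ • extendTop v hv (l + η • m), ?_, fun t ht => ?_, fun k hk => ?_⟩
  · exact (continuous_extendTop ho hV hmV (fun x hx => (hm x hx).2)
      (fun x hx => (h3 x hx).2) hη0).const_smul (r⁻¹ : ℝ≥0)
  · rw [LinearMap.smul_apply, hscale, extendTop_of_mem _ (hTv ht),
      ENNReal.div_lt_iff (Or.inl hr0') (Or.inl ENNReal.coe_ne_top), one_mul]
    calc (l + η • m) t ≤ 1 + η • (M : ℝ≥0∞) := by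
          rw [LinearMap.add_apply, LinearMap.smul_apply]
          refine add_le_add (h1 t ht) ?_
          rw [ENNReal.smul_def, ENNReal.smul_def, smul_eq_mul, smul_eq_mul]
          gcongr
          exact hM t ht
      _ = (q : ℝ≥0) := by
          rw [ENNReal.smul_def, smul_eq_mul, ← ENNReal.coe_mul, hη, div_mul_cancel₀ _ hM0.ne',
            ← ENNReal.coe_one, ← ENNReal.coe_add, add_tsub_cancel_of_le hq1.le]
      _ < r := by exact_mod_cast hqr
  · rw [LinearMap.smul_apply, hscale, ENNReal.lt_div_iff_mul_lt (Or.inl hr0')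
      (Or.inl ENNReal.coe_ne_top), one_mul]
    by_cases hkv : k ∈ face v hv
    · rw [extendTop_of_mem _ hkv]
      exact (hrc.trans_le (h2 k hk)).trans_le le_self_add
    · rw [extendTop_of_notMem _ hkv]
      exact ENNReal.coe_lt_top

theorem map_eps_eq_zero {f : C →ₗ[ℝ≥0] ℝ≥0∞} {x : C} (h : f x ≠ ∞) : f (eps x) = 0 := by
  have h1 : f (eps x) ≠ ∞ := ne_top_of_le_ne_top h (AlgLE.map (eps_le x))
  have h2 : f (eps x) + f (eps x) = f (eps x) + 0 := by
    rw [← map_add, eps_add_eps, add_zero]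
  exact (ENNReal.add_right_inj h1).1 h2

/-- The largest zero of a lower semicontinuous linear function. -/
theorem exists_max_zero {f : C →ₗ[ℝ≥0] ℝ≥0∞} (hf : LowerSemicontinuous f) :
    ∃ w : C, w + w = w ∧ f w = 0 ∧ ∀ x, f x = 0 → AlgLE x w := by
  obtain ⟨w, hw, h1, h2⟩ := exists_lub_of_directed (A := {x | f x = 0}) ⟨0, map_zero f⟩
    (fun a ha b hb => ⟨a + b, by
      rw [mem_ofPred_eq] at ha hb ⊢
      rw [map_add, ha, hb, add_zero], AlgLE.self_add _ _, AlgLE.add_self _ _⟩)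
  have hcl : IsClosed {x | f x = 0} := by
    have := hf.isClosed_preimage 0
    convert this using 1
    ext x
    simp
  have hfw : f w = 0 := hcl.closure_subset hw
  refine ⟨w, algLE_antisymm _ _ (h1 _ ?_) (AlgLE.self_add _ _), hfw, h1⟩
  rw [mem_ofPred_eq, map_add, hfw, add_zero]

/-- The sublevel set `{f ≤ 1}` lies in the face of the largest zero `w` of `f`. If a point of the
closed convex hull of `K` were below `t + w` with `f t ≤ 1`, it would dominate a convex combination
of points of `{f > 1}`, which is impossible as `f w = 0`. -/
theorem exists_continuous_between (hC : HasAbundanceOfCompactIdempotents C)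
    {f : C →ₗ[ℝ≥0] ℝ≥0∞} (hf : LowerSemicontinuous f) {K : Set C} (hK : IsClosed K)
    (hKf : ∀ k ∈ K, 1 < f k) :
    ∃ g : C →ₗ[ℝ≥0] ℝ≥0∞, Continuous g ∧ (∀ k ∈ K, 1 < g k) ∧ ∀ x, 1 ≤ g x → 1 < f x := by
  obtain ⟨w, hw, hfw, hmax⟩ := exists_max_zero hf
  obtain ⟨g, hg, h1, h2⟩ := exists_continuous_separating hC (w := w) (hw := hw)
    (T := {x | f x ≤ 1}) (K := closure (convexHull ℝ≥0 K)) (hf.isClosed_preimage 1)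
    (by
      intro x hx y hy a b ha hb hab
      rw [mem_ofPred_eq] at hx hy ⊢
      rw [map_add, map_smul, map_smul, ENNReal.smul_def, ENNReal.smul_def, smul_eq_mul, smul_eq_mul]
      calc (a : ℝ≥0∞) * f x + b * f y ≤ a * 1 + b * 1 := by gcongr
        _ = 1 := by rw [mul_one, mul_one, ← ENNReal.coe_add, hab, ENNReal.coe_one])
    ⟨0, by simp⟩
    (fun x hx => hmax _ (map_eps_eq_zero (ne_top_of_le_ne_top ENNReal.one_ne_top hx)))
    isClosed_closure (convex_closure (convex_convexHull ℝ≥0 _))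
    (by
      intro k hk t ht hle
      obtain ⟨n, a, y, ha, hy, hsum⟩ := exists_sum_le_of_mem_closure_convexHull hK
        (hf.isOpen_preimage 1) hKf hk
      have h3 := (hsum.trans hle).map (f := f)
      rw [map_add, hfw, add_zero, map_sum] at h3
      have h4 : ∑ i, (a i : ℝ≥0∞) < ∑ i, f (a i • y i) := by
        obtain ⟨i, -, hi⟩ := Finset.exists_ne_zero_of_sum_ne_zero
          (ha ▸ one_ne_zero : ∑ i, a i ≠ 0)
        have h5 : ∀ i, f (a i • y i) = a i * f (y i) := fun i => by
          rw [map_smul, ENNReal.smul_def, smul_eq_mul]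
        simp only [h5]
        rw [← Finset.sum_erase_add _ _ (Finset.mem_univ i),
          ← Finset.sum_erase_add _ _ (Finset.mem_univ i)]
        refine ENNReal.add_lt_add_of_le_of_lt (ENNReal.sum_ne_top.2 fun _ _ => ENNReal.coe_ne_top)
          (Finset.sum_le_sum fun j _ => ?_) ?_
        · exact le_mul_of_one_le_right bot_le (hy j).le
        · calc (a i : ℝ≥0∞) = a i * 1 := (mul_one _).symm
            _ < a i * f (y i) := ENNReal.mul_lt_mul_right (by simpa using hi) ENNReal.coe_ne_top (hy i)
      rw [← ENNReal.ofNNReal_finsetSum, ha, ENNReal.coe_one] at h4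
      exact absurd (h4.trans_le (h3.trans ht)) (lt_irrefl _))
  refine ⟨g, hg, fun k hk => h2 k (subset_closure (subset_convexHull ℝ≥0 _ hk)), fun x hx => ?_⟩
  by_contra! h
  exact absurd hx (h1 x h).not_ge

end IsExtendedChoquetCone

theorem ENNReal.nnreal_smul_eq (t : ℝ≥0) (x : ℝ≥0∞) : t • x = (t : ℝ≥0∞) * x := by
  rw [ENNReal.smul_def, smul_eq_mul]

theorem ENNReal.iSup_mul_iSup_of_monotone {a b : ℕ → ℝ≥0∞} (ha : Monotone a) (hb : Monotone b) :
    (⨆ n, a n) * ⨆ n, b n = ⨆ n, a n * b n := by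
  refine le_antisymm ?_ (iSup_le fun n => mul_le_mul' (le_iSup a n) (le_iSup b n))
  rw [ENNReal.iSup_mul]
  refine iSup_le fun i => ?_
  rw [ENNReal.mul_iSup]
  refine iSup_le fun j => le_iSup_of_le (max i j) ?_
  exact mul_le_mul' (ha (le_max_left _ _)) (hb (le_max_right _ _))

/-! ### The Cu-cone of lower semicontinuous linear functions. -/

section LinearOrderHom

variable {C : Type*} [AddCommMonoid C] [Module ℝ≥0 C]

/-- Linear functions are compared on their open unit sublevel sets. -/
theorem LinearMap.le_of_forall_one_lt {f g : C →ₗ[ℝ≥0] ℝ≥0∞} (h : ∀ x, 1 < f x → 1 ≤ g x) (x : C) :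
    f x ≤ g x := by
  by_contra! hlt
  obtain ⟨r, hr1, hr2⟩ := ENNReal.lt_iff_exists_nnreal_btwn.1 hlt
  have hr : r ≠ 0 := by rintro rfl; simp at hr1
  have hr' : (r : ℝ≥0∞) ≠ 0 := by exact_mod_cast hr
  have e : ∀ f : C →ₗ[ℝ≥0] ℝ≥0∞, f (r⁻¹ • x) = f x / r := fun f => by
    rw [map_smul, ENNReal.nnreal_smul_eq, ENNReal.coe_inv hr, mul_comm, div_eq_mul_inv]
  have h1 := h (r⁻¹ • x) (by
    rw [e, ENNReal.lt_div_iff_mul_lt (Or.inl hr') (Or.inl ENNReal.coe_ne_top), one_mul]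
    exact hr2)
  rw [e, ENNReal.le_div_iff_mul_le (Or.inl hr') (Or.inl ENNReal.coe_ne_top), one_mul] at h1
  exact absurd h1 hr1.not_ge

/-- The pointwise supremum of an increasing sequence of linear functions. -/
noncomputable def LinearMap.iSupOfMonotone (f : ℕ → C →ₗ[ℝ≥0] ℝ≥0∞)
    (hf : ∀ x, Monotone fun n => f n x) : C →ₗ[ℝ≥0] ℝ≥0∞ where
  toFun x := ⨆ n, f n x
  map_add' x y := by
    simp only [map_add]
    exact (ENNReal.iSup_add_iSup_of_monotone (hf x) (hf y)).symm
  map_smul' t x := by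
    simp only [map_smul, ENNReal.nnreal_smul_eq, RingHom.id_apply]
    exact ENNReal.mul_iSup _ _ |>.symm

/-- `f` attains a minimum above `1` on the compact set `{c ≥ 1}`, and homogeneity turns this into a
multiplicative gap everywhere. -/
theorem LinearMap.exists_gap [TopologicalSpace C] [CompactSpace C] {c f : C →ₗ[ℝ≥0] ℝ≥0∞} (hc : Continuous c)
    (hf : LowerSemicontinuous f) (h : ∀ x, 1 ≤ c x → 1 < f x) :
    ∃ η : ℝ≥0, 1 < η ∧ ∀ x, η * c x ≤ f x := by
  have hcl : IsCompact {x | 1 ≤ c x} := (isClosed_le continuous_const hc).isCompact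
  obtain ⟨η, hη, hη'⟩ : ∃ η : ℝ≥0, 1 < η ∧ ∀ x, 1 ≤ c x → (η : ℝ≥0∞) ≤ f x := by
    rcases {x | 1 ≤ c x}.eq_empty_or_nonempty with he | hne
    · exact ⟨2, one_lt_two, fun x hx => absurd (show x ∈ {x | 1 ≤ c x} from hx) (by simp [he])⟩
    · obtain ⟨y, hy, hmin⟩ := hf.lowerSemicontinuousOn _ |>.exists_isMinOn hne hcl
      obtain ⟨η, h1, h2⟩ := ENNReal.lt_iff_exists_nnreal_btwn.1 (h y hy)
      exact ⟨η, by exact_mod_cast h1, fun x hx => h2.le.trans (hmin hx)⟩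
  refine ⟨η, hη, fun x => ?_⟩
  have hη0 : η ≠ 0 := (zero_lt_one.trans hη).ne'
  have := LinearMap.le_of_forall_one_lt (f := η • c) (g := f) (fun x hx => ?_) x
  · simpa [ENNReal.nnreal_smul_eq] using this
  · have e : ∀ g : C →ₗ[ℝ≥0] ℝ≥0∞, (η : ℝ≥0∞) * g x = g (η • x) := fun g => by
      rw [map_smul, ENNReal.nnreal_smul_eq]
    rw [LinearMap.smul_apply, ENNReal.nnreal_smul_eq, e] at hx
    have h1 := hη' _ hx.le
    rw [← e] at h1
    by_contra! hlt
    have := ENNReal.mul_lt_mul_right (a := (η : ℝ≥0∞)) (by simpa) ENNReal.coe_ne_top hlt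
    rw [mul_one] at this
    exact absurd h1 this.not_ge

end LinearOrderHom

namespace LscSigma

variable {C : Type*} [AddCommMonoid C] [Module ℝ≥0 C] [TopologicalSpace C] [T2Space C]

theorem le_iff {f g : LscSigma C} : f ≤ g ↔ ∀ x, f.1 x ≤ g.1 x := Iff.rfl

theorem add_apply (f g : LscSigma C) (x : C) : (f + g).1 x = f.1 x + g.1 x := rfl

theorem smul_apply (t : ℝ≥0) (f : LscSigma C) (x : C) : (t • f).1 x = t * f.1 x := by
  rw [← ENNReal.nnreal_smul_eq]; rfl

/-- The supremum of an increasing sequence in `LscSigma C`. -/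
noncomputable def iSupOfMonotone (f : ℕ → LscSigma C) (hf : Monotone f) : LscSigma C :=
  ⟨LinearMap.iSupOfMonotone (fun n => (f n).1) fun x _ _ h => hf h x, by
    refine ⟨lowerSemicontinuous_iSup fun n => (f n).2.1, fun a => ?_⟩
    have : {x | (a : ℝ≥0∞) < ⨆ n, (f n).1 x} = ⋃ n, {x | (a : ℝ≥0∞) < (f n).1 x} := by
      ext x
      simp [lt_iSup_iff]
    exact this ▸ isSigmaCompact_iUnion _ fun n => (f n).2.2 a⟩

theorem isLUB_iSupOfMonotone (f : ℕ → LscSigma C) (hf : Monotone f) :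
    IsLUB (range f) (iSupOfMonotone f hf) := by
  constructor
  · rintro _ ⟨n, rfl⟩ x
    exact le_iSup (fun n => (f n).1 x) n
  · intro g hg x
    exact iSup_le fun n => hg ⟨n, rfl⟩ x

theorem isLUB_iff {f : ℕ → LscSigma C} (hf : Monotone f) {g : LscSigma C} :
    IsLUB (range f) g ↔ ∀ x, g.1 x = ⨆ n, (f n).1 x := by
  constructor
  · intro h x
    rw [h.unique (isLUB_iSupOfMonotone f hf)]
    rfl
  · intro h
    have : g = iSupOfMonotone f hf := Subtype.ext (LinearMap.ext h)
    exact this ▸ isLUB_iSupOfMonotone f hf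

/-- Continuous linear functions on a compact cone belong to `LscSigma`. -/
def ofContinuous [CompactSpace C] (g : C →ₗ[ℝ≥0] ℝ≥0∞) (hg : Continuous g) : LscSigma C :=
  ⟨g, hg.lowerSemicontinuous, fun a => by
    have : {x | (a : ℝ≥0∞) < g x} = ⋃ q : {q : ℚ // (a : ℝ≥0∞) < Real.toNNReal q},
        {x | (Real.toNNReal q.1 : ℝ≥0∞) ≤ g x} := by
      ext x
      simp only [mem_ofPred_eq, mem_iUnion]
      constructor
      · intro h
        obtain ⟨q, -, h1, h2⟩ := ENNReal.lt_iff_exists_rat_btwn.1 h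
        exact ⟨⟨q, h1⟩, h2.le⟩
      · rintro ⟨q, hq⟩
        exact q.2.trans_le hq
    rw [this]
    exact isSigmaCompact_iUnion_of_isCompact _ fun q =>
      (isClosed_le continuous_const hg).isCompact⟩

/-- The compact set `{c ≥ 1}` is covered by the increasing open sets `{y n > 1}`, hence by one of
them. -/
theorem seqWayBelow_of_gap [CompactSpace C] {f g : LscSigma C} {c : C →ₗ[ℝ≥0] ℝ≥0∞} (hc : Continuous c)
    {η : ℝ≥0} (hη : 1 < η) (hf : ∀ x, f.1 x ≤ c x) (hg : ∀ x, η * c x ≤ g.1 x) :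
    SeqWayBelow f g := by
  intro y z hy hz hgz
  rw [isLUB_iff hy] at hz
  have hcl : IsCompact {x | 1 ≤ c x} := (isClosed_le continuous_const hc).isCompact
  obtain ⟨n, hn⟩ := hcl.elim_directed_cover (fun n => {x | 1 < (y n).1 x})
    (fun n => (y n).2.1.isOpen_preimage 1)
    (by
      intro x hx
      have h1 : 1 < z.1 x := by
        refine lt_of_lt_of_le ?_ ((hg x).trans (hgz x))
        calc (1 : ℝ≥0∞) < η := by exact_mod_cast hη
          _ = η * 1 := (mul_one _).symm
          _ ≤ η * c x := by gcongr; exact hx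
      rw [hz x] at h1
      exact mem_iUnion.2 (lt_iSup_iff.1 h1))
    (Monotone.directed_le fun n m hnm x hx => lt_of_lt_of_le hx (hy hnm x))
  refine ⟨n, fun x => (hf x).trans ?_⟩
  exact LinearMap.le_of_forall_one_lt (fun x hx => (hn (show 1 ≤ c x from hx.le)).le) x

variable {C : Type*} [AddCommMonoid C] [Module ℝ≥0 C] [TopologicalSpace C]
  [IsExtendedChoquetCone C]

/-- Write `{f > 1}` as a union of compact sets `K n`. Interpolation is applied recursively, the next
function exceeding `1` on `K n` and on the compact set where the previous one is at least `1`. -/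
theorem exists_seq_continuous (hC : HasAbundanceOfCompactIdempotents C) (f : LscSigma C) :
    ∃ c : ℕ → C →ₗ[ℝ≥0] ℝ≥0∞, (∀ n, Continuous (c n)) ∧ (∀ n x, 1 ≤ c n x → 1 < c (n + 1) x) ∧
      (∀ n x, 1 ≤ c n x → 1 < f.1 x) ∧ (∀ x, Monotone fun n => c n x) ∧
      ∀ x, f.1 x = ⨆ n, c n x := by
  obtain ⟨K, hK, hKf⟩ := f.2.2 1
  let G : Set (C →ₗ[ℝ≥0] ℝ≥0∞) := {g | Continuous g ∧ ∀ x, 1 ≤ g x → 1 < f.1 x}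
  have step : ∀ (n : ℕ) (g : G), ∃ g' : G, (∀ x, 1 ≤ g.1 x → 1 < g'.1 x) ∧ ∀ x ∈ K n, 1 < g'.1 x := by
    rintro n ⟨g, hg, hgf⟩
    obtain ⟨g', h1, h2, h3⟩ := IsExtendedChoquetCone.exists_continuous_between hC f.2.1
      (K := {x | 1 ≤ g x} ∪ K n) ((isClosed_le continuous_const hg).union (hK n).isClosed) (by
        rintro k (hk | hk)
        · exact hgf k hk
        · have : k ∈ {x | ((1 : ℝ≥0) : ℝ≥0∞) < f.1 x} := hKf ▸ mem_iUnion.2 ⟨n, hk⟩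
          simpa using this)
    exact ⟨⟨g', h1, h3⟩, fun x hx => h2 x (Or.inl hx), fun x hx => h2 x (Or.inr hx)⟩
  choose next hn1 hn2 using step
  let c : ℕ → G := fun n => Nat.rec ⟨0, continuous_const, by simp⟩ (fun n g => next n g) n
  have hc : ∀ n x, 1 ≤ (c n).1 x → 1 < (c (n + 1)).1 x := fun n => hn1 n (c n)
  refine ⟨fun n => (c n).1, fun n => (c n).2.1, hc, fun n => (c n).2.2, fun x =>
    monotone_nat_of_le_succ fun n => LinearMap.le_of_forall_one_lt (fun x hx => (hc n x hx.le).le) x,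
    fun x => le_antisymm ?_ ?_⟩
  · have hmono : ∀ x, Monotone fun n => (c n).1 x := fun x => monotone_nat_of_le_succ
      fun n => LinearMap.le_of_forall_one_lt (fun x hx => (hc n x hx.le).le) x
    refine LinearMap.le_of_forall_one_lt (g := LinearMap.iSupOfMonotone _ hmono) (fun x hx => ?_) x
    have : x ∈ ⋃ n, K n := hKf ▸ (by simpa using hx)
    obtain ⟨n, hn⟩ := mem_iUnion.1 this
    exact (hn2 n (c n) x hn).le.trans (le_iSup (fun n => (c n).1 x) (n + 1))
  · exact iSup_le fun n => LinearMap.le_of_forall_one_lt (fun x hx => ((c n).2.2 x hx.le).le) x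

/-- With `seqWayBelow_of_gap` this characterizes `f ≪ g`, and both O4 and O5 are read off from it.
-/
theorem exists_gap_of_seqWayBelow (hC : HasAbundanceOfCompactIdempotents C) {f g : LscSigma C}
    (h : SeqWayBelow f g) : ∃ (c : C →ₗ[ℝ≥0] ℝ≥0∞) (η : ℝ≥0), Continuous c ∧ 1 < η ∧
      (∀ x, f.1 x ≤ c x) ∧ ∀ x, η * c x ≤ g.1 x := by
  obtain ⟨c, h1, h2, h3, h4, h5⟩ := exists_seq_continuous hC g
  have hm : Monotone fun n => ofContinuous (c n) (h1 n) := fun _ _ h x => h4 x h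
  obtain ⟨n, hn⟩ := h _ g hm ((isLUB_iff hm).2 h5) le_rfl
  obtain ⟨η, h6, h7⟩ := LinearMap.exists_gap (h1 n) g.2.1 (h3 n)
  exact ⟨c n, η, h1 n, h6, hn, h7⟩

theorem cuCone (hC : HasAbundanceOfCompactIdempotents C) : CuCone (LscSigma C) where
  add_le_add_left f g h k x := add_le_add_left (h x) (k.1 x)
  zero_le' f x := bot_le
  o1 f hf := ⟨_, isLUB_iSupOfMonotone f hf⟩
  o2 f := by
    obtain ⟨c, h1, h2, h3, h4, h5⟩ := exists_seq_continuous hC f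
    refine ⟨fun n => ofContinuous (c n) (h1 n), fun n => ?_,
      (isLUB_iff fun _ _ h x => h4 x h).2 h5⟩
    obtain ⟨η, h6, h7⟩ := LinearMap.exists_gap (h1 n) (h1 (n + 1)).lowerSemicontinuous (h2 n)
    exact seqWayBelow_of_gap (h1 n) h6 (fun x => le_rfl) h7
  o3 f g a b hf hg ha hb := by
    have hm : Monotone fun n => f n + g n := fun _ _ h x => add_le_add (hf h x) (hg h x)
    rw [isLUB_iff hf] at ha
    rw [isLUB_iff hg] at hb
    rw [isLUB_iff hm]
    intro x
    rw [add_apply, ha, hb]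
    exact ENNReal.iSup_add_iSup_of_monotone (fun _ _ h => hf h x) (fun _ _ h => hg h x)
  o4 f₁ f₂ g₁ g₂ h₁ h₂ := by
    obtain ⟨c, η, h1, h2, h3, h4⟩ := exists_gap_of_seqWayBelow hC h₁
    obtain ⟨c', η', h1', h2', h3', h4'⟩ := exists_gap_of_seqWayBelow hC h₂
    refine seqWayBelow_of_gap (c := c + c') (h1.add h1') (lt_min h2 h2')
      (fun x => add_le_add (h3 x) (h3' x)) fun x => ?_
    rw [LinearMap.add_apply, add_apply, mul_add]
    refine add_le_add (le_trans ?_ (h4 x)) (le_trans ?_ (h4' x))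
    · gcongr; exact min_le_left _ _
    · gcongr; exact min_le_right _ _
  smul_le_smul' t₁ t₂ f₁ f₂ _ ht hf x := by
    change (t₁ • f₁).1 x ≤ (t₂ • f₂).1 x
    rw [smul_apply, smul_apply]
    gcongr
    exact hf x
  isLUB_smul t f t₀ f₀ _ ht hf ht₀ hf₀ := by
    have hm : Monotone fun n => t n • f n := fun a b h x => by
      change (t a • f a).1 x ≤ (t b • f b).1 x
      rw [smul_apply, smul_apply]
      gcongr
      · exact ht h
      · exact hf h x
    rw [isLUB_iff hf] at hf₀
    rw [isLUB_iff hm]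
    intro x
    have e : (t₀ : ℝ≥0∞) = ⨆ n, (t n : ℝ≥0∞) := by
      rw [← ht₀.ciSup_eq, ENNReal.coe_iSup ⟨t₀, ht₀.1⟩]
    simp only [smul_apply]
    rw [hf₀, e]
    refine ENNReal.iSup_mul_iSup_of_monotone (fun _ _ h => ?_) (fun _ _ h => hf h x)
    exact_mod_cast ht h

end LscSigma

/-! ### Axioms O5 and O6 for lower semicontinuous linear functions. -/

theorem IsSigmaCompact.union {X : Type*} [TopologicalSpace X] {s t : Set X}
    (hs : IsSigmaCompact s) (ht : IsSigmaCompact t) : IsSigmaCompact (s ∪ t) := by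
  rw [union_eq_iUnion]
  exact isSigmaCompact_iUnion _ fun b => by cases b <;> assumption

theorem ENNReal.add_sub_add {a b c d : ℝ≥0∞} (hca : c ≤ a) (hdb : d ≤ b) (hc : c ≠ ∞) (hd : d ≠ ∞) :
    (a + b) - (c + d) = (a - c) + (b - d) := by
  obtain ⟨x, rfl⟩ := exists_add_of_le hca
  obtain ⟨y, rfl⟩ := exists_add_of_le hdb
  rw [ENNReal.add_sub_cancel_left hc, ENNReal.add_sub_cancel_left hd, add_add_add_comm,
    ENNReal.add_sub_cancel_left (ENNReal.add_ne_top.2 ⟨hc, hd⟩)]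

namespace LscSigma

section

variable {C : Type*} [AddCommMonoid C] [Module ℝ≥0 C] [TopologicalSpace C] [T2Space C]
  [CompactSpace C]

/-- The complement is `g - c`, set to `∞` where `c = ∞`. The gap `η > 1` is what makes it lower
semicontinuous at those points. -/
theorem exists_add_eq {c : C →ₗ[ℝ≥0] ℝ≥0∞} (hc : Continuous c) {g : LscSigma C} {η : ℝ≥0}
    (hη : 1 < η) (h : ∀ x, η * c x ≤ g.1 x) : ∃ z : LscSigma C, ∀ x, c x + z.1 x = g.1 x := by
  classical
  obtain ⟨θ, hθ, rfl⟩ : ∃ θ : ℝ≥0, 0 < θ ∧ η = 1 + θ :=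
    ⟨η - 1, tsub_pos_of_lt hη, (add_tsub_cancel_of_le hη.le).symm⟩
  have hθ0 : (θ : ℝ≥0∞) ≠ 0 := by exact_mod_cast hθ.ne'
  have h' : ∀ x, c x + θ * c x ≤ g.1 x := fun x => by
    simpa [add_mul] using h x
  have hcg : ∀ x, c x ≤ g.1 x := fun x => le_self_add.trans (h' x)
  let z : C →ₗ[ℝ≥0] ℝ≥0∞ :=
    { toFun := fun x => if c x = ∞ then ∞ else g.1 x - c x
      map_add' := by
        intro x y
        by_cases hx : c x = ∞
        · simp [hx]
        · by_cases hy : c y = ∞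
          · simp [hy]
          · rw [if_neg hx, if_neg hy, if_neg (by simp [hx, hy]), map_add, map_add]
            exact ENNReal.add_sub_add (hcg x) (hcg y) hx hy
      map_smul' := by
        intro t x
        rcases eq_or_ne t 0 with rfl | ht
        · simp
        · have ht' : (t : ℝ≥0∞) ≠ 0 := by exact_mod_cast ht
          simp only [map_smul, ENNReal.nnreal_smul_eq, RingHom.id_apply]
          by_cases hx : c x = ∞
          · simp [hx, ENNReal.mul_top, ht']
          · rw [if_neg hx, if_neg (ENNReal.mul_ne_top ENNReal.coe_ne_top hx),
              ENNReal.mul_sub fun _ _ => ENNReal.coe_ne_top] }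
  have hz : ∀ x, c x ≠ ∞ → ∀ a : ℝ≥0∞, a < z x ↔ a + c x < g.1 x := fun x hx a => by
    change a < ite _ _ _ ↔ _
    rw [if_neg hx, lt_tsub_iff_right]
  have hz' : ∀ x, c x = ∞ → z x = ∞ := fun x hx => if_pos hx
  refine ⟨⟨z, ?_, fun a => ?_⟩, fun x => ?_⟩
  · rw [lowerSemicontinuous_iff_isOpen_preimage]
    intro a
    by_cases ha : a = ∞
    · simp [ha]
    -- The first set takes care of the points with `c x = ∞`, where the difference cannot be formed:
    -- `z` dominates `θ * c`, which is large nearby.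
    have e : z ⁻¹' Ioi a = {x | a < θ * c x} ∪
        ⋃ r : ℝ≥0∞, {x | a + c x < r} ∩ (g.1 ⁻¹' Ioi r) := by
      ext x
      simp only [mem_preimage, mem_Ioi, mem_union, mem_ofPred_eq, mem_iUnion, mem_inter_iff]
      by_cases hx : c x = ∞
      · simp [hz' x hx, hx, ENNReal.mul_top hθ0, lt_top_iff_ne_top, ha]
      · rw [hz x hx]
        constructor
        · intro h1
          obtain ⟨r, h2, h3⟩ := exists_between h1
          exact Or.inr ⟨r, h2, h3⟩
        · rintro (h1 | ⟨r, h2, h3⟩)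
          · refine lt_of_lt_of_le ?_ (h' x)
            rw [add_comm a]
            exact ENNReal.add_lt_add_left hx h1
          · exact h2.trans h3
    rw [e]
    refine (isOpen_lt continuous_const
      (ENNReal.continuous_const_mul ENNReal.coe_ne_top |>.comp hc)).union
      (isOpen_iUnion fun r => (isOpen_lt (by fun_prop) continuous_const).inter
        (g.2.1.isOpen_preimage r))
  · have e : {x | (a : ℝ≥0∞) < z x} = {x | ∞ ≤ c x} ∪
        ⋃ q : ℚ, {x | a + c x ≤ (Real.toNNReal q : ℝ≥0)} ∩
          {x | ((Real.toNNReal q : ℝ≥0) : ℝ≥0∞) < g.1 x} := by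
      ext x
      simp only [mem_union, mem_ofPred_eq, mem_iUnion, mem_inter_iff, top_le_iff]
      by_cases hx : c x = ∞
      · simp [hz' x hx, hx]
      · rw [hz x hx]
        constructor
        · intro h1
          obtain ⟨q, -, h2, h3⟩ := ENNReal.lt_iff_exists_rat_btwn.1 h1
          exact Or.inr ⟨q, h2.le, h3⟩
        · rintro (h1 | ⟨q, h2, h3⟩)
          · exact absurd h1 hx
          · exact h2.trans_lt h3
    rw [e]
    exact (isClosed_le continuous_const hc).isCompact.isSigmaCompact.union
      (isSigmaCompact_iUnion _ fun q =>
        (isClosed_le (by fun_prop) continuous_const).isCompact.isSigmaCompact.inter_of_t2 (g.2.2 _))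
  · change c x + z x = g.1 x
    by_cases hx : c x = ∞
    · rw [hx, top_add]
      exact (top_le_iff.1 (hx ▸ hcg x)).symm
    · change c x + ite _ _ _ = _
      rw [if_neg hx]
      exact add_tsub_cancel_of_le (hcg x)

end

variable {C : Type*} [AddCommMonoid C] [Module ℝ≥0 C] [TopologicalSpace C]
  [IsExtendedChoquetCone C]

theorem axiomO5 (hC : HasAbundanceOfCompactIdempotents C) : AxiomO5 (LscSigma C) := by
  intro f' f g hf hfg
  obtain ⟨c, η, h1, h2, h3, h4⟩ := exists_gap_of_seqWayBelow hC hf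
  obtain ⟨z, hz⟩ := exists_add_eq h1 h2 fun x => (h4 x).trans (hfg x)
  refine ⟨z, fun x => ?_, fun x => ?_⟩
  · change (f' + z).1 x ≤ g.1 x
    rw [add_apply, ← hz]
    gcongr
    exact h3 x
  · change g.1 x ≤ (f + z).1 x
    rw [add_apply, ← hz]
    gcongr
    refine le_trans (le_mul_of_one_le_left bot_le ?_) (h4 x)
    exact_mod_cast h2.le

end LscSigma

namespace IsExtendedChoquetCone

variable {C : Type*} [AddCommMonoid C] [Module ℝ≥0 C] [TopologicalSpace C]
  [IsExtendedChoquetCone C]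

/-- The infimum of two linear functions among linear functions. -/
noncomputable def infConv (f g : C →ₗ[ℝ≥0] ℝ≥0∞) : C →ₗ[ℝ≥0] ℝ≥0∞ where
  toFun x := ⨅ p : {p : C × C // p.1 + p.2 = x}, f p.1.1 + g p.1.2
  map_add' x y := by
    refine le_antisymm ?_ ?_
    · refine ENNReal.le_iInf_add_iInf ?_
      rintro ⟨⟨a, b⟩, hab⟩ ⟨⟨c, d⟩, hcd⟩
      refine (iInf_le _ ⟨(a + c, b + d), by
        rw [← hab, ← hcd]; exact add_add_add_comm _ _ _ _⟩).trans ?_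
      simp only [map_add]
      rw [add_add_add_comm]
    · refine le_iInf fun ⟨⟨a, b⟩, hab⟩ => ?_
      -- Refinement only gives `y ≤ a₂ + b₂`; a second Riesz decomposition and monotonicity of `f`
      -- and `g` make this sufficient.
      obtain ⟨a₁, a₂, b₁, b₂, rfl, rfl, rfl, hy⟩ := refinement (x := x) (y := y) (a := a) (b := b)
        (by rw [← hab]; exact AlgLE.refl _)
      obtain ⟨c, d, rfl, hc, hd⟩ := riesz hy
      simp only [map_add]
      refine (add_le_add (iInf_le _ ⟨(a₁, b₁), rfl⟩) (iInf_le _ ⟨(c, d), rfl⟩)).trans ?_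
      simp only
      rw [add_add_add_comm]
      refine add_le_add (add_le_add le_rfl hc.map) (add_le_add le_rfl hd.map)
  map_smul' t x := by
    rcases eq_or_ne t 0 with rfl | ht
    · simp only [zero_smul, RingHom.id_apply]
      exact le_antisymm (iInf_le_of_le ⟨(0, 0), by simp⟩ (by simp)) bot_le
    · have h : ∀ (t : ℝ≥0) (x : C), t ≠ 0 → (⨅ p : {p : C × C // p.1 + p.2 = t • x}, f p.1.1 + g p.1.2) ≤
          t * ⨅ p : {p : C × C // p.1 + p.2 = x}, f p.1.1 + g p.1.2 := by
        intro t x ht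
        rw [ENNReal.mul_iInf_of_ne (by simpa) ENNReal.coe_ne_top]
        refine le_iInf fun ⟨⟨a, b⟩, hab⟩ => iInf_le_of_le ⟨(t • a, t • b), ?_⟩ ?_
        · rw [← hab, smul_add]
        · simp only [map_smul, ENNReal.nnreal_smul_eq, mul_add]
          exact le_rfl
      rw [RingHom.id_apply, ENNReal.nnreal_smul_eq]
      refine le_antisymm (h t x ht) ?_
      have h1 := h t⁻¹ (t • x) (inv_ne_zero ht)
      rw [smul_smul, inv_mul_cancel₀ ht, one_smul, ENNReal.coe_inv ht] at h1
      calc _ ≤ (t : ℝ≥0∞) * ((t : ℝ≥0∞)⁻¹ * _) := by gcongr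
        _ = _ := by rw [← mul_assoc, ENNReal.mul_inv_cancel (by simpa) ENNReal.coe_ne_top, one_mul]

theorem infConv_le_left (f g : C →ₗ[ℝ≥0] ℝ≥0∞) (x : C) : infConv f g x ≤ f x :=
  iInf_le_of_le ⟨(x, 0), add_zero _⟩ (by simp)

theorem infConv_le_right (f g : C →ₗ[ℝ≥0] ℝ≥0∞) (x : C) : infConv f g x ≤ g x :=
  iInf_le_of_le ⟨(0, x), zero_add _⟩ (by simp)

theorem exists_infConv_eq {f g : C →ₗ[ℝ≥0] ℝ≥0∞} (hf : LowerSemicontinuous f)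
    (hg : LowerSemicontinuous g) (x : C) : ∃ a b, a + b = x ∧ infConv f g x = f a + g b := by
  have hcl : IsCompact {p : C × C | p.1 + p.2 = x} :=
    (isClosed_eq (by fun_prop) continuous_const).isCompact
  obtain ⟨⟨a, b⟩, hab, hmin⟩ := LowerSemicontinuousOn.exists_isMinOn (s := {p : C × C | p.1 + p.2 = x})
    (f := fun p : C × C => f p.1 + g p.2) ⟨(x, 0), add_zero _⟩ hcl
    (((hf.comp continuous_fst).add (hg.comp continuous_snd)).lowerSemicontinuousOn _)
  exact ⟨a, b, hab, le_antisymm (iInf_le_of_le ⟨(a, b), hab⟩ le_rfl) (le_iInf fun p => hmin p.2)⟩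

theorem lowerSemicontinuous_infConv {f g : C →ₗ[ℝ≥0] ℝ≥0∞} (hf : LowerSemicontinuous f)
    (hg : LowerSemicontinuous g) : LowerSemicontinuous (infConv f g) := by
  rw [lowerSemicontinuous_iff_isClosed_preimage]
  intro r
  have e : infConv f g ⁻¹' Iic r =
      (fun p : C × C => p.1 + p.2) '' ((fun p : C × C => f p.1 + g p.2) ⁻¹' Iic r) := by
    ext x
    constructor
    · intro hx
      obtain ⟨a, b, hab, h⟩ := exists_infConv_eq hf hg x
      exact ⟨(a, b), h.symm.trans_le hx, hab⟩
    · rintro ⟨⟨a, b⟩, h, rfl⟩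
      exact (iInf_le (fun p : {p : C × C // p.1 + p.2 = a + b} => f p.1.1 + g p.1.2)
        ⟨(a, b), rfl⟩).trans h
  rw [e]
  refine (IsClosed.isCompact ?_ |>.image (by fun_prop)).isClosed
  exact ((hf.comp continuous_fst).add (hg.comp continuous_snd)).isClosed_preimage r

/-- For `x = a + b = c + d`, split `b` along `c + d`. The part below `c` is charged to `f c`; on the
part below `d`, `f` is bounded by `g + h`, charged to `g b` and `h d`. -/
theorem le_infConv_add_infConv {f g h : C →ₗ[ℝ≥0] ℝ≥0∞} (hfgh : ∀ x, f x ≤ g x + h x) (x : C) :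
    f x ≤ infConv f g x + infConv f h x := by
  refine ENNReal.le_iInf_add_iInf ?_
  rintro ⟨⟨a, b⟩, rfl⟩ ⟨⟨c, d⟩, hcd⟩
  simp only at hcd ⊢
  obtain ⟨b₁, b₂, rfl, h1, h2⟩ := riesz (show AlgLE b (c + d) from hcd ▸ AlgLE.add_self _ _)
  calc f (a + (b₁ + b₂)) = f a + (f b₁ + f b₂) := by rw [map_add, map_add]
    _ ≤ f a + (f c + (g b₂ + h b₂)) := by gcongr; exacts [h1.map, hfgh _]
    _ ≤ f a + (f c + (g (b₁ + b₂) + h d)) := by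
      gcongr
      exacts [(AlgLE.add_self _ _).map, h2.map]
    _ = _ := by abel

theorem exists_continuous_upper_bound (hC : HasAbundanceOfCompactIdempotents C)
    {f : C →ₗ[ℝ≥0] ℝ≥0∞} (hf : LowerSemicontinuous f) {ι : Type*} (s : Finset ι)
    (g : ι → C →ₗ[ℝ≥0] ℝ≥0∞) (hg : ∀ i ∈ s, Continuous (g i) ∧ ∀ x, 1 ≤ g i x → 1 < f x) :
    ∃ h : C →ₗ[ℝ≥0] ℝ≥0∞, Continuous h ∧ (∀ i ∈ s, ∀ x, g i x ≤ h x) ∧ ∀ x, 1 ≤ h x → 1 < f x := by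
  obtain ⟨h, h1, h2, h3⟩ := exists_continuous_between hC hf (K := ⋃ i ∈ s, {x | 1 ≤ g i x})
    (s.finite_toSet.isClosed_biUnion fun i hi => _root_.isClosed_le continuous_const (hg i hi).1)
    (by
      intro k hk
      obtain ⟨i, hi, hk⟩ := mem_iUnion₂.1 hk
      exact (hg i hi).2 k hk)
  refine ⟨h, h1, fun i hi x => LinearMap.le_of_forall_one_lt (fun x hx => ?_) x, h3⟩
  exact (h2 x (mem_iUnion₂.2 ⟨i, hi, hx.le⟩)).le

theorem exists_continuous_lt (hC : HasAbundanceOfCompactIdempotents C)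
    {f : C →ₗ[ℝ≥0] ℝ≥0∞} (hf : LowerSemicontinuous f) {x : C} {r : ℝ≥0} (hr : (r : ℝ≥0∞) < f x) :
    ∃ h : C →ₗ[ℝ≥0] ℝ≥0∞, Continuous h ∧ (r : ℝ≥0∞) < h x ∧ ∀ x, 1 ≤ h x → 1 < f x := by
  obtain ⟨q, hq1, hq2⟩ := ENNReal.lt_iff_exists_nnreal_btwn.1 hr
  have hq : q ≠ 0 := by rintro rfl; simp at hq1
  have hq' : (q : ℝ≥0∞) ≠ 0 := by exact_mod_cast hq
  have e : ∀ f : C →ₗ[ℝ≥0] ℝ≥0∞, 1 < f (q⁻¹ • x) ↔ q < f x := fun f => by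
    rw [map_smul, ENNReal.nnreal_smul_eq, ENNReal.coe_inv hq, mul_comm, ← div_eq_mul_inv,
      ENNReal.lt_div_iff_mul_lt (Or.inl hq') (Or.inl ENNReal.coe_ne_top), one_mul]
  obtain ⟨h, h1, h2, h3⟩ := exists_continuous_between hC hf (K := {q⁻¹ • x}) isClosed_singleton
    (by rintro _ rfl; exact (e f).2 hq2)
  exact ⟨h, h1, hq1.trans ((e h).1 (h2 _ rfl)), h3⟩

/-- Near each point of the compact set `{c ≥ 1}` suitable continuous minorants exist, and finitely
many of them have a continuous upper bound that is still below `p` or `q`. This provides elements of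
`LscSigma C` where infimal convolutions are only known to be lower semicontinuous. -/
theorem exists_continuous_sum (hC : HasAbundanceOfCompactIdempotents C)
    {c p q : C →ₗ[ℝ≥0] ℝ≥0∞} (hc : Continuous c) (hp : LowerSemicontinuous p)
    (hq : LowerSemicontinuous q) (h : ∀ x, 1 ≤ c x → 1 < p x + q x) :
    ∃ p' q' : C →ₗ[ℝ≥0] ℝ≥0∞, Continuous p' ∧ Continuous q' ∧ (∀ x, p' x ≤ p x) ∧
      (∀ x, q' x ≤ q x) ∧ ∀ x, c x ≤ p' x + q' x := by
  have hcl : IsCompact {x | 1 ≤ c x} := (_root_.isClosed_le continuous_const hc).isCompact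
  have key : ∀ x, 1 ≤ c x → ∃ p' q' : C →ₗ[ℝ≥0] ℝ≥0∞, (Continuous p' ∧ ∀ x, 1 ≤ p' x → 1 < p x) ∧
      (Continuous q' ∧ ∀ x, 1 ≤ q' x → 1 < q x) ∧ 1 < p' x + q' x := by
    intro x hx
    have hz : ∀ p : C →ₗ[ℝ≥0] ℝ≥0∞, Continuous (0 : C →ₗ[ℝ≥0] ℝ≥0∞) ∧
      ∀ x, 1 ≤ (0 : C →ₗ[ℝ≥0] ℝ≥0∞) x → 1 < p x := fun p => ⟨continuous_const, by simp⟩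
    by_cases hp0 : p x = 0
    · obtain ⟨q', h1, h2, h3⟩ := exists_continuous_lt hC hq (x := x) (r := 1)
        (by simpa [hp0] using h x hx)
      exact ⟨0, q', hz _, ⟨h1, h3⟩, by simpa using h2⟩
    by_cases hq0 : q x = 0
    · obtain ⟨p', h1, h2, h3⟩ := exists_continuous_lt hC hp (x := x) (r := 1)
        (by simpa [hq0] using h x hx)
      exact ⟨p', 0, ⟨h1, h3⟩, hz _, by simpa using h2⟩
    obtain ⟨a, ha, b, hb, hab⟩ := ENNReal.exists_lt_add_of_lt_add (h x hx) hp0 hq0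
    lift a to ℝ≥0 using ha.ne_top
    lift b to ℝ≥0 using hb.ne_top
    obtain ⟨p', h1, h2, h3⟩ := exists_continuous_lt hC hp ha
    obtain ⟨q', h1', h2', h3'⟩ := exists_continuous_lt hC hq hb
    exact ⟨p', q', ⟨h1, h3⟩, ⟨h1', h3'⟩, hab.trans (ENNReal.add_lt_add h2 h2')⟩
  choose! p' q' hp' hq' hpq using key
  obtain ⟨s, hs, hcov⟩ := hcl.elim_nhds_subcover (fun x => {y | 1 < p' x y + q' x y}) fun x hx =>
    (isOpen_lt continuous_const ((hp' x hx).1.add (hq' x hx).1)).mem_nhds (hpq x hx)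
  obtain ⟨P, hP1, hP2, hP3⟩ := exists_continuous_upper_bound hC hp s p' fun i hi => hp' i (hs i hi)
  obtain ⟨Q, hQ1, hQ2, hQ3⟩ := exists_continuous_upper_bound hC hq s q' fun i hi => hq' i (hs i hi)
  refine ⟨P, Q, hP1, hQ1, LinearMap.le_of_forall_one_lt fun x hx => (hP3 x hx.le).le,
    LinearMap.le_of_forall_one_lt fun x hx => (hQ3 x hx.le).le,
    LinearMap.le_of_forall_one_lt (g := P + Q) fun x hx => ?_⟩
  obtain ⟨i, hi, hx⟩ := mem_iUnion₂.1 (hcov hx.le)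
  exact (lt_of_lt_of_le hx (add_le_add (hP2 i hi x) (hQ2 i hi x))).le

end IsExtendedChoquetCone

namespace LscSigma

open IsExtendedChoquetCone

variable {C : Type*} [AddCommMonoid C] [Module ℝ≥0 C] [TopologicalSpace C]
  [IsExtendedChoquetCone C]

theorem axiomO6 (hC : HasAbundanceOfCompactIdempotents C) : AxiomO6 (LscSigma C) := by
  intro f g h hfgh f' hf
  obtain ⟨c, η, h1, h2, h3, h4⟩ := exists_gap_of_seqWayBelow hC hf
  obtain ⟨p, q, hp, hq, hpf, hqf, hc⟩ := exists_continuous_sum hC h1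
    (lowerSemicontinuous_infConv f.2.1 g.2.1) (lowerSemicontinuous_infConv f.2.1 h.2.1)
    (fun x hx => by
      refine lt_of_lt_of_le ?_ ((h4 x).trans (le_infConv_add_infConv hfgh x))
      calc (1 : ℝ≥0∞) < η := by exact_mod_cast h2
        _ = η * 1 := (mul_one _).symm
        _ ≤ η * c x := by gcongr)
  exact ⟨ofContinuous p hp, ofContinuous q hq, fun x => (h3 x).trans (hc x),
    fun x => (hpf x).trans (infConv_le_left _ _ x), fun x => (hpf x).trans (infConv_le_right _ _ x),
    fun x => (hqf x).trans (infConv_le_left _ _ x), fun x => (hqf x).trans (infConv_le_right _ _ x)⟩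

end LscSigma

/-! ### Homogeneity of functionals; ideals and idempotent functionals. -/

theorem IsAlgebraicLattice.of_orderIso {L M : Type*} [PartialOrder L] [PartialOrder M] (e : L ≃o M)
    (h : IsAlgebraicLattice L) : IsAlgebraicLattice M := by
  refine ⟨fun A => ?_, fun x => ?_⟩
  · obtain ⟨u, hu⟩ := h.1 (e ⁻¹' A)
    refine ⟨e u, ?_⟩
    have := (e.isLUB_image' (s := e ⁻¹' A) (x := u)).2 hu
    rwa [image_preimage_eq _ e.surjective] at this
  · obtain ⟨K, hK, hx⟩ := h.2 (e.symm x)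
    refine ⟨e '' K, ?_, ?_⟩
    · rintro _ ⟨k, hk, rfl⟩ s u hs hd hu hku
      obtain ⟨y, hy, hky⟩ := hK k hk (e ⁻¹' s) (e.symm u) (hs.preimage e.surjective)
        (by
          intro a ha b hb
          obtain ⟨c, hc, h1, h2⟩ := hd _ ha _ hb
          exact ⟨e.symm c, by simpa using hc, e.le_symm_apply.2 h1, e.le_symm_apply.2 h2⟩)
        (by
          rw [← e.isLUB_image', image_preimage_eq _ e.surjective]
          simpa using hu)
        (by rwa [e.le_symm_apply])
      exact ⟨e y, hy, e.monotone hky⟩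
    · have := (e.isLUB_image').2 hx
      simpa using this

section

variable {S : Type*} [AddCommMonoid S] [PartialOrder S]

namespace FunctionalCone

@[ext]
theorem ext {l m : FunctionalCone S} (h : ∀ s, l s = m s) : l = m := DFunLike.ext _ _ h

theorem add_apply (l m : FunctionalCone S) (s : S) : (l + m) s = l s + m s := rfl

theorem smul_apply (t : ℝ≥0) (l : FunctionalCone S) (s : S) : (t • l) s = t * l s := by
  rw [← ENNReal.nnreal_smul_eq]; rfl

theorem map_add (l : FunctionalCone S) (s t : S) : l (s + t) = l s + l t := l.1.map_add s t

theorem map_zero (l : FunctionalCone S) : l 0 = 0 := l.1.map_zero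

theorem isLUB (l : FunctionalCone S) {x : ℕ → S} {y : S} (hx : Monotone x) (h : IsLUB (range x) y) :
    l y = ⨆ n, l (x n) := (l.2.2 x y hx h).iSup_eq.symm

theorem le_of_algLE {l m : FunctionalCone S} (h : AlgLE l m) (s : S) : l s ≤ m s := by
  obtain ⟨n, rfl⟩ := h
  exact le_self_add

/-- A functional from a monotone additive map preserving suprema. -/
def mk (f : S → ℝ≥0∞) (h0 : f 0 = 0) (ha : ∀ s t, f (s + t) = f s + f t) (hm : Monotone f)
    (hs : ∀ (x : ℕ → S) (y : S), Monotone x → IsLUB (range x) y → f y ≤ ⨆ n, f (x n)) :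
    FunctionalCone S :=
  ⟨⟨⟨f, h0⟩, ha⟩, hm, fun x y hx hy => by
    have : f y = ⨆ n, f (x n) := le_antisymm (hs x y hx hy) (iSup_le fun n => hm (hy.1 ⟨n, rfl⟩))
    change IsLUB (range fun n => f (x n)) (f y)
    rw [this]
    exact isLUB_iSup⟩

theorem idem_apply {l : FunctionalCone S} (hl : l + l = l) (s : S) : l s = 0 ∨ l s = ∞ := by
  by_cases h : l s = ∞
  · exact Or.inr h
  · have h1 : l s + l s = l s + 0 := by rw [← add_apply, hl, add_zero]
    exact Or.inl ((ENNReal.add_right_inj h).1 h1)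

theorem idem_le_iff {l m : FunctionalCone S} (hm : m + m = m) :
    AlgLE l m ↔ ∀ s, l s ≤ m s := by
  refine ⟨le_of_algLE, fun h => ⟨m, ext fun s => ?_⟩⟩
  rw [add_apply]
  rcases idem_apply hm s with h1 | h1
  · rw [h1, add_zero]
    exact le_antisymm (h1 ▸ h s) bot_le
  · rw [h1, add_top]

end FunctionalCone

variable [Module ℝ≥0 S]

/-- Additivity gives integer multiples and monotonicity interpolates between them. The reverse
inequality is the same bound for `t⁻¹`. -/
theorem FunctionalCone.map_smul [CuCone S] (l : FunctionalCone S) (t : ℝ≥0) (s : S) :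
    l (t • s) = t * l s := by
  have hnat : ∀ (n : ℕ) (s : S), l ((n : ℝ≥0) • s) = n * l s := by
    intro n s
    induction n with
    | zero => simp [FunctionalCone.map_zero]
    | succ n ih =>
      push_cast
      rw [add_smul, one_smul, FunctionalCone.map_add, ih, add_mul, one_mul]
  have hmono : ∀ {t r : ℝ≥0} (s : S), t ≤ r → l (t • s) ≤ l (r • s) := by
    intro t r s h
    rcases eq_or_ne t 0 with rfl | ht
    · simp [FunctionalCone.map_zero]
    · exact l.mono (CuCone.smul_le_smul' _ _ _ _ (pos_iff_ne_zero.2 ht) h le_rfl)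
  have hle : ∀ (t : ℝ≥0) (s : S), t ≠ 0 → l (t • s) ≤ t * l s := by
    intro t s ht
    by_cases h1 : l s = ∞
    · simp [h1, ENNReal.mul_top, ht]
    by_cases h0 : l s = 0
    · obtain ⟨n, hn⟩ := exists_nat_ge t
      refine (hmono s hn).trans ?_
      rw [hnat, h0, mul_zero, mul_zero]
    by_contra! hlt
    rw [← ENNReal.lt_div_iff_mul_lt (Or.inl h0) (Or.inl h1)] at hlt
    obtain ⟨r, h2, h3⟩ := ENNReal.lt_iff_exists_nnreal_btwn.1 hlt
    rw [ENNReal.coe_lt_coe] at h2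
    -- With `(m + 1) * (r - t) ≥ 1`, rounding `(m + 1) * t` up to an integer stays below `(m + 1) *
    -- r`.
    obtain ⟨m, hm⟩ := exists_nat_one_div_lt (tsub_pos_of_lt h2)
    have hm' : ((m + 1 : ℕ) : ℝ≥0∞) ≠ 0 := by simp
    have h4 : ((m + 1 : ℕ) : ℝ≥0∞) * l (t • s) ≤ ((m + 1 : ℕ) : ℝ≥0∞) * (r * l s) := by
      rw [← hnat, smul_smul]
      refine (hmono s (Nat.le_ceil _)).trans ?_
      rw [hnat, ← mul_assoc]
      gcongr
      have h5 : (⌈((m + 1 : ℕ) : ℝ≥0) * t⌉₊ : ℝ≥0) ≤ ((m + 1 : ℕ) : ℝ≥0) * r := by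
        refine (Nat.ceil_lt_add_one bot_le).le.trans ?_
        have h6 : 1 ≤ ((m + 1 : ℕ) : ℝ≥0) * (r - t) := by
          rw [div_lt_iff₀ (by positivity), mul_comm] at hm
          exact_mod_cast hm.le
        calc ((m + 1 : ℕ) : ℝ≥0) * t + 1 ≤ ((m + 1 : ℕ) : ℝ≥0) * t + ((m + 1 : ℕ) : ℝ≥0) * (r - t) := by
              gcongr
          _ = _ := by rw [← mul_add, add_tsub_cancel_of_le h2.le]
      exact_mod_cast h5
    rw [ENNReal.mul_le_mul_iff_right hm' (ENNReal.natCast_ne_top _)] at h4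
    rw [ENNReal.lt_div_iff_mul_lt (Or.inl h0) (Or.inl h1)] at h3
    exact absurd h4 h3.not_ge
  rcases eq_or_ne t 0 with rfl | ht
  · simp [FunctionalCone.map_zero]
  refine le_antisymm (hle t s ht) ?_
  have h1 := hle t⁻¹ (t • s) (inv_ne_zero ht)
  rw [smul_smul, inv_mul_cancel₀ ht, one_smul, ENNReal.coe_inv ht] at h1
  calc (t : ℝ≥0∞) * l s ≤ t * ((t : ℝ≥0∞)⁻¹ * l (t • s)) := by gcongr
    _ = _ := by rw [← mul_assoc, ENNReal.mul_inv_cancel (by simpa) ENNReal.coe_ne_top, one_mul]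

open Classical in
/-- The functional that vanishes on an ideal and is infinite elsewhere. -/
noncomputable def CuIdeal.functional [CuCone S] (I : CuIdeal S) : FunctionalCone S :=
  FunctionalCone.mk (fun s => if s ∈ I.1 then 0 else ∞) (if_pos I.1.zero_mem)
    (by
      intro s t
      by_cases hs : s ∈ I.1
      · by_cases ht : t ∈ I.1
        · simp [hs, ht, I.1.add_mem hs ht]
        · have := CuSemigroup.zero_le' s
          rw [if_neg fun h => ht (I.2.1 _ _ (le_add_of_nonneg_left this) h), if_neg ht, add_top]
      · have := CuSemigroup.zero_le' t
        rw [if_neg fun h => hs (I.2.1 _ _ (le_add_of_nonneg_right this) h), if_neg hs, top_add])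
    (by
      intro s t hst
      by_cases ht : t ∈ I.1
      · simp [I.2.1 _ _ hst ht]
      · simp [ht])
    (by
      intro x y hx hy
      by_cases h : ∀ n, x n ∈ I.1
      · simp [I.2.2 x y hx h hy]
      · push Not at h
        obtain ⟨n, hn⟩ := h
        refine le_trans le_top (le_iSup_of_le n ?_)
        simp [hn])

open Classical in
theorem CuIdeal.functional_apply [CuCone S] (I : CuIdeal S) (s : S) :
    I.functional s = if s ∈ I.1 then 0 else ∞ := rfl

theorem CuIdeal.functional_eq_zero_iff [CuCone S] (I : CuIdeal S) (s : S) :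
    I.functional s = 0 ↔ s ∈ I.1 := by
  rw [CuIdeal.functional_apply]
  split_ifs with h <;> simp [h]

theorem CuIdeal.functional_idem [CuCone S] (I : CuIdeal S) :
    I.functional + I.functional = I.functional := by
  ext s
  rw [FunctionalCone.add_apply, CuIdeal.functional_apply]
  split_ifs <;> simp

theorem CuIdeal.functional_eq_of_idem [CuCone S] {I : CuIdeal S} {l : FunctionalCone S}
    (hl : l + l = l) (h : ∀ s, s ∈ I.1 ↔ l s = 0) : I.functional = l := by
  ext s
  rcases FunctionalCone.idem_apply hl s with h1 | h1
  · rw [h1, CuIdeal.functional_eq_zero_iff, h, h1]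
  · rw [h1]
    refine (FunctionalCone.idem_apply (CuIdeal.functional_idem _) s).resolve_left fun h' => ?_
    rw [CuIdeal.functional_eq_zero_iff, h] at h'
    exact ENNReal.top_ne_zero (h1.symm.trans h')

/-- Ideals correspond to idempotent functionals. -/
noncomputable def CuIdeal.orderIso [CuCone S] : CuIdeal S ≃o (Idem (FunctionalCone S))ᵒᵈ where
  toFun I := @OrderDual.toDual (Idem _) ⟨I.functional, I.functional_idem⟩
  invFun w := ⟨{
    carrier := {s | (OrderDual.ofDual w).1 s = 0}
    zero_mem' := FunctionalCone.map_zero _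
    add_mem' := fun {s t} hs ht => by
      rw [mem_ofPred_eq] at hs ht ⊢
      rw [FunctionalCone.map_add, hs, ht, add_zero]
    smul_mem' := fun t s hs => by
      rw [mem_ofPred_eq] at hs ⊢
      rw [FunctionalCone.map_smul, hs, mul_zero] },
    fun x y hxy hy => le_antisymm (((OrderDual.ofDual w).1.mono hxy).trans hy.le) bot_le,
    fun x y hx h hy => by
      refine ((OrderDual.ofDual w).1.isLUB hx hy).trans ?_
      simpa using h⟩
  left_inv I := Subtype.ext (Submodule.ext fun s => I.functional_eq_zero_iff s)
  right_inv w :=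
    congrArg (@OrderDual.toDual (Idem _)) (Subtype.ext
      (CuIdeal.functional_eq_of_idem (OrderDual.ofDual w).2 fun _ => Iff.rfl))
  map_rel_iff' {I J} := by
    change AlgLE J.functional I.functional ↔ I.1 ≤ J.1
    rw [FunctionalCone.idem_le_iff I.functional_idem]
    constructor
    · intro h s hs
      rw [← CuIdeal.functional_eq_zero_iff] at hs ⊢
      exact le_antisymm (hs ▸ h s) bot_le
    · intro h s
      rcases FunctionalCone.idem_apply I.functional_idem s with h1 | h1
      · rw [(J.functional_eq_zero_iff s).2 (h ((I.functional_eq_zero_iff s).1 h1))]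
        exact bot_le
      · rw [h1]
        exact le_top

end

/-- A functional on a Cu-cone as a linear map. -/
def FunctionalCone.toLinearMap {S : Type*} [AddCommMonoid S] [PartialOrder S] [Module ℝ≥0 S]
    [CuCone S] (l : FunctionalCone S) : S →ₗ[ℝ≥0] ℝ≥0∞ where
  toFun := l
  map_add' := l.map_add
  map_smul' t s := by rw [l.map_smul, RingHom.id_apply, ENNReal.nnreal_smul_eq]

@[simp]
theorem FunctionalCone.toLinearMap_apply {S : Type*} [AddCommMonoid S] [PartialOrder S]
    [Module ℝ≥0 S] [CuCone S] (l : FunctionalCone S) (s : S) : l.toLinearMap s = l s := rfl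

/-- Linear equivalences preserve idempotents. -/
def LinearEquiv.idemOrderIso {C D : Type*} [AddCommMonoid C] [AddCommMonoid D]
    [Module ℝ≥0 C] [Module ℝ≥0 D] (e : C ≃ₗ[ℝ≥0] D) : Idem C ≃o Idem D where
  toFun w := ⟨e w.1, by rw [← map_add, w.2]⟩
  invFun w := ⟨e.symm w.1, by rw [← map_add, w.2]⟩
  left_inv w := Subtype.ext (e.symm_apply_apply w.1)
  right_inv w := Subtype.ext (e.apply_symm_apply w.1)
  map_rel_iff' {v w} := by
    constructor
    · rintro ⟨z, hz⟩
      refine ⟨e.symm z, e.injective ?_⟩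
      rw [map_add, e.apply_symm_apply]
      exact hz
    · rintro ⟨z, hz⟩
      exact ⟨e z, (map_add e v.1 z).symm.trans (congrArg e hz)⟩

/-! ### Evaluation identifies a cone with its bidual. -/

namespace LscSigma

section

variable {C : Type*} [AddCommMonoid C] [Module ℝ≥0 C] [TopologicalSpace C] [T2Space C]

/-- Evaluation at a point as a functional on `LscSigma C`. -/
noncomputable def eval (x : C) : FunctionalCone (LscSigma C) :=
  FunctionalCone.mk (fun f => f.1 x) rfl (fun _ _ => rfl) (fun _ _ h => h x)
    fun _ _ hx hy => ((isLUB_iff hx).1 hy x).le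

@[simp]
theorem eval_apply (x : C) (f : LscSigma C) : eval x f = f.1 x := rfl

variable (C) in
/-- Evaluation as a linear map. -/
noncomputable def evalLinear : C →ₗ[ℝ≥0] FunctionalCone (LscSigma C) where
  toFun := eval
  map_add' x y := FunctionalCone.ext fun f => map_add f.1 x y
  map_smul' t x := FunctionalCone.ext fun f => by
    rw [RingHom.id_apply, FunctionalCone.smul_apply, eval_apply, eval_apply, map_smul,
      ENNReal.nnreal_smul_eq]

end

open IsExtendedChoquetCone

variable {C : Type*} [AddCommMonoid C] [Module ℝ≥0 C] [TopologicalSpace C]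
  [IsExtendedChoquetCone C]

theorem exists_continuous_lt_lt (hC : HasAbundanceOfCompactIdempotents C) {x y : C}
    (h : ¬ AlgLE x y) : ∃ g : C →ₗ[ℝ≥0] ℝ≥0∞, Continuous g ∧ g y < 1 ∧ 1 < g x := by
  obtain ⟨g, h1, h2, h3⟩ := exists_continuous_separating hC (w := eps y) (hw := eps_add_eps y)
    (T := {t | AlgLE t y}) (K := {k | AlgLE x k}) (isClosed_le y)
    (fun a ha b hb s t _ _ hst => by
      have := (AlgLE.smul s ha).add (AlgLE.smul t hb)
      rwa [← add_smul, hst, one_smul] at this)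
    ⟨y, AlgLE.refl y⟩ (fun t ht => eps_mono ht) (isClosed_ge x)
    (fun a ha b hb s t _ _ hst => by
      have := (AlgLE.smul s ha).add (AlgLE.smul t hb)
      rwa [← add_smul, hst, one_smul] at this)
    (fun k hk t ht hle => h (AlgLE.trans hk (hle.trans (by
      have := AlgLE.add ht (AlgLE.refl (eps y))
      rwa [self_add_eps] at this))))
  exact ⟨g, h1, h2 y (AlgLE.refl y), h3 x (AlgLE.refl x)⟩

theorem eval_injective (hC : HasAbundanceOfCompactIdempotents C) :
    Function.Injective (evalLinear C) := by
  have key : ∀ x y : C, evalLinear C x = evalLinear C y → AlgLE x y := by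
    intro x y h
    by_contra hxy
    obtain ⟨g, hg, h1, h2⟩ := exists_continuous_lt_lt hC hxy
    have h3 : g x = g y := DFunLike.congr_fun h (ofContinuous g hg)
    exact absurd (h1.trans h2) (by rw [h3]; exact lt_irrefl _)
  exact fun x y h => algLE_antisymm _ _ (key _ _ h) (key _ _ h.symm)

theorem continuous_eval (hC : HasAbundanceOfCompactIdempotents C) : Continuous (evalLinear C) := by
  refine continuous_generateFrom_iff.2 ?_
  rintro U (⟨f, a, rfl⟩ | ⟨f', a, rfl⟩)
  · exact f.2.1.isOpen_preimage a
  · rw [isOpen_iff_mem_nhds]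
    rintro x ⟨f, hf, hx⟩
    obtain ⟨c, η, h1, h2, h3, h4⟩ := exists_gap_of_seqWayBelow hC hf
    -- A factor strictly between `1` and `η` leaves a gap on both sides: `f' ≪ θ • c`, while `θ • c`
    -- is continuous and still less than `a` at `x`.
    obtain ⟨θ, hθ1, hθ2⟩ := exists_between h2
    have hθ0 : θ ≠ 0 := (zero_lt_one.trans hθ1).ne'
    have h5 : Continuous (θ • c : C →ₗ[ℝ≥0] ℝ≥0∞) := h1.const_smul θ
    have h6 : (θ • c) x < a := by
      refine lt_of_le_of_lt ((le_trans ?_ (h4 x))) hx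
      rw [LinearMap.smul_apply, ENNReal.nnreal_smul_eq]
      gcongr
    filter_upwards [h5.continuousAt.eventually (gt_mem_nhds h6)] with y hy
    refine ⟨ofContinuous _ h5, seqWayBelow_of_gap h1 hθ1 h3 fun x => ?_, hy⟩
    exact (ENNReal.nnreal_smul_eq _ _).ge

/-- The vectors realized by points of `C` form a closed convex cone `W` in `ℝ^ι`; where `l` is
infinite only a lower bound is asked. If the target `P` were not in `W`, a separating form would
give an inequality `∑ a i • f i ≤ ∑ b i • f i` up to a small correction, and applying `l` to it
contradicts the separation of `P`. -/
theorem exists_forall_eq_of_finite [CuCone (LscSigma C)] (l : FunctionalCone (LscSigma C))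
    {ι : Type*} [Fintype ι] (f : ι → LscSigma C) (hf : ∀ i, Continuous (f i).1) (N : ι → ℝ≥0) :
    ∃ x : C, ∀ i, (l (f i) ≠ ∞ → (f i).1 x = l (f i)) ∧ (l (f i) = ∞ → N i ≤ (f i).1 x) := by
  classical
  let P : ι → ℝ≥0 := fun i => if l (f i) = ∞ then N i else (l (f i)).toNNReal
  let W : Set (ι → ℝ) := {u | (∀ i, 0 ≤ u i) ∧ ∃ x : C, ∀ i,
    (l (f i) ≠ ∞ → (f i).1 x = ENNReal.ofReal (u i)) ∧
      (l (f i) = ∞ → ENNReal.ofReal (u i) ≤ (f i).1 x)}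
  by_cases hP : (fun i => (P i : ℝ)) ∈ W
  · obtain ⟨-, x, hx⟩ := hP
    refine ⟨x, fun i => ⟨fun h => ?_, fun h => ?_⟩⟩
    · rw [(hx i).1 h, ENNReal.ofReal_coe_nnreal]
      simp [P, h]
    · have := (hx i).2 h
      rwa [ENNReal.ofReal_coe_nnreal, show P i = N i from if_pos h] at this
  exfalso
  have hWsmul : ∀ u ∈ W, ∀ t : ℝ, 0 ≤ t → t • u ∈ W := by
    rintro u ⟨hu, x, hx⟩ t ht
    refine ⟨fun i => mul_nonneg ht (hu i), t.toNNReal • x, fun i => ⟨fun h => ?_, fun h => ?_⟩⟩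
    · rw [map_smul, (hx i).1 h, ENNReal.nnreal_smul_eq, Pi.smul_apply, smul_eq_mul,
        ENNReal.ofReal_mul ht]
      rfl
    · rw [map_smul, ENNReal.nnreal_smul_eq, Pi.smul_apply, smul_eq_mul, ENNReal.ofReal_mul ht]
      exact mul_le_mul' le_rfl ((hx i).2 h)
  have hWadd : ∀ u ∈ W, ∀ v ∈ W, u + v ∈ W := by
    rintro u ⟨hu, x, hx⟩ v ⟨hv, y, hy⟩
    refine ⟨fun i => add_nonneg (hu i) (hv i), x + y, fun i => ⟨fun h => ?_, fun h => ?_⟩⟩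
    · rw [map_add, (hx i).1 h, (hy i).1 h, Pi.add_apply, ENNReal.ofReal_add (hu i) (hv i)]
    · rw [map_add, Pi.add_apply, ENNReal.ofReal_add (hu i) (hv i)]
      exact add_le_add ((hx i).2 h) ((hy i).2 h)
  have hWc : IsClosed W := by
    have e : W = {u | ∀ i, 0 ≤ u i} ∩ Prod.snd '' {p : C × (ι → ℝ) | ∀ i,
        (l (f i) ≠ ∞ → (f i).1 p.1 = ENNReal.ofReal (p.2 i)) ∧
        (l (f i) = ∞ → ENNReal.ofReal (p.2 i) ≤ (f i).1 p.1)} := by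
      ext u
      constructor
      · rintro ⟨hu, x, hx⟩
        exact ⟨hu, (x, u), hx, rfl⟩
      · rintro ⟨hu, ⟨x, u⟩, hx, rfl⟩
        exact ⟨hu, x, hx⟩
    rw [e]
    refine IsClosed.inter ?_ (isClosedMap_snd_of_compactSpace _ ?_)
    · simp only [ofPred_forall]
      exact isClosed_iInter fun i => _root_.isClosed_le continuous_const (continuous_apply i)
    · simp only [ofPred_forall, ofPred_and]
      have h1 : ∀ i, Continuous fun p : C × (ι → ℝ) => (f i).1 p.1 := fun i =>
        (hf i).comp continuous_fst
      have h2 : ∀ i, Continuous fun p : C × (ι → ℝ) => ENNReal.ofReal (p.2 i) := fun i =>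
        ENNReal.continuous_ofReal.comp ((continuous_apply i).comp continuous_snd)
      exact isClosed_iInter fun i => (isClosed_iInter fun _ => isClosed_eq (h1 i) (h2 i)).inter
        (isClosed_iInter fun _ => _root_.isClosed_le (h2 i) (h1 i))
  have hW0 : (0 : ι → ℝ) ∈ W := ⟨fun _ => le_rfl, 0, fun i => by simp⟩
  obtain ⟨φ, r, hφP, hφ⟩ := geometric_hahn_banach_point_closed (t := W) (x := fun i => (P i : ℝ))
    (by
      intro u hu v hv a b ha hb _
      exact hWadd _ (hWsmul u hu a ha) _ (hWsmul v hv b hb)) hWc hP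
  have hr : r < 0 := by simpa using hφ 0 hW0
  have hφW : ∀ u ∈ W, 0 ≤ φ u := by
    intro u hu
    by_contra! hneg
    have h1 := hφ _ (hWsmul u hu (r / φ u) (div_nonneg_of_nonpos hr.le hneg.le))
    rw [_root_.map_smul, smul_eq_mul, div_mul_cancel₀ _ hneg.ne] at h1
    exact lt_irrefl _ h1
  set ψ : ι → ℝ := fun i => - φ (Pi.single i 1) with hψ
  have hφψ : ∀ u : ι → ℝ, φ u = - ∑ i, ψ i * u i := by
    intro u
    conv_lhs => rw [← Finset.univ_sum_single u]
    rw [map_sum, ← Finset.sum_neg_distrib]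
    refine Finset.sum_congr rfl fun i _ => ?_
    rw [hψ, neg_mul, neg_neg, mul_comm, ← smul_eq_mul, ← _root_.map_smul, ← Pi.single_smul]
    simp
  -- Positive and negative parts of `ψ`. Negative coefficients at indices with `l (f i) = ∞` are
  -- dropped, since `W` permits a zero coordinate there.
  let a : ι → ℝ≥0 := fun i => (ψ i).toNNReal
  let b : ι → ℝ≥0 := fun i => if l (f i) = ∞ then 0 else (-ψ i).toNNReal
  have hab : ∀ i, l (f i) ≠ ∞ → (a i : ℝ) - b i = ψ i := by
    intro i hi
    simp only [a, b, if_neg hi, Real.coe_toNNReal']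
    rcases le_total 0 (ψ i) with h | h
    · rw [max_eq_left h, max_eq_right (by linarith)]; ring
    · rw [max_eq_right h, max_eq_left (by linarith)]; ring
  have claim : ∀ x : C, (∀ i, l (f i) ≠ ∞ → (f i).1 x ≠ ∞) →
      ∑ i, a i * (f i).1 x ≤ ∑ i, b i * (f i).1 x := by
    intro x hx
    have h1 : ∀ M : ℕ, ∑ i, a i * min ((f i).1 x) (M : ℝ≥0∞) ≤ ∑ i, b i * (f i).1 x := by
      intro M
      let U : ι → ℝ≥0 := fun i => if l (f i) = ∞ then
        (if 0 < ψ i then (min ((f i).1 x) (M : ℝ≥0∞)).toNNReal else 0) else ((f i).1 x).toNNReal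
      have hfin : ∀ i, min ((f i).1 x) (M : ℝ≥0∞) ≠ ∞ := fun i =>
        ne_top_of_le_ne_top (ENNReal.natCast_ne_top M) (min_le_right _ _)
      have hUW : (fun i => (U i : ℝ)) ∈ W := by
        refine ⟨fun i => (U i).2, x, fun i => ⟨fun h => ?_, fun h => ?_⟩⟩
        · rw [ENNReal.ofReal_coe_nnreal]
          simp only [U, if_neg h]
          rw [ENNReal.coe_toNNReal (hx i h)]
        · rw [ENNReal.ofReal_coe_nnreal]
          simp only [U, if_pos h]
          split_ifs
          · rw [ENNReal.coe_toNNReal (hfin i)]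
            exact min_le_left _ _
          · simp
      have h2 := hφW _ hUW
      rw [hφψ] at h2
      have h3 : ∀ i, ((a i * U i : ℝ≥0) : ℝ) - (b i * U i : ℝ≥0) = ψ i * U i := by
        intro i
        push_cast
        by_cases h : l (f i) = ∞
        · simp only [a, b, U, if_pos h]
          split_ifs with h'
          · rw [Real.coe_toNNReal _ h'.le]; simp
          · simp
        · rw [← sub_mul, hab i h]
      have h4 : ∑ i, a i * U i ≤ ∑ i, b i * U i := by
        rw [← NNReal.coe_le_coe, NNReal.coe_sum, NNReal.coe_sum, ← sub_nonpos,
          ← Finset.sum_sub_distrib]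
        simp only [h3]
        linarith
      calc ∑ i, a i * min ((f i).1 x) (M : ℝ≥0∞) ≤ ∑ i, ((a i * U i : ℝ≥0) : ℝ≥0∞) := by
            refine Finset.sum_le_sum fun i _ => ?_
            rw [ENNReal.coe_mul]
            by_cases h : l (f i) = ∞
            · simp only [a, U, if_pos h]
              split_ifs with h'
              · rw [ENNReal.coe_toNNReal (hfin i)]
              · rw [Real.toNNReal_of_nonpos (not_lt.1 h')]; simp
            · simp only [U, if_neg h]
              rw [ENNReal.coe_toNNReal (hx i h)]
              gcongr
              exact min_le_left _ _
        _ ≤ ∑ i, ((b i * U i : ℝ≥0) : ℝ≥0∞) := by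
            rw [← ENNReal.ofNNReal_finsetSum, ← ENNReal.ofNNReal_finsetSum]
            exact_mod_cast h4
        _ ≤ _ := by
            refine Finset.sum_le_sum fun i _ => ?_
            rw [ENNReal.coe_mul]
            by_cases h : l (f i) = ∞
            · simp [b, h]
            · simp only [U, if_neg h]
              rw [ENNReal.coe_toNNReal (hx i h)]
    have h2 : ∀ i, Tendsto (fun M : ℕ => min ((f i).1 x) (M : ℝ≥0∞)) atTop (𝓝 ((f i).1 x)) := by
      intro i
      have := (tendsto_const_nhds (x := (f i).1 x)).min ENNReal.tendsto_nat_nhds_top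
      rwa [min_top_right] at this
    exact le_of_tendsto' (tendsto_finsetSum _ fun i _ => ENNReal.Tendsto.const_mul (h2 i)
      (Or.inr ENNReal.coe_ne_top)) h1
  have hsum : ∀ a : ι → ℝ≥0, ∀ x, (∑ i, a i • f i).1 x = ∑ i, a i * (f i).1 x := by
    intro a x
    rw [Submodule.coe_sum, LinearMap.sum_apply]
    exact Finset.sum_congr rfl fun i _ => smul_apply _ _ _
  have hlsum : ∀ a : ι → ℝ≥0, l (∑ i, a i • f i) = ∑ i, a i * l (f i) := by
    intro a
    rw [← FunctionalCone.toLinearMap_apply, map_sum]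
    exact Finset.sum_congr rfl fun i _ => l.map_smul _ _
  -- `claim` says nothing about points where some `f i` with `l (f i) ≠ ∞` is infinite. Adding `δ •
  -- f i` makes the right side infinite there, at a cost that vanishes with `δ`.
  have hδ : ∀ δ : ℝ≥0, 0 < δ → ∑ i, a i * l (f i) ≤
      ∑ i, ((b i + if l (f i) = ∞ then 0 else δ : ℝ≥0) : ℝ≥0∞) * l (f i) := by
    intro δ hδ
    rw [← hlsum, ← hlsum fun i => b i + if l (f i) = ∞ then 0 else δ]
    refine l.mono fun x => ?_
    change (∑ i, a i • f i).1 x ≤ (∑ i, (b i + if l (f i) = ∞ then 0 else δ) • f i).1 x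
    rw [hsum, hsum]
    by_cases hx : ∀ i, l (f i) ≠ ∞ → (f i).1 x ≠ ∞
    · refine (claim x hx).trans (Finset.sum_le_sum fun i _ => ?_)
      gcongr
      exact le_self_add
    · push Not at hx
      obtain ⟨i, hi, hx⟩ := hx
      refine le_trans le_top (le_trans ?_ (Finset.single_le_sum (fun _ _ => bot_le)
        (Finset.mem_univ i)))
      rw [hx, if_neg hi, ENNReal.mul_top]
      have : b i + δ ≠ 0 := by positivity
      exact_mod_cast this
  have hbfin : ∀ i, (b i : ℝ≥0∞) * l (f i) = (b i * P i : ℝ≥0) := by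
    intro i
    by_cases h : l (f i) = ∞
    · simp [b, h]
    · simp only [P, if_neg h, ENNReal.coe_mul]
      rw [ENNReal.coe_toNNReal h]
  have hlim : ∑ i, a i * l (f i) ≤ ((∑ i, b i * P i : ℝ≥0) : ℝ≥0∞) := by
    set D : ℝ≥0 := ∑ i, if l (f i) = ∞ then 0 else P i with hD
    refine ENNReal.le_of_forall_pos_le_add fun ε hε _ => ?_
    refine (hδ (ε / (D + 1)) (by positivity)).trans ?_
    have h1 : ∀ i, ((b i + if l (f i) = ∞ then 0 else ε / (D + 1) : ℝ≥0) : ℝ≥0∞) * l (f i) =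
        ((b i * P i + ε / (D + 1) * (if l (f i) = ∞ then 0 else P i) : ℝ≥0) : ℝ≥0∞) := by
      intro i
      rw [ENNReal.coe_add, add_mul, hbfin, ENNReal.coe_add]
      congr 1
      by_cases h : l (f i) = ∞
      · simp [h]
      · simp only [P, if_neg h, ENNReal.coe_mul]
        rw [ENNReal.coe_toNNReal h]
    simp only [h1]
    rw [← ENNReal.ofNNReal_finsetSum, ← ENNReal.coe_add, ENNReal.coe_le_coe,
      Finset.sum_add_distrib, ← Finset.mul_sum, ← hD]
    gcongr
    rw [div_mul_eq_mul_div, div_le_iff₀ (by positivity)]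
    gcongr
    exact le_self_add
  have ha0 : ∀ i, l (f i) = ∞ → a i = 0 := by
    intro i hi
    by_contra h0
    have h1 := (Finset.single_le_sum (f := fun i => (a i : ℝ≥0∞) * l (f i)) (fun _ _ => bot_le)
      (Finset.mem_univ i)).trans hlim
    simp only [hi] at h1
    rw [ENNReal.mul_top (by exact_mod_cast h0)] at h1
    exact ENNReal.coe_ne_top (top_le_iff.1 h1)
  have haP : ∀ i, (a i : ℝ≥0∞) * l (f i) = (a i * P i : ℝ≥0) := by
    intro i
    by_cases h : l (f i) = ∞
    · simp [ha0 i h]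
    · simp only [P, if_neg h, ENNReal.coe_mul]
      rw [ENNReal.coe_toNNReal h]
  simp only [haP] at hlim
  rw [← ENNReal.ofNNReal_finsetSum, ENNReal.coe_le_coe, ← NNReal.coe_le_coe, NNReal.coe_sum,
    NNReal.coe_sum, ← sub_nonpos, ← Finset.sum_sub_distrib] at hlim
  have hfinal : ∑ i, ψ i * P i ≤ 0 := by
    refine le_trans (Finset.sum_le_sum fun i _ => ?_) hlim
    push_cast
    rw [← sub_mul]
    by_cases h : l (f i) = ∞
    · have h1 := ha0 i h
      have h2 : ψ i ≤ 0 := Real.toNNReal_eq_zero.1 h1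
      rw [h1]
      simp only [b, if_pos h]
      simpa using mul_nonpos_of_nonpos_of_nonneg h2 (P i).2
    · rw [hab i h]
  rw [hφψ] at hφP
  linarith

/-- The finitely many conditions satisfied in `exists_forall_eq_of_finite` are closed, so
compactness of `C` satisfies all of them at once. Continuous functions determine the rest through
increasing suprema. -/
theorem eval_surjective (hC : HasAbundanceOfCompactIdempotents C) :
    Function.Surjective (evalLinear C) := by
  have := cuCone hC
  intro l
  let A := {g : LscSigma C // Continuous g.1} × ℝ≥0
  let Z : A → Set C := fun p => {x | (l p.1.1 ≠ ∞ → p.1.1.1 x = l p.1.1) ∧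
    (l p.1.1 = ∞ → p.2 ≤ p.1.1.1 x)}
  have hZ : ∀ p, IsClosed (Z p) := by
    rintro ⟨⟨g, hg⟩, N⟩
    simp only [Z, ofPred_and, ofPred_forall]
    exact (isClosed_iInter fun _ => isClosed_eq hg continuous_const).inter
      (isClosed_iInter fun _ => _root_.isClosed_le continuous_const hg)
  obtain ⟨x, -, hx⟩ := isCompact_univ.inter_iInter_nonempty Z hZ (by
    intro s
    obtain ⟨x, hx⟩ := exists_forall_eq_of_finite l (fun i : s => i.1.1.1) (fun i => i.1.1.2)
      (fun i => i.1.2)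
    exact ⟨x, mem_univ _, mem_iInter₂.2 fun p hp => hx ⟨p, hp⟩⟩)
  rw [mem_iInter] at hx
  have h1 : ∀ (g : LscSigma C), Continuous g.1 → g.1 x = l g := by
    intro g hg
    by_cases h : l g = ∞
    · rw [h]
      exact ENNReal.eq_top_of_forall_nnreal_le fun N => (hx (⟨g, hg⟩, N)).2 h
    · exact (hx (⟨g, hg⟩, 0)).1 h
  refine ⟨x, FunctionalCone.ext fun f => ?_⟩
  obtain ⟨c, hc, -, -, h4, h5⟩ := exists_seq_continuous hC f
  have hm : Monotone fun n => ofContinuous (c n) (hc n) := fun _ _ h x => h4 x h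
  rw [l.isLUB hm ((isLUB_iff hm).2 h5)]
  refine (h5 x).trans (iSup_congr fun n => h1 (ofContinuous (c n) (hc n)) (hc n))

/-- Evaluation is an isomorphism of extended Choquet cones. -/
noncomputable def evalEquiv (hC : HasAbundanceOfCompactIdempotents C) :
    C ≃L[ℝ≥0] FunctionalCone (LscSigma C) :=
  { LinearEquiv.ofBijective (evalLinear C) ⟨eval_injective hC, eval_surjective hC⟩ with
    continuous_toFun := continuous_eval hC
    continuous_invFun := by
      have := cuCone hC
      exact (Continuous.homeoOfEquivCompactToT2 (f := (LinearEquiv.ofBijective (evalLinear C)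
        ⟨eval_injective hC, eval_surjective hC⟩).toEquiv) (continuous_eval hC)).symm.continuous }

theorem hasAbundanceOfCompactIdeals (hC : HasAbundanceOfCompactIdempotents C) :
    HasAbundanceOfCompactIdeals (LscSigma C) := by
  have := cuCone hC
  have h1 : (Idem C)ᵒᵈ ≃o (Idem (FunctionalCone (LscSigma C)))ᵒᵈ :=
    (evalEquiv hC).toLinearEquiv.idemOrderIso.dual
  exact (hC.of_orderIso h1).of_orderIso CuIdeal.orderIso.symm

end LscSigma

theorem half_smul_add_half_smul {S : Type*} [AddCommMonoid S] [Module ℝ≥0 S] (x : S) :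
    (2⁻¹ : ℝ≥0) • x + (2⁻¹ : ℝ≥0) • x = x := by
  rw [← add_smul, ← two_mul, mul_inv_cancel₀ two_ne_zero, one_smul]

/-! ### Regularization and differences of comparable functionals. -/

section CuSemigroup

variable {S : Type*} [AddCommMonoid S] [PartialOrder S] [CuSemigroup S]

namespace CuSemigroup

theorem exists_seq (s : S) : ∃ a : ℕ → S, (∀ n, SeqWayBelow (a n) (a (n + 1))) ∧ Monotone a ∧
    IsLUB (range a) s ∧ ∀ n, SeqWayBelow (a n) s := by
  obtain ⟨a, h1, h2⟩ := o2 s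
  exact ⟨a, h1, monotone_nat_of_le_succ fun n => (h1 n).le, h2,
    fun n => (h1 n).trans_le (h2.1 ⟨_, rfl⟩)⟩

theorem zero_wayBelow (s : S) : SeqWayBelow 0 s := fun _ _ _ _ _ => ⟨0, zero_le' _⟩

theorem le_of_forall_wayBelow {s t : S} (h : ∀ s', SeqWayBelow s' s → s' ≤ t) : s ≤ t := by
  obtain ⟨a, -, -, h2, h3⟩ := exists_seq s
  exact h2.2 (by rintro _ ⟨n, rfl⟩; exact h _ (h3 n))

theorem exists_le_add_of_wayBelow {r s t : S} (h : SeqWayBelow r (s + t)) :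
    ∃ s' t', SeqWayBelow s' s ∧ SeqWayBelow t' t ∧ r ≤ s' + t' := by
  obtain ⟨a, -, ha, ha', ha''⟩ := exists_seq s
  obtain ⟨b, -, hb, hb', hb''⟩ := exists_seq t
  obtain ⟨n, hn⟩ := h _ _ (fun _ _ h => add_le_add (ha h) (hb h)) (o3 a b s t ha hb ha' hb') le_rfl
  exact ⟨a n, b n, ha'' n, hb'' n, hn⟩

end CuSemigroup

namespace FunctionalCone

open CuSemigroup

theorem le_of_forall_wayBelow (l : FunctionalCone S) {s : S} {c : ℝ≥0∞}
    (h : ∀ s', SeqWayBelow s' s → l s' ≤ c) : l s ≤ c := by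
  by_contra! hlt
  obtain ⟨s', hs', h'⟩ := l.exists_lt_of_lt hlt
  exact absurd (h s' hs') h'.not_ge

theorem exists_forall_le_add (l : FunctionalCone S) {s : S} (hs : l s ≠ ∞) {a : ℕ → S}
    (ha : Monotone a) (has : IsLUB (range a) s) {ε : ℝ≥0} (hε : 0 < ε) :
    ∃ n, ∀ m, n ≤ m → l s ≤ l (a m) + ε := by
  by_contra! hcon
  have h1 : ∀ n, l (a n) + ε ≤ l s := fun n => by
    obtain ⟨m, hm, h⟩ := hcon n
    exact (add_le_add (l.mono (ha hm)) le_rfl).trans h.le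
  have h2 : l s + ε ≤ l s := by
    conv_lhs => rw [l.isLUB ha has]
    rw [ENNReal.iSup_add]
    exact iSup_le h1
  exact absurd h2 (ENNReal.lt_add_right hs (by exact_mod_cast hε.ne')).not_ge

theorem exists_le_add (l : FunctionalCone S) {s : S} (hs : l s ≠ ∞) {ε : ℝ≥0} (hε : 0 < ε) :
    ∃ s', SeqWayBelow s' s ∧ l s ≤ l s' + ε := by
  obtain ⟨a, -, ha, h1, h2⟩ := exists_seq s
  obtain ⟨n, hn⟩ := l.exists_forall_le_add hs ha h1 hε
  exact ⟨a n, h2 n, hn n le_rfl⟩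

/-- The largest functional below a monotone additive map. -/
noncomputable def regularize (f : S → ℝ≥0∞) (h0 : f 0 = 0) (ha : ∀ s t, f (s + t) = f s + f t)
    (hm : Monotone f) : FunctionalCone S :=
  mk (fun s => ⨆ s' : {s' // SeqWayBelow s' s}, f s'.1)
    (le_antisymm (iSup_le fun s' => (hm s'.2.le).trans h0.le) bot_le)
    (by
      intro s t
      refine le_antisymm (iSup_le fun ⟨r, hr⟩ => ?_) ?_
      · obtain ⟨s', t', hs, ht, hrst⟩ := exists_le_add_of_wayBelow hr
        refine (hm hrst).trans ((ha _ _).trans_le (add_le_add ?_ ?_))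
        · exact le_iSup (fun s' : {s' // SeqWayBelow s' s} => f s'.1) ⟨s', hs⟩
        · exact le_iSup (fun s' : {s' // SeqWayBelow s' t} => f s'.1) ⟨t', ht⟩
      · have h1 : Nonempty {s' // SeqWayBelow s' s} := ⟨⟨0, zero_wayBelow s⟩⟩
        have h2 : Nonempty {s' // SeqWayBelow s' t} := ⟨⟨0, zero_wayBelow t⟩⟩
        refine ENNReal.iSup_add_iSup_le fun s' t' => ?_
        rw [← ha]
        exact le_iSup (fun r : {r // SeqWayBelow r (s + t)} => f r.1)
          ⟨s'.1 + t'.1, o4 _ _ _ _ s'.2 t'.2⟩)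
    (fun s t hst => iSup_le fun s' => le_iSup (fun r : {r // SeqWayBelow r t} => f r.1)
      ⟨s'.1, s'.2.trans_le hst⟩)
    (fun x y hx hy => iSup_le fun ⟨r, hr⟩ => by
      obtain ⟨r', h1, h2⟩ := hr.exists_between
      obtain ⟨n, hn⟩ := h2 x y hx hy le_rfl
      exact le_iSup_of_le n (le_iSup (fun r : {r // SeqWayBelow r (x n)} => f r.1)
        ⟨r, h1.trans_le hn⟩))

section

variable {f : S → ℝ≥0∞} {h0 : f 0 = 0} {ha : ∀ s t, f (s + t) = f s + f t} {hm : Monotone f}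

theorem regularize_le (s : S) : regularize f h0 ha hm s ≤ f s :=
  iSup_le fun s' => hm s'.2.le

theorem le_regularize {s' s : S} (h : SeqWayBelow s' s) : f s' ≤ regularize f h0 ha hm s :=
  le_iSup (fun r : {r // SeqWayBelow r s} => f r.1) ⟨s', h⟩

theorem le_regularize_of_le (l : FunctionalCone S) (h : ∀ s, l s ≤ f s) (s : S) :
    l s ≤ regularize f h0 ha hm s :=
  l.le_of_forall_wayBelow fun s' hs' => (h s').trans (le_regularize hs')

end

/-- The largest element of `F(S)` among those whose sum with `l` is below `m`. -/
theorem exists_max_residual (h5 : AxiomO5 S) {l m : FunctionalCone S} (h : ∀ s, l s ≤ m s) :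
    ∃ r : FunctionalCone S, l + r = m ∧ ∀ u : FunctionalCone S, (∀ s, l s + u s ≤ m s) →
      ∀ s, u s ≤ r s := by
  classical
  let d : S → ℝ≥0∞ := fun s => if l s = ∞ then ∞ else m s - l s
  have hd : ∀ s, l s + d s = m s := by
    intro s
    by_cases hs : l s = ∞
    · simp only [d, if_pos hs, add_top]
      exact (top_le_iff.1 (hs ▸ h s)).symm
    · simp only [d, if_neg hs]
      exact add_tsub_cancel_of_le (h s)
  have d0 : d 0 = 0 := by simp [d, map_zero]
  have dadd : ∀ s t, d (s + t) = d s + d t := by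
    intro s t
    by_cases hs : l s = ∞
    · simp [d, hs, map_add]
    by_cases ht : l t = ∞
    · simp [d, ht, map_add]
    simp only [d, hs, ht, map_add, if_false, ENNReal.add_eq_top, or_self]
    exact ENNReal.add_sub_add (h s) (h t) hs ht
  -- O5 supplies an approximate complement `z` of `s'` in `t`. Comparing `m` and `l` on it, and
  -- cancelling the finite values `l t` and `l z`, gives the monotonicity of the difference.
  have dmono : Monotone d := by
    intro s t hst
    by_cases ht : l t = ∞
    · simp [d, ht]
    have hs : l s ≠ ∞ := ne_top_of_le_ne_top ht (l.mono hst)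
    simp only [d, if_neg ht, if_neg hs]
    rw [tsub_le_iff_right]
    refine m.le_of_forall_wayBelow fun s' hs' => ?_
    obtain ⟨z, hz1, hz2⟩ := h5 s' s t hs' hst
    have e1 : m s' + m z ≤ m t := by rw [← map_add]; exact m.mono hz1
    have e2 : l t ≤ l s + l z := by rw [← map_add]; exact l.mono hz2
    have hz : l z ≠ ∞ := by
      refine ne_top_of_le_ne_top ht (l.mono (le_trans ?_ hz1))
      exact le_add_of_nonneg_left (zero_le' _)
    have e3 : m s' + l z + l t ≤ m t - l t + l s + l z + l t := by
      calc m s' + l z + l t ≤ m s' + m z + (l s + l z) := by gcongr; exact h z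
        _ ≤ m t + (l s + l z) := by gcongr
        _ = (m t - l t) + l t + (l s + l z) := by rw [tsub_add_cancel_of_le (h t)]
        _ = _ := by ring
    have e4 := (ENNReal.add_le_add_iff_right ht).1 e3
    exact (ENNReal.add_le_add_iff_right hz).1 e4
  refine ⟨regularize d d0 dadd dmono, ext fun s => ?_, fun u hu => ?_⟩
  · rw [add_apply]
    refine le_antisymm ?_ ?_
    · calc l s + regularize d d0 dadd dmono s ≤ l s + d s := by gcongr; exact regularize_le s
        _ = m s := hd s
    · refine m.le_of_forall_wayBelow fun s' hs' => ?_
      rw [← hd s']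
      exact add_le_add (l.mono hs'.le) (le_regularize hs')
  · refine le_regularize_of_le u fun s => ?_
    by_cases hs : l s = ∞
    · simp [d, hs]
    · have := hu s
      rw [← hd s] at this
      exact (ENNReal.add_le_add_iff_left hs).1 this

theorem algLE_iff (h5 : AxiomO5 S) {l m : FunctionalCone S} : AlgLE l m ↔ ∀ s, l s ≤ m s := by
  refine ⟨le_of_algLE, fun h => ?_⟩
  obtain ⟨r, hr, -⟩ := exists_max_residual h5 h
  exact ⟨r, hr⟩

end FunctionalCone

end CuSemigroup

/-! ### Approximate Riesz decomposition and positive parts of differences. -/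

section CuCone

variable {S : Type*} [AddCommMonoid S] [PartialOrder S] [Module ℝ≥0 S] [CuCone S]

namespace CuCone

theorem smul_mono {t₁ t₂ : ℝ≥0} (ht : t₁ ≤ t₂) {s₁ s₂ : S} (hs : s₁ ≤ s₂) : t₁ • s₁ ≤ t₂ • s₂ := by
  rcases eq_or_ne t₁ 0 with rfl | h
  · rw [zero_smul]
    exact CuSemigroup.zero_le' _
  · exact smul_le_smul' _ _ _ _ (pos_iff_ne_zero.2 h) ht hs

/-- Cancellation up to a small multiple of the cancelled element. -/
theorem le_add_inv_smul {x y z : S} (h : x + y ≤ x + z) (n : ℕ) :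
    y ≤ z + ((n : ℝ≥0) + 1)⁻¹ • x := by
  have h1 : ∀ n : ℕ, x + ((n : ℝ≥0) + 1) • y ≤ x + ((n : ℝ≥0) + 1) • z := by
    intro n
    induction n with
    | zero => simpa using h
    | succ n ih =>
      push_cast
      rw [add_smul _ 1 y, add_smul _ 1 z, one_smul, one_smul]
      calc x + (((n : ℝ≥0) + 1) • y + y) = (x + ((n : ℝ≥0) + 1) • y) + y := by abel
        _ ≤ (x + ((n : ℝ≥0) + 1) • z) + y := by gcongr
        _ = ((n : ℝ≥0) + 1) • z + (x + y) := by abel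
        _ ≤ ((n : ℝ≥0) + 1) • z + (x + z) := by gcongr
        _ = _ := by abel
  have h0 : ((n : ℝ≥0) + 1) ≠ 0 := by positivity
  have h2 : ((n : ℝ≥0) + 1) • y ≤ x + ((n : ℝ≥0) + 1) • z :=
    (le_add_of_nonneg_left (CuSemigroup.zero_le' x)).trans (h1 n)
  have h3 := smul_mono (le_refl ((n : ℝ≥0) + 1)⁻¹) h2
  rwa [smul_add, smul_smul, smul_smul, inv_mul_cancel₀ h0, one_smul, one_smul, add_comm] at h3

/-- One step of an approximate Riesz decomposition: half of `q` is split along `s` and `r`, and the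
remainder is again below the sum of the remainders of `s` and `r`, up to a small error. -/
theorem exists_half_split (h5 : AxiomO5 S) (h6 : AxiomO6 S) (t : FunctionalCone S) {q s r : S}
    (hq : t q ≠ ∞) (h : q ≤ s + r) {ε : ℝ≥0} (hε : 0 < ε) :
    ∃ α β s₁ r₁ q₁ : S, α + s₁ ≤ s ∧ β + r₁ ≤ r ∧ α + β + q₁ ≤ q ∧ q₁ ≤ s₁ + r₁ ∧
      t q ≤ t α + t β + t q₁ + ε ∧ t q ≤ 2 * (t α + t β) + ε := by
  obtain ⟨δ, hδ, rfl⟩ : ∃ δ : ℝ≥0, 0 < δ ∧ ε = 8 * δ :=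
    ⟨ε / 8, by positivity, by rw [mul_div_cancel₀]; norm_num⟩
  have hfin : ∀ {x}, x ≤ q → t x ≠ ∞ := fun hx => ne_top_of_le_ne_top hq (t.mono hx)
  have hhalf : ∀ x : S, (2⁻¹ : ℝ≥0) • x ≤ x := fun x => by
    conv_rhs => rw [← half_smul_add_half_smul x]
    exact le_add_of_nonneg_left (CuSemigroup.zero_le' _)
  obtain ⟨q', hq', hqq'⟩ := t.exists_le_add hq hδ
  obtain ⟨a, b, hab, haq, has, hbq, hbr⟩ := h6 q s r h q' hq'
  obtain ⟨u, hu1, hu2, hu3, hu4⟩ := CuSemigroup.exists_seq ((2⁻¹ : ℝ≥0) • a)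
  obtain ⟨v, hv1, hv2, hv3, hv4⟩ := CuSemigroup.exists_seq ((2⁻¹ : ℝ≥0) • b)
  obtain ⟨n₁, hn₁⟩ := t.exists_forall_le_add (hfin ((hhalf a).trans haq)) hu2 hu3 hδ
  obtain ⟨n₂, hn₂⟩ := t.exists_forall_le_add (hfin ((hhalf b).trans hbq)) hv2 hv3 hδ
  set j := max n₁ n₂
  have hα := hn₁ j (le_max_left _ _)
  have hβ := hn₂ j (le_max_right _ _)
  -- The complements in `s` and `r` use `u j ≪ u (j + 1)`, the one in `q` uses `u (j + 1) ≪ u (j +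
  -- 2)`. The shift makes the same element `u (j + 1) + v (j + 1)` appear on both sides of the
  -- inequality to be cancelled.
  obtain ⟨s₁, hs₁, hs₁'⟩ := h5 _ _ s (hu1 j) (((hu4 (j + 1)).le.trans (hhalf a)).trans has)
  obtain ⟨r₁, hr₁, hr₁'⟩ := h5 _ _ r (hv1 j) (((hv4 (j + 1)).le.trans (hhalf b)).trans hbr)
  obtain ⟨q₁, hq₁, hq₁'⟩ := h5 _ _ q (CuSemigroup.o4 _ _ _ _ (hu1 (j + 1)) (hv1 (j + 1))) (by
    refine (add_le_add (hu4 (j + 1 + 1)).le (hv4 (j + 1 + 1)).le).trans ?_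
    conv_rhs => rw [← half_smul_add_half_smul q]
    exact add_le_add (smul_mono le_rfl haq) (smul_mono le_rfl hbq))
  have hq₁q : q₁ ≤ q := (le_add_of_nonneg_left (CuSemigroup.zero_le' _)).trans hq₁
  obtain ⟨n, hn⟩ : ∃ n : ℕ, (((n : ℝ≥0) + 1)⁻¹ : ℝ≥0) * t q ≤ δ := by
    lift t q to ℝ≥0 using hq with T
    obtain ⟨n, hn⟩ := exists_nat_ge (T / δ)
    refine ⟨n, ?_⟩
    rw [← ENNReal.coe_mul, ENNReal.coe_le_coe, inv_mul_le_iff₀ (by positivity)]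
    rw [div_le_iff₀ hδ] at hn
    exact hn.trans (by gcongr; exact le_self_add)
  have hcan : q₁ ≤ s₁ + r₁ + ((n : ℝ≥0) + 1)⁻¹ • (u (j + 1) + v (j + 1)) := by
    refine le_add_inv_smul ?_ n
    refine (hq₁.trans (h.trans (add_le_add hs₁' hr₁'))).trans_eq ?_
    abel
  obtain ⟨q₁', hqw, hqt⟩ := t.exists_le_add (hfin hq₁q) hδ
  -- Cancellation leaves a small multiple as an error term; O6 splits it off from `q₁`, and `y` is
  -- the remainder that is returned.
  obtain ⟨y, e, hye, hyq, hysr, -, he⟩ := h6 q₁ _ _ hcan q₁' hqw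
  have hte : t e ≤ δ := by
    refine (t.mono he).trans (le_trans ?_ hn)
    rw [t.map_smul]
    gcongr
    exact t.mono ((le_add_of_nonneg_right (CuSemigroup.zero_le' _)).trans hq₁)
  refine ⟨u j, v j, s₁, r₁, y, hs₁, hr₁, ?_, hysr, ?_, ?_⟩
  · exact (add_le_add (add_le_add (hu1 j).le (hv1 j).le) hyq).trans hq₁
  · calc t q ≤ t (u (j + 1 + 1) + v (j + 1 + 1) + q₁) := t.mono hq₁'
      _ = t (u (j + 1 + 1)) + t (v (j + 1 + 1)) + t q₁ := by rw [t.map_add, t.map_add]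
      _ ≤ (t (u j) + δ) + (t (v j) + δ) + ((t y + δ) + δ) := by
        refine add_le_add (add_le_add ((t.mono (hu4 _).le).trans hα) ((t.mono (hv4 _).le).trans hβ)) ?_
        refine hqt.trans (add_le_add ((t.mono hye).trans ?_) le_rfl)
        rw [t.map_add]
        exact add_le_add le_rfl hte
      _ = t (u j) + t (v j) + t y + (4 * δ : ℝ≥0) := by push_cast; ring
      _ ≤ _ := by gcongr; norm_num
  · calc t q ≤ t (a + b) + δ := hqq'.trans (add_le_add (t.mono hab) le_rfl)
      _ = 2 * (t ((2⁻¹ : ℝ≥0) • a) + t ((2⁻¹ : ℝ≥0) • b)) + δ := by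
        rw [two_mul, ← t.map_add, ← t.map_add, ← smul_add, half_smul_add_half_smul]
      _ ≤ 2 * ((t (u j) + δ) + (t (v j) + δ)) + δ := by gcongr
      _ = 2 * (t (u j) + t (v j)) + (5 * δ : ℝ≥0) := by push_cast; ring
      _ ≤ _ := by gcongr; norm_num

end CuCone

namespace FunctionalCone

/-- The positive part of the difference of two functionals. -/
noncomputable def posDiff (t x : FunctionalCone S) (s : S) : ℝ≥0∞ :=
  ⨆ q : {q // q ≤ s}, t q.1 - x q.1

theorem sub_le_posDiff (t x : FunctionalCone S) {q s : S} (h : q ≤ s) :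
    t q - x q ≤ posDiff t x s :=
  le_iSup (fun q : {q // q ≤ s} => t q.1 - x q.1) ⟨q, h⟩

theorem le_add_posDiff (t x : FunctionalCone S) {q s : S} (h : q ≤ s) :
    t q ≤ x q + posDiff t x s :=
  tsub_le_iff_left.1 (sub_le_posDiff t x h)

theorem posDiff_mono (t x : FunctionalCone S) : Monotone (posDiff t x) := fun _ _ h =>
  iSup_le fun q => sub_le_posDiff t x (q.2.trans h)

theorem posDiff_add_le (t x : FunctionalCone S) (s r : S) :
    posDiff t x s + posDiff t x r ≤ posDiff t x (s + r) := by
  have h1 : Nonempty {q // q ≤ s} := ⟨⟨s, le_rfl⟩⟩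
  have h2 : Nonempty {q // q ≤ r} := ⟨⟨r, le_rfl⟩⟩
  refine ENNReal.iSup_add_iSup_le fun ⟨q, hq⟩ ⟨p, hp⟩ => ?_
  rcases le_total (t q) (x q) with h | h
  · rw [tsub_eq_zero_of_le h, zero_add]
    exact sub_le_posDiff t x (hp.trans (le_add_of_nonneg_left (CuSemigroup.zero_le' _)))
  rcases le_total (t p) (x p) with h' | h'
  · rw [tsub_eq_zero_of_le h', add_zero]
    exact sub_le_posDiff t x (hq.trans (le_add_of_nonneg_right (CuSemigroup.zero_le' _)))
  by_cases hx : x q = ∞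
  · rw [hx, ENNReal.sub_top, zero_add]
    exact sub_le_posDiff t x (hp.trans (le_add_of_nonneg_left (CuSemigroup.zero_le' _)))
  by_cases hx' : x p = ∞
  · rw [hx', ENNReal.sub_top, add_zero]
    exact sub_le_posDiff t x (hq.trans (le_add_of_nonneg_right (CuSemigroup.zero_le' _)))
  rw [← ENNReal.add_sub_add h h' hx hx', ← map_add, ← map_add]
  exact sub_le_posDiff t x (add_le_add hq hp)

/-- Each half-split accounts for half of `t q`, up to an arbitrarily small error, and leaves a
remainder to which the same estimate applies; superadditivity of `posDiff` collects the pieces. -/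
theorem le_add_posDiff_add_pow (h5 : AxiomO5 S) (h6 : AxiomO6 S) (t x : FunctionalCone S) (k : ℕ) :
    ∀ {q s r : S}, t q ≠ ∞ → q ≤ s + r →
      t q ≤ x q + (posDiff t x s + posDiff t x r) + 2⁻¹ ^ k * t q := by
  induction k with
  | zero => intro q s r _ _; simp
  | succ k ih =>
    intro q s r hq h
    refine ENNReal.le_of_forall_pos_le_add fun ε hε _ => ?_
    obtain ⟨δ, hδ, rfl⟩ : ∃ δ : ℝ≥0, 0 < δ ∧ ε = 2 * δ :=
      ⟨ε / 2, by positivity, by rw [mul_div_cancel₀]; norm_num⟩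
    obtain ⟨α, β, s₁, r₁, q₁, hs, hr, hq₁, hsr, e1, e2⟩ := CuCone.exists_half_split h5 h6 t hq h hδ
    have hq₁q : q₁ ≤ q := (le_add_of_nonneg_left (CuSemigroup.zero_le' _)).trans hq₁
    have e3 := ih (ne_top_of_le_ne_top hq (t.mono hq₁q)) hsr
    have e4 : t α + t β + t q₁ ≤ t q := by rw [← t.map_add, ← t.map_add]; exact t.mono hq₁
    have e5 : x α + x β + x q₁ ≤ x q := by rw [← x.map_add, ← x.map_add]; exact x.mono hq₁
    have e6 : posDiff t x α + posDiff t x s₁ ≤ posDiff t x s :=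
      (posDiff_add_le t x _ _).trans (posDiff_mono t x hs)
    have e7 : posDiff t x β + posDiff t x r₁ ≤ posDiff t x r :=
      (posDiff_add_le t x _ _).trans (posDiff_mono t x hr)
    have hαβ : t α + t β ≠ ∞ := ne_top_of_le_ne_top hq (le_self_add.trans e4)
    have e8 : 2 * t q₁ ≤ t q + δ := by
      have h2 : (2 : ℝ≥0∞) * (t α + t β) ≠ ∞ := ENNReal.mul_ne_top ENNReal.ofNat_ne_top hαβ
      refine (ENNReal.add_le_add_iff_right h2).1 ?_
      calc 2 * t q₁ + 2 * (t α + t β) = 2 * (t α + t β + t q₁) := by ring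
        _ ≤ 2 * t q := by gcongr
        _ = t q + t q := two_mul _
        _ ≤ t q + (2 * (t α + t β) + δ) := by gcongr
        _ = _ := by ring
    have e9 : (2⁻¹ : ℝ≥0∞) ^ k * t q₁ ≤ 2⁻¹ ^ (k + 1) * t q + δ := by
      calc (2⁻¹ : ℝ≥0∞) ^ k * t q₁ = 2⁻¹ ^ (k + 1) * (2 * t q₁) := by
            rw [pow_succ, mul_assoc, ← mul_assoc 2⁻¹ 2, ENNReal.inv_mul_cancel two_ne_zero
              ENNReal.ofNat_ne_top, one_mul]
        _ ≤ 2⁻¹ ^ (k + 1) * (t q + δ) := by gcongr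
        _ = 2⁻¹ ^ (k + 1) * t q + 2⁻¹ ^ (k + 1) * δ := mul_add _ _ _
        _ ≤ _ := by
          gcongr
          refine mul_le_of_le_one_left bot_le (pow_le_one₀ bot_le ?_)
          exact ENNReal.inv_le_one.2 one_le_two
    calc t q ≤ t α + t β + t q₁ + δ := e1
      _ ≤ (x α + posDiff t x α) + (x β + posDiff t x β) +
          (x q₁ + (posDiff t x s₁ + posDiff t x r₁) + (2⁻¹ ^ (k + 1) * t q + δ)) + δ := by
        gcongr
        · exact le_add_posDiff t x le_rfl
        · exact le_add_posDiff t x le_rfl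
        · exact e3.trans (by gcongr)
      _ = (x α + x β + x q₁) + ((posDiff t x α + posDiff t x s₁) +
          (posDiff t x β + posDiff t x r₁)) + 2⁻¹ ^ (k + 1) * t q + (2 * δ : ℝ≥0) := by
        push_cast; ring
      _ ≤ _ := by gcongr

theorem le_add_posDiff_add (h5 : AxiomO5 S) (h6 : AxiomO6 S) (t x : FunctionalCone S) {q s r : S}
    (h : q ≤ s + r) : t q ≤ x q + (posDiff t x s + posDiff t x r) := by
  refine t.le_of_forall_wayBelow fun q' hq' => ?_
  -- The iteration needs a finite value. If the value is infinite, O6 alone gives a piece below `s`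
  -- or `r` on which `t` is infinite.
  by_cases ht : t q' = ∞
  · obtain ⟨a, b, hab, haq, has, hbq, hbr⟩ := h6 q s r h q' hq'
    have h1 : t a + t b = ∞ := top_le_iff.1 (by rw [← ht, ← t.map_add]; exact t.mono hab)
    by_cases hx : x q = ∞
    · simp [hx]
    have key : ∀ c d, c ≤ q → c ≤ d → t c = ∞ → posDiff t x d = ∞ := by
      intro c d hcq hcd hc
      refine top_le_iff.1 ((sub_le_posDiff t x hcd).trans' ?_)
      rw [hc, ENNReal.top_sub (ne_top_of_le_ne_top hx (x.mono hcq))]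
    rcases ENNReal.add_eq_top.1 h1 with h2 | h2
    · rw [key a s haq has h2]; simp
    · rw [key b r hbq hbr h2]; simp
  · have h1 := fun k => le_add_posDiff_add_pow h5 h6 t x k ht (hq'.le.trans h)
    have h2 : Tendsto (fun k : ℕ => x q' + (posDiff t x s + posDiff t x r) + 2⁻¹ ^ k * t q') atTop
        (𝓝 (x q' + (posDiff t x s + posDiff t x r) + 0 * t q')) := by
      refine tendsto_const_nhds.add (ENNReal.Tendsto.mul_const ?_ (Or.inr ht))
      exact ENNReal.tendsto_pow_atTop_nhds_zero_of_lt_one (ENNReal.inv_lt_one.2 ENNReal.one_lt_two)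
    rw [zero_mul, add_zero] at h2
    exact (ge_of_tendsto' h2 h1).trans (add_le_add (x.mono hq'.le) le_rfl)

theorem posDiff_add (h5 : AxiomO5 S) (h6 : AxiomO6 S) (t x : FunctionalCone S) (s r : S) :
    posDiff t x (s + r) = posDiff t x s + posDiff t x r :=
  le_antisymm (iSup_le fun q => tsub_le_iff_left.2 (le_add_posDiff_add h5 h6 t x q.2))
    (posDiff_add_le t x s r)

/-- The least element of `F(S)` whose sum with `x` is above `t`. -/
theorem exists_min_residual (h5 : AxiomO5 S) (h6 : AxiomO6 S) (t x : FunctionalCone S) :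
    ∃ r : FunctionalCone S, (∀ s, t s ≤ x s + r s) ∧ ∀ u : FunctionalCone S,
      (∀ s, t s ≤ x s + u s) → ∀ s, r s ≤ u s := by
  refine ⟨regularize (posDiff t x) (le_antisymm (iSup_le fun q => ?_) bot_le)
    (posDiff_add h5 h6 t x) (posDiff_mono t x), fun s => ?_, fun u hu s => ?_⟩
  · rw [le_antisymm q.2 (CuSemigroup.zero_le' _), map_zero, zero_tsub]
  · refine t.le_of_forall_wayBelow fun s' hs' => (le_add_posDiff t x le_rfl).trans ?_
    exact add_le_add (x.mono hs'.le) (le_regularize hs')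
  · refine (regularize_le s).trans (iSup_le fun q => ?_)
    exact (tsub_le_iff_left.2 (hu q.1)).trans (u.mono q.2)

end FunctionalCone

end CuCone

/-! ### The functionals form an extended Choquet cone. -/

theorem ENNReal.exists_add_lt {x y a : ℝ≥0∞} (h : x + y < a) :
    ∃ b c, x < b ∧ y < c ∧ b + c < a := by
  have hx : x ≠ ∞ := fun h' => by simp [h'] at h
  have hy : y ≠ ∞ := fun h' => by simp [h'] at h
  have h1 : ∀ᶠ p in 𝓝 (x, y), p.1 + p.2 < a :=
    (continuous_fst.add continuous_snd).continuousAt.eventually (gt_mem_nhds h)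
  have : (𝓝[>] x).NeBot := nhdsGT_neBot_of_exists_gt ⟨∞, lt_top_iff_ne_top.2 hx⟩
  have : (𝓝[>] y).NeBot := nhdsGT_neBot_of_exists_gt ⟨∞, lt_top_iff_ne_top.2 hy⟩
  rw [nhds_prod_eq] at h1
  have h2 := h1.filter_mono (prod_mono (nhdsWithin_le_nhds (s := Ioi x))
    (nhdsWithin_le_nhds (s := Ioi y)))
  obtain ⟨⟨b, c⟩, h3, hb, hc⟩ := (h2.and (prod_mem_prod self_mem_nhdsWithin
    self_mem_nhdsWithin)).exists
  exact ⟨b, c, hb, hc, h3⟩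

theorem ENNReal.exists_eventually_lt_mul {t : ℝ≥0} (ht : 0 < t) {x a : ℝ≥0∞} (h : a < t * x) :
    ∃ b < x, ∀ᶠ s : ℝ≥0 in 𝓝 t, a < s * b := by
  have hx : x ≠ 0 := fun h' => by simp [h'] at h
  have h0 : (t : ℝ≥0∞) ≠ 0 := by exact_mod_cast ht.ne'
  have h1 : ∀ᶠ p in 𝓝 (x, (t : ℝ≥0∞)), a < p.2 * p.1 :=
    (((ENNReal.tendsto_mul (Or.inl h0) (Or.inr ENNReal.coe_ne_top)).comp
      (continuous_swap.tendsto (x, (t : ℝ≥0∞)))).eventually (lt_mem_nhds h))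
  have : (𝓝[<] x).NeBot := nhdsLT_neBot_of_exists_lt ⟨0, pos_iff_ne_zero.2 hx⟩
  rw [nhds_prod_eq] at h1
  obtain ⟨b, hb, hbx⟩ := ((h1.curry.filter_mono (nhdsWithin_le_nhds (s := Iio x))).and
    self_mem_nhdsWithin).exists
  exact ⟨b, hbx, (ENNReal.continuous_coe.tendsto t).eventually hb⟩

theorem ENNReal.exists_eventually_mul_lt {t : ℝ≥0} (ht : 0 < t) {x a : ℝ≥0∞} (h : t * x < a) :
    ∃ b > x, ∀ᶠ s : ℝ≥0 in 𝓝 t, s * b < a := by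
  have h0 : (t : ℝ≥0∞) ≠ 0 := by exact_mod_cast ht.ne'
  have hx : x ≠ ∞ := fun h' => by simp [h', ENNReal.mul_top h0] at h
  have h1 : ∀ᶠ p in 𝓝 (x, (t : ℝ≥0∞)), p.2 * p.1 < a :=
    (((ENNReal.tendsto_mul (Or.inl h0) (Or.inr ENNReal.coe_ne_top)).comp
      (continuous_swap.tendsto (x, (t : ℝ≥0∞)))).eventually (gt_mem_nhds h))
  have : (𝓝[>] x).NeBot := nhdsGT_neBot_of_exists_gt ⟨∞, lt_top_iff_ne_top.2 hx⟩
  rw [nhds_prod_eq] at h1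
  obtain ⟨b, hb, hbx⟩ := ((h1.curry.filter_mono (nhdsWithin_le_nhds (s := Ioi x))).and
    self_mem_nhdsWithin).exists
  exact ⟨b, hbx, (ENNReal.continuous_coe.tendsto t).eventually hb⟩

namespace FunctionalCone

section Lattice

variable {S : Type*} [AddCommMonoid S] [PartialOrder S] [Module ℝ≥0 S] [CuCone S]

theorem exists_iSup_of_directed {ι : Type*} [Nonempty ι] (l : ι → FunctionalCone S)
    (hl : ∀ i j, ∃ k, (∀ s, l i s ≤ l k s) ∧ ∀ s, l j s ≤ l k s) :
    ∃ m : FunctionalCone S, ∀ s, m s = ⨆ i, l i s := by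
  refine ⟨mk (fun s => ⨆ i, l i s) (by simp [map_zero]) (fun s t => ?_)
    (fun s t h => iSup_mono fun i => (l i).mono h) (fun x y hx hy => ?_), fun s => rfl⟩
  · simp only [map_add]
    refine (ENNReal.iSup_add_iSup fun i j => ?_).symm
    obtain ⟨k, h1, h2⟩ := hl i j
    exact ⟨k, add_le_add (h1 s) (h2 t)⟩
  · refine iSup_le fun i => ?_
    rw [(l i).isLUB hx hy]
    exact iSup_mono fun n => le_iSup (fun i => l i (x n)) i

theorem exists_isAlgSup (h5 : AxiomO5 S) (h6 : AxiomO6 S) (x y : FunctionalCone S) :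
    ∃ m, IsAlgSup x y m := by
  obtain ⟨r, h1, h2⟩ := exists_min_residual h5 h6 y x
  refine ⟨x + r, AlgLE.self_add _ _, (algLE_iff h5).2 h1, ?_⟩
  rintro _ ⟨z, rfl⟩ hz
  exact (AlgLE.refl x).add ((algLE_iff h5).2 (h2 z (le_of_algLE hz)))

/-- The common lower bounds are directed because binary suprema exist, and directed suprema of
functionals are pointwise. -/
theorem exists_isAlgInf (h5 : AxiomO5 S) (h6 : AxiomO6 S) (x y : FunctionalCone S) :
    ∃ m, IsAlgInf x y m := by
  let A := {l : FunctionalCone S // AlgLE l x ∧ AlgLE l y}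
  have : Nonempty A := ⟨⟨0, AlgLE.zero_le _, AlgLE.zero_le _⟩⟩
  obtain ⟨m, hm⟩ := exists_iSup_of_directed (fun l : A => l.1) (by
    intro i j
    obtain ⟨k, h1, h2, h3⟩ := exists_isAlgSup h5 h6 i.1 j.1
    exact ⟨⟨k, h3 _ i.2.1 j.2.1, h3 _ i.2.2 j.2.2⟩, le_of_algLE h1, le_of_algLE h2⟩)
  refine ⟨m, (algLE_iff h5).2 fun s => ?_, (algLE_iff h5).2 fun s => ?_, fun z h1 h2 =>
    (algLE_iff h5).2 fun s => ?_⟩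
  · rw [hm]
    exact iSup_le fun l => le_of_algLE l.2.1 s
  · rw [hm]
    exact iSup_le fun l => le_of_algLE l.2.2 s
  · rw [hm]
    exact le_iSup (fun l : A => l.1 s) ⟨z, h1, h2⟩

/-- By minimality of the residual, addition of `x` has a lower adjoint, and so it preserves infima.
Dually, the maximal residual gives the statement for suprema. -/
theorem add_isAlgInf (h5 : AxiomO5 S) (h6 : AxiomO6 S) {x y z m : FunctionalCone S}
    (h : IsAlgInf y z m) : IsAlgInf (x + y) (x + z) (x + m) := by
  refine ⟨(AlgLE.refl x).add h.1, (AlgLE.refl x).add h.2.1, fun v h1 h2 => ?_⟩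
  obtain ⟨r, hr1, hr2⟩ := exists_min_residual h5 h6 v x
  refine AlgLE.trans ((algLE_iff h5).2 hr1) ((AlgLE.refl x).add (h.2.2 r ?_ ?_))
  · exact (algLE_iff h5).2 (hr2 y (le_of_algLE h1))
  · exact (algLE_iff h5).2 (hr2 z (le_of_algLE h2))

theorem add_isAlgSup (h5 : AxiomO5 S) {x y z m : FunctionalCone S}
    (h : IsAlgSup y z m) : IsAlgSup (x + y) (x + z) (x + m) := by
  refine ⟨(AlgLE.refl x).add h.1, (AlgLE.refl x).add h.2.1, fun v h1 h2 => ?_⟩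
  obtain ⟨r, rfl, hr⟩ := exists_max_residual h5
    (le_of_algLE ((AlgLE.self_add x y).trans h1))
  exact (AlgLE.refl x).add (h.2.2 r ((algLE_iff h5).2 (hr y (le_of_algLE h1)))
    ((algLE_iff h5).2 (hr z (le_of_algLE h2))))

end Lattice

section Topology

theorem tendsto_nhds_iff {S : Type*} [AddCommMonoid S] [PartialOrder S] {ι : Type*} {f : Filter ι} {l : ι → FunctionalCone S}
    {l₀ : FunctionalCone S} : Tendsto l f (𝓝 l₀) ↔ (∀ s a, a < l₀ s → ∀ᶠ i in f, a < l i s) ∧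
      ∀ s' s a, SeqWayBelow s' s → l₀ s < a → ∀ᶠ i in f, ∃ t, SeqWayBelow s' t ∧ l i t < a := by
  constructor
  · intro h
    exact ⟨fun s a ha => h.eventually ((isOpen_lt s a).mem_nhds ha), fun s' s a hs ha =>
      h.eventually ((isOpen_gt s' a).mem_nhds ⟨s, hs, ha⟩)⟩
  · rintro ⟨h1, h2⟩
    refine TopologicalSpace.tendsto_nhds_generateFrom_iff.2 ?_
    rintro U (⟨s, a, rfl⟩ | ⟨s', a, rfl⟩) hU
    · exact h1 s a hU
    · obtain ⟨s, hs, hlt⟩ := hU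
      exact h2 s' s a hs hlt

variable {S : Type*} [AddCommMonoid S] [PartialOrder S] [CuSemigroup S]

theorem tendsto_of_forall {ι : Type*} {f : Filter ι} {l : ι → FunctionalCone S}
    {l₀ : FunctionalCone S} (h1 : ∀ s a, a < l₀ s → ∀ᶠ i in f, a < l i s)
    (h2 : ∀ s' s a, SeqWayBelow s' s → l₀ s < a → ∀ᶠ i in f, l i s' < a) : Tendsto l f (𝓝 l₀) := by
  refine tendsto_nhds_iff.2 ⟨h1, fun s' s a hs ha => ?_⟩
  obtain ⟨t, ht1, ht2⟩ := hs.exists_between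
  exact (h2 t s a ht2 ha).mono fun i hi => ⟨t, ht1, hi⟩

theorem eventually_lt {s' s : S} (hs : SeqWayBelow s' s) {l₀ : FunctionalCone S} {a : ℝ≥0∞}
    (ha : l₀ s < a) : ∀ᶠ l in 𝓝 l₀, l s' < a := by
  filter_upwards [(isOpen_gt s' a).mem_nhds ⟨s, hs, ha⟩] with l ⟨t, ht, hlt⟩
  exact (l.mono ht.le).trans_lt hlt

theorem lowerSemicontinuous_apply (s : S) :
    LowerSemicontinuous fun l : FunctionalCone S => l s :=
  lowerSemicontinuous_iff_isOpen_preimage.2 fun a => isOpen_lt s a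

/-- A pointwise limit along an ultrafilter is additive and monotone but may fail to preserve
suprema. Its regularization is still a limit, because the topology tests upper bounds only between
elements `s' ≪ s`. -/
instance instCompactSpace : CompactSpace (FunctionalCone S) := by
  refine ⟨isCompact_iff_ultrafilter_le_nhds.2 fun u _ => ?_⟩
  have hlim : ∀ s : S, ∃ c : ℝ≥0∞, Tendsto (fun l : FunctionalCone S => l s) u (𝓝 c) := by
    intro s
    obtain ⟨c, -, hc⟩ := isCompact_univ.ultrafilter_le_nhds
      (u.map fun l : FunctionalCone S => l s) (by simp)
    exact ⟨c, hc⟩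
  choose c hc using hlim
  have h0 : c 0 = 0 := tendsto_nhds_unique (hc 0) (by simp only [map_zero]; exact tendsto_const_nhds)
  have hadd : ∀ s t, c (s + t) = c s + c t := fun s t =>
    tendsto_nhds_unique (hc (s + t)) (by simp only [map_add]; exact (hc s).add (hc t))
  have hmono : Monotone c := fun s t h =>
    le_of_tendsto_of_tendsto' (hc s) (hc t) fun l => l.mono h
  refine ⟨regularize c h0 hadd hmono, mem_univ _, ?_⟩
  refine (tendsto_of_forall (l := id) ?_ ?_ : Tendsto id (u : Filter (FunctionalCone S)) _)
  · intro s a ha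
    obtain ⟨s', hs', h⟩ := exists_lt_of_lt _ ha
    exact (hc s).eventually (lt_mem_nhds (h.trans_le
      ((regularize_le s').trans (hmono hs'.le))))
  · intro s' s a hs ha
    exact (hc s').eventually (gt_mem_nhds ((le_regularize hs).trans_lt ha))

instance instContinuousAdd : ContinuousAdd (FunctionalCone S) := by
  refine ⟨continuous_iff_continuousAt.2 fun ⟨l, m⟩ => tendsto_of_forall ?_ ?_⟩
  · intro s a ha
    have : LowerSemicontinuous fun p : FunctionalCone S × FunctionalCone S => p.1 s + p.2 s :=
      ((lowerSemicontinuous_apply s).comp continuous_fst).add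
        ((lowerSemicontinuous_apply s).comp continuous_snd)
    exact this (l, m) a ha
  · intro s' s a hs ha
    rw [add_apply] at ha
    obtain ⟨b, c, hb, hc, hbc⟩ := ENNReal.exists_add_lt ha
    filter_upwards [(continuous_fst.tendsto (l, m)).eventually (eventually_lt hs hb),
      (continuous_snd.tendsto (l, m)).eventually (eventually_lt hs hc)] with p h1 h2
    exact (ENNReal.add_lt_add h1 h2).trans hbc

theorem convex_lt (s : S) (a : ℝ≥0∞) : Convex ℝ≥0 {l : FunctionalCone S | a < l s} := by
  intro l hl m hm α β _ _ hαβ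
  rw [mem_ofPred_eq, add_apply, smul_apply, smul_apply]
  calc a < min (l s) (m s) := lt_min hl hm
    _ = α * min (l s) (m s) + β * min (l s) (m s) := by
      rw [← add_mul, ← ENNReal.coe_add, hαβ, ENNReal.coe_one, one_mul]
    _ ≤ _ := by gcongr; exacts [min_le_left _ _, min_le_right _ _]

theorem convex_gt (s : S) (a : ℝ≥0∞) : Convex ℝ≥0 {l : FunctionalCone S | l s < a} := by
  intro l hl m hm α β _ _ hαβ
  rw [mem_ofPred_eq, add_apply, smul_apply, smul_apply]
  calc α * l s + β * m s ≤ α * max (l s) (m s) + β * max (l s) (m s) := by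
        gcongr; exacts [le_max_left _ _, le_max_right _ _]
    _ = max (l s) (m s) := by
      rw [← add_mul, ← ENNReal.coe_add, hαβ, ENNReal.coe_one, one_mul]
    _ < a := max_lt hl hm

theorem exists_convex_nhd (l : FunctionalCone S) {U : Set (FunctionalCone S)} (hU : IsOpen U)
    (hl : l ∈ U) : ∃ V, IsOpen V ∧ Convex ℝ≥0 V ∧ l ∈ V ∧ V ⊆ U := by
  induction hU with
  | basic U hU =>
    rcases hU with ⟨s, a, rfl⟩ | ⟨s', a, rfl⟩
    · exact ⟨_, isOpen_lt s a, convex_lt s a, hl, subset_rfl⟩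
    · obtain ⟨s, hs, hlt⟩ := hl
      have hstep : ∀ t : {t // SeqWayBelow s' t}, ∃ r : {t // SeqWayBelow s' t},
          SeqWayBelow r.1 t.1 := fun t => by
        obtain ⟨r, h1, h2⟩ := t.2.exists_between
        exact ⟨⟨r, h1⟩, h2⟩
      choose next hnext using hstep
      -- A decreasing sequence above `s'` replaces the union over all `t` with `s' ≪ t`: its sets
      -- increase, so their union is convex, and it is open because consecutive terms are way below
      -- each other.
      let T : ℕ → {t // SeqWayBelow s' t} := fun n => Nat.rec ⟨s, hs⟩ (fun _ t => next t) n
      have hT : ∀ n, SeqWayBelow (T (n + 1)).1 (T n).1 := fun n => hnext (T n)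
      refine ⟨⋃ n, {m | m (T n).1 < a}, ?_, ?_, mem_iUnion.2 ⟨0, hlt⟩, ?_⟩
      · rw [isOpen_iff_mem_nhds]
        intro m hm
        obtain ⟨n, hn⟩ := mem_iUnion.1 hm
        filter_upwards [eventually_lt (hT n) hn] with k hk
        exact mem_iUnion.2 ⟨n + 1, hk⟩
      · refine (Monotone.directed_le ?_).convex_iUnion fun n => convex_gt _ _
        exact monotone_nat_of_le_succ fun n m hm => (m.mono (hT n).le).trans_lt hm
      · intro m hm
        obtain ⟨n, hn⟩ := mem_iUnion.1 hm
        exact ⟨_, (T n).2, hn⟩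
  | univ => exact ⟨univ, isOpen_univ, convex_univ, mem_univ _, subset_rfl⟩
  | inter U V _ _ hU hV =>
    obtain ⟨U', h1, h2, h3, h4⟩ := hU hl.1
    obtain ⟨V', h1', h2', h3', h4'⟩ := hV hl.2
    exact ⟨U' ∩ V', h1.inter h1', h2.inter h2', ⟨h3, h3'⟩, inter_subset_inter h4 h4'⟩
  | sUnion T _ ih =>
    obtain ⟨U, hUT, hlU⟩ := hl
    obtain ⟨V, h1, h2, h3, h4⟩ := ih U hUT hlU
    exact ⟨V, h1, h2, h3, h4.trans (subset_sUnion_of_mem hUT)⟩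

end Topology

section ExtendedChoquetCone

variable {S : Type*} [AddCommMonoid S] [PartialOrder S] [Module ℝ≥0 S] [CuCone S]

theorem continuousOn_smul : ContinuousOn (fun p : ℝ≥0 × FunctionalCone S => p.1 • p.2)
    {p | 0 < p.1} := by
  rintro ⟨t, l⟩ (ht : 0 < t)
  refine ContinuousAt.continuousWithinAt (tendsto_of_forall ?_ ?_)
  · intro s a ha
    rw [smul_apply] at ha
    obtain ⟨b, hb, hbt⟩ := ENNReal.exists_eventually_lt_mul ht ha
    filter_upwards [(continuous_fst.tendsto (t, l)).eventually hbt,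
      (continuous_snd.tendsto (t, l)).eventually ((isOpen_lt s b).mem_nhds hb)] with p h1 h2
    rw [smul_apply]
    exact h1.trans_le (mul_le_mul' le_rfl (le_of_lt h2))
  · intro s' s a hs ha
    rw [smul_apply] at ha
    obtain ⟨b, hb, hbt⟩ := ENNReal.exists_eventually_mul_lt ht ha
    filter_upwards [(continuous_fst.tendsto (t, l)).eventually hbt,
      (continuous_snd.tendsto (t, l)).eventually (eventually_lt hs hb)] with p h1 h2
    rw [smul_apply]
    exact (mul_le_mul' le_rfl (le_of_lt h2)).trans_lt h1

theorem isExtendedChoquetCone (h5 : AxiomO5 S) (h6 : AxiomO6 S) :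
    IsExtendedChoquetCone (FunctionalCone S) where
  algLE_antisymm x y h1 h2 := ext fun s => le_antisymm (le_of_algLE h1 s) (le_of_algLE h2 s)
  continuousOn_smul := continuousOn_smul
  exists_inf := exists_isAlgInf h5 h6
  exists_sup := exists_isAlgSup h5 h6
  add_inf _ _ _ _ h := add_isAlgInf h5 h6 h
  add_sup _ _ _ _ h := add_isAlgSup h5 h
  locallyConvex := ⟨{U | IsOpen U ∧ Convex ℝ≥0 U},
    TopologicalSpace.isTopologicalBasis_of_isOpen_of_nhds (fun _ h => h.1) fun l U hl hU => by
      obtain ⟨V, h1, h2, h3, h4⟩ := exists_convex_nhd l hU hl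
      exact ⟨V, ⟨h1, h2⟩, h3, h4⟩, fun _ h => h.2⟩

theorem hasAbundanceOfCompactIdempotents (h : HasAbundanceOfCompactIdeals S) :
    HasAbundanceOfCompactIdempotents (FunctionalCone S) :=
  h.of_orderIso CuIdeal.orderIso

end ExtendedChoquetCone

end FunctionalCone

/-! ### Elements of a Cu-cone as functions on its functionals. -/

namespace CuCone

variable {S : Type*} [AddCommMonoid S] [PartialOrder S] [Module ℝ≥0 S] [CuCone S]

theorem exists_seq_smul (s : S) : ∃ t : ℕ → ℝ≥0, (∀ n, 0 < t n ∧ t n < 1) ∧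
    Monotone (fun n => t n • s) ∧ IsLUB (range fun n => t n • s) s := by
  obtain ⟨t, ht, ht', hlim⟩ := exists_seq_strictMono_tendsto' (zero_lt_one (α := ℝ≥0))
  refine ⟨t, ht', fun m n h => smul_mono (ht.monotone h) le_rfl, ?_⟩
  have := isLUB_smul t (fun _ => s) 1 s (fun n => (ht' n).1) ht.monotone monotone_const
    (isLUB_of_tendsto_atTop ht.monotone hlim) (by simp)
  rwa [one_smul] at this

theorem le_of_forall_le_smul {s t : S} (h : ∀ r : ℝ≥0, 1 < r → s ≤ r • t) : s ≤ t := by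
  obtain ⟨u, hu, -, hs⟩ := exists_seq_smul s
  refine hs.2 ?_
  rintro _ ⟨n, rfl⟩
  have := smul_mono (le_refl (u n)) (h (u n)⁻¹ ((one_lt_inv₀ (hu n).1).2 (hu n).2))
  rwa [smul_smul, mul_inv_cancel₀ (hu n).1.ne', one_smul] at this

theorem exists_le_smul_of_wayBelow {s t : S} (h : SeqWayBelow s t) :
    ∃ r : ℝ≥0, 0 < r ∧ r < 1 ∧ s ≤ r • t := by
  obtain ⟨u, hu, hm, ht⟩ := exists_seq_smul t
  obtain ⟨n, hn⟩ := h _ _ hm ht le_rfl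
  exact ⟨u n, (hu n).1, (hu n).2, hn⟩

end CuCone

namespace FunctionalCone

variable {S : Type*} [AddCommMonoid S] [PartialOrder S]

theorem isCompact_ge [CuSemigroup S] (s : S) (b : ℝ≥0∞) :
    IsCompact {l : FunctionalCone S | ∀ t, SeqWayBelow s t → b ≤ l t} := by
  have h : {l : FunctionalCone S | ∀ t, SeqWayBelow s t → b ≤ l t} =
      {l : FunctionalCone S | ∃ t, SeqWayBelow s t ∧ l t < b}ᶜ := by
    ext l
    simp
  rw [h]
  exact (isOpen_gt s b).isClosed_compl.isCompact

variable [Module ℝ≥0 S] [CuCone S]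

/-- Elements of a Cu-cone as functions on its cone of functionals. -/
noncomputable def hat (s : S) : LscSigma (FunctionalCone S) where
  val :=
    { toFun := fun l => l s
      map_add' := fun l m => add_apply l m s
      map_smul' := fun t l => by
        rw [smul_apply, RingHom.id_apply, ENNReal.nnreal_smul_eq] }
  property := by
    refine ⟨lowerSemicontinuous_apply s, fun a => ?_⟩
    obtain ⟨x, -, hx, hxl, hxs⟩ := CuSemigroup.exists_seq s
    have h : {l : FunctionalCone S | (a : ℝ≥0∞) < l s} =
        ⋃ (n : ℕ) (q : {q : ℚ // a < Real.toNNReal q}),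
          {l : FunctionalCone S | ∀ t, SeqWayBelow (x n) t →
            ((Real.toNNReal q.1 : ℝ≥0) : ℝ≥0∞) ≤ l t} := by
      ext l
      simp only [mem_iUnion, mem_ofPred_eq]
      constructor
      · intro hl
        obtain ⟨q, -, hq, hq'⟩ := ENNReal.lt_iff_exists_rat_btwn.1 hl
        obtain ⟨s', hs', hl'⟩ := l.exists_lt_of_lt hq'
        obtain ⟨n, hn⟩ := hs' x s hx hxl le_rfl
        exact ⟨n, ⟨q, by exact_mod_cast hq⟩, fun t ht => hl'.le.trans (l.mono (hn.trans ht.le))⟩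
      · rintro ⟨n, q, hl⟩
        exact lt_of_lt_of_le (by exact_mod_cast q.2) (hl s (hxs n))
    change IsSigmaCompact {l : FunctionalCone S | (a : ℝ≥0∞) < l s}
    rw [h]
    exact isSigmaCompact_iUnion _ fun n => isSigmaCompact_iUnion_of_isCompact _ fun q =>
      isCompact_ge _ _

variable (S) in
/-- `hat` as a linear map. -/
noncomputable def hatLinear : S →ₗ[ℝ≥0] LscSigma (FunctionalCone S) where
  toFun := hat
  map_add' s t := Subtype.ext (LinearMap.ext fun l => l.map_add s t)
  map_smul' r s := Subtype.ext (LinearMap.ext fun l => by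
    rw [RingHom.id_apply, LscSigma.smul_apply]
    exact l.map_smul r s)

theorem hat_add (s t : S) : hat (s + t) = hat s + hat t := _root_.map_add (hatLinear S) s t

theorem hat_zero : hat (0 : S) = 0 := _root_.map_zero (hatLinear S)

theorem hat_smul (r : ℝ≥0) (s : S) : hat (r • s) = r • hat s := _root_.map_smul (hatLinear S) r s

/-- Hahn-Banach gives a monotone linear function separating `s'` from `t`. It need not preserve
suprema; its regularization does, and the passage from `s'` to `s` compensates the loss. -/
theorem hat_le_hat {s t : S} : hat s ≤ hat t ↔ s ≤ t := by
  refine ⟨fun h => CuSemigroup.le_of_forall_wayBelow fun s' hs' =>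
    CuCone.le_of_forall_le_smul fun r hr => ?_, fun h l => l.mono h⟩
  by_contra hn
  have hp : IsConePreorder (fun x y : S => x ≤ y) :=
    ⟨fun _ => le_rfl, fun _ _ _ => le_trans, fun _ _ _ h => add_le_add_left h _,
      fun _ _ _ _ h => CuCone.smul_mono le_rfl h, CuSemigroup.zero_le'⟩
  obtain ⟨f, hf, h1, h2⟩ := hp.exists_linear hr hn
  have hm : Monotone f := fun x y => hf x y
  have h3 : regularize f (_root_.map_zero f) (_root_.map_add f) hm s ≤
    regularize f (_root_.map_zero f) (_root_.map_add f) hm t := h _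
  exact absurd (h2.trans_le ((le_regularize hs').trans (h3.trans ((regularize_le t).trans h1))))
    (lt_irrefl _)

theorem isLUB_hat {x : ℕ → S} (hx : Monotone x) {s : S} (h : IsLUB (range x) s) :
    IsLUB (range fun n => hat (x n)) (hat s) :=
  (LscSigma.isLUB_iff fun _ _ h => hat_le_hat.2 (hx h)).2 fun l => l.isLUB hx h

/-- The closed set of `l` with `1 ≤ l v` for all `v` way above `s` is compact, contains `{l s > 1}`,
and lies in `{l t > 1}` because an intermediate `u` is below `r • t` with `r < 1`. -/
theorem hat_wayBelow {s t : S} (h : SeqWayBelow s t) : SeqWayBelow (hat s) (hat t) := by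
  obtain ⟨u, h1, h2⟩ := h.exists_between
  obtain ⟨r, hr0, hr1, hr⟩ := CuCone.exists_le_smul_of_wayBelow h2
  intro y z hy hyz hz
  have hcov : {l : FunctionalCone S | ∀ v, SeqWayBelow s v → 1 ≤ l v} ⊆
      ⋃ n, {l : FunctionalCone S | 1 < (y n).1 l} := by
    intro l hl
    have h3 : 1 < l t := by
      have h4 : (1 : ℝ≥0∞) ≤ r * l t := by
        rw [← l.map_smul]
        exact (hl u h1).trans (l.mono hr)
      by_contra! h5
      have h6 : (r : ℝ≥0∞) * l t ≤ r * 1 := by gcongr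
      rw [mul_one] at h6
      exact absurd (h4.trans h6) (by exact_mod_cast hr1.not_ge)
    have h4 : 1 < z.1 l := h3.trans_le (hz l)
    rw [(LscSigma.isLUB_iff hy).1 hyz l] at h4
    obtain ⟨n, hn⟩ := lt_iSup_iff.1 h4
    exact mem_iUnion.2 ⟨n, hn⟩
  obtain ⟨n, hn⟩ := (isCompact_ge s 1).elim_directed_cover _
    (fun n => (y n).2.1.isOpen_preimage 1) hcov
    (directed_of_isDirected_le fun m n h l (hl : 1 < _) => hl.trans_le (hy h l))
  refine ⟨n, LinearMap.le_of_forall_one_lt fun l hl => ?_⟩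
  have h3 : l ∈ {l : FunctionalCone S | ∀ v, SeqWayBelow s v → 1 ≤ l v} := fun v hv =>
    (show 1 < l s from hl).le.trans (l.mono hv.le)
  exact (show 1 < (y n).1 l from hn h3).le

/-- The preorder on pairs of functions given by moving an element of the Cu-cone from the first
component to the second. -/
theorem isConePreorder_transfer :
    IsConePreorder fun p q : LscSigma (FunctionalCone S) × LscSigma (FunctionalCone S) =>
      ∃ s : S, p.1 ≤ q.1 + hat s ∧ hat s + p.2 ≤ q.2 where
  refl p := ⟨0, by simp [hat_zero], by simp [hat_zero]⟩
  trans := by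
    rintro p q r ⟨s, h1, h2⟩ ⟨t, h3, h4⟩
    rw [LscSigma.le_iff] at h1 h2 h3 h4
    refine ⟨t + s, fun l => ?_, fun l => ?_⟩
    · change p.1.1 l ≤ (r.1 + hat (t + s)).1 l
      rw [hat_add, ← add_assoc]
      exact (h1 l).trans (add_le_add (h3 l) le_rfl)
    · change (hat (t + s) + p.2).1 l ≤ r.2.1 l
      rw [hat_add, add_assoc]
      exact (add_le_add le_rfl (h2 l)).trans (h4 l)
  add := by
    rintro p q r ⟨s, h1, h2⟩
    rw [LscSigma.le_iff] at h1 h2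
    refine ⟨s, fun l => ?_, fun l => ?_⟩
    · change (p.1 + r.1).1 l ≤ (q.1 + r.1 + hat s).1 l
      rw [add_right_comm]
      exact add_le_add (h1 l) le_rfl
    · change (hat s + (p.2 + r.2)).1 l ≤ (q.2 + r.2).1 l
      rw [← add_assoc]
      exact add_le_add (h2 l) le_rfl
  smul := by
    rintro t p q - ⟨s, h1, h2⟩
    rw [LscSigma.le_iff] at h1 h2
    refine ⟨t • s, fun l => ?_, fun l => ?_⟩
    · change (t • p.1).1 l ≤ (t • q.1 + hat (t • s)).1 l
      rw [hat_smul, ← smul_add, LscSigma.smul_apply, LscSigma.smul_apply]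
      exact mul_le_mul' le_rfl (h1 l)
    · change (hat (t • s) + t • p.2).1 l ≤ (t • q.2).1 l
      rw [hat_smul, ← smul_add, LscSigma.smul_apply, LscSigma.smul_apply]
      exact mul_le_mul' le_rfl (h2 l)
  nonneg p := ⟨0, fun l => bot_le, fun l => by
    change (hat (0 : S) + 0).1 l ≤ p.2.1 l
    rw [hat_zero, add_zero]
    exact bot_le⟩

/-- Otherwise the transfer pre-order separates `(a, 0)` from `(0, b)`. The components `f₁` and `f₂`
of the separating function satisfy `f₁ ≤ f₂` on `S`; regularized, they are evaluations at points `l`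
and `m` of `F(S)` with `l ≤ m`. Then `f₁ a ≤ b(l) ≤ b(m) ≤ f₂ b`, contradicting the separation. -/
theorem exists_between_smul (h5 : AxiomO5 S) (h6 : AxiomO6 S) (hI : HasAbundanceOfCompactIdeals S)
    {a b : LscSigma (FunctionalCone S)} (hab : SeqWayBelow a b) {r : ℝ≥0} (hr : 1 < r) :
    ∃ s : S, a ≤ hat s ∧ hat s ≤ r • b := by
  have := isExtendedChoquetCone h5 h6
  have hC := hasAbundanceOfCompactIdempotents hI
  have := LscSigma.cuCone hC
  by_contra! hcon
  obtain ⟨f, hf, h1, h2⟩ := (isConePreorder_transfer (S := S)).exists_linear (a := (a, 0))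
    (b := (0, b)) hr (by
      rintro ⟨s, h1, h2⟩
      refine hcon s ?_ ?_
      · simpa using h1
      · simpa using h2)
  let f₁ : LscSigma (FunctionalCone S) →ₗ[ℝ≥0] ℝ≥0∞ := f ∘ₗ LinearMap.inl ℝ≥0 _ _
  let f₂ : LscSigma (FunctionalCone S) →ₗ[ℝ≥0] ℝ≥0∞ := f ∘ₗ LinearMap.inr ℝ≥0 _ _
  have hm₁ : Monotone f₁ := fun x y h => hf _ _ ⟨0, by simpa [hat_zero] using h, by simp [hat_zero]⟩
  have hm₂ : Monotone f₂ := fun x y h => hf _ _ ⟨0, by simp [hat_zero], by simpa [hat_zero] using h⟩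
  have hle : ∀ s : S, f₁ (hat s) ≤ f₂ (hat s) := fun s => hf _ _ ⟨s, by simp, by simp⟩
  let g₁ := regularize f₁ (_root_.map_zero f₁) (_root_.map_add f₁) hm₁
  let g₂ := regularize f₂ (_root_.map_zero f₂) (_root_.map_add f₂) hm₂
  obtain ⟨l, hl⟩ := LscSigma.eval_surjective hC g₁
  obtain ⟨m, hm⟩ := LscSigma.eval_surjective hC g₂
  have hl' : ∀ h : LscSigma (FunctionalCone S), h.1 l = g₁ h := DFunLike.congr_fun hl
  have hm' : ∀ h : LscSigma (FunctionalCone S), h.1 m = g₂ h := DFunLike.congr_fun hm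
  have hlm : AlgLE l m := (algLE_iff h5).2 fun s => l.le_of_forall_wayBelow fun s' hs' => by
    calc l s' = g₁ (hat s') := hl' (hat s')
      _ ≤ f₁ (hat s') := regularize_le _
      _ ≤ f₂ (hat s') := hle s'
      _ ≤ g₂ (hat s) := le_regularize (hat_wayBelow hs')
      _ = m s := (hm' (hat s)).symm
  have h3 : f₁ a ≤ f₂ b := by
    calc f₁ a ≤ g₁ b := le_regularize hab
      _ = b.1 l := (hl' b).symm
      _ ≤ b.1 m := AlgLE.map hlm
      _ = g₂ b := hm' b
      _ ≤ f₂ b := regularize_le _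
  exact absurd (h2.trans_le (h3.trans h1)) (lt_irrefl _)

/-- The factor `r` is absorbed by an intermediate element between `a` and `b`, so a rapidly
increasing sequence to `f` interlaces with an increasing sequence from `S`, whose supremum
represents `f`. -/
theorem hat_surjective (h5 : AxiomO5 S) (h6 : AxiomO6 S) (hI : HasAbundanceOfCompactIdeals S) :
    Function.Surjective (hat : S → LscSigma (FunctionalCone S)) := by
  have := isExtendedChoquetCone h5 h6
  have := LscSigma.cuCone (hasAbundanceOfCompactIdempotents hI)
  have key : ∀ {a b : LscSigma (FunctionalCone S)}, SeqWayBelow a b →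
      ∃ s : S, a ≤ hat s ∧ hat s ≤ b := by
    intro a b hab
    obtain ⟨c, h1, h2⟩ := hab.exists_between
    obtain ⟨r, hr0, hr1, hr⟩ := CuCone.exists_le_smul_of_wayBelow h2
    obtain ⟨s, h3, h4⟩ := exists_between_smul h5 h6 hI h1 ((one_lt_inv₀ hr0).2 hr1)
    refine ⟨s, h3, h4.trans ?_⟩
    have := CuCone.smul_mono (le_refl r⁻¹) hr
    rwa [smul_smul, inv_mul_cancel₀ hr0.ne', one_smul] at this
  intro f
  obtain ⟨c, hc, hcm, hcf, -⟩ := CuSemigroup.exists_seq f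
  choose s hs1 hs2 using fun n => key (hc n)
  have hs : Monotone s := monotone_nat_of_le_succ fun n =>
    hat_le_hat.1 ((hs2 n).trans (hs1 (n + 1)))
  obtain ⟨t, ht⟩ := CuSemigroup.o1 s hs
  refine ⟨t, (isLUB_hat hs ht).unique ⟨?_, fun g hg => hcf.2 ?_⟩⟩
  · rintro _ ⟨n, rfl⟩
    exact (hs2 n).trans (hcf.1 ⟨n + 1, rfl⟩)
  · rintro _ ⟨n, rfl⟩
    exact (hs1 n).trans (hg ⟨n, rfl⟩)

end FunctionalCone

theorem mainTheorem2 :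
    (∀ (S : Type u) [AddCommMonoid S] [PartialOrder S] [Module ℝ≥0 S] [CuCone S],
      AxiomO5 S → AxiomO6 S → HasAbundanceOfCompactIdeals S →
        IsExtendedChoquetCone (FunctionalCone S) ∧
        HasAbundanceOfCompactIdempotents (FunctionalCone S) ∧
        ∃ e : S ≃ₗ[ℝ≥0] LscSigma (FunctionalCone S),
          (∀ (s : S) (l : FunctionalCone S), (e s).1 l = l s) ∧
          ∀ s t : S, e s ≤ e t ↔ s ≤ t) ∧
    (∀ (C : Type v) [AddCommMonoid C] [Module ℝ≥0 C] [TopologicalSpace C]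
      [IsExtendedChoquetCone C],
      HasAbundanceOfCompactIdempotents C →
        CuCone (LscSigma C) ∧ AxiomO5 (LscSigma C) ∧ AxiomO6 (LscSigma C) ∧
        HasAbundanceOfCompactIdeals (LscSigma C) ∧
        ∃ e : C ≃L[ℝ≥0] FunctionalCone (LscSigma C),
          ∀ (x : C) (f : LscSigma C), e x f = f.1 x) := by
  refine ⟨fun S _ _ _ _ h5 h6 hI => ?_, fun C _ _ _ _ hC => ?_⟩
  · exact ⟨FunctionalCone.isExtendedChoquetCone h5 h6,
      FunctionalCone.hasAbundanceOfCompactIdempotents hI,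
      LinearEquiv.ofBijective (FunctionalCone.hatLinear S)
        ⟨fun s t h => le_antisymm (FunctionalCone.hat_le_hat.1 (le_of_eq h))
          (FunctionalCone.hat_le_hat.1 (le_of_eq h.symm)), FunctionalCone.hat_surjective h5 h6 hI⟩,
      fun _ _ => rfl, fun _ _ => FunctionalCone.hat_le_hat⟩
  · exact ⟨LscSigma.cuCone hC, LscSigma.axiomO5 hC, LscSigma.axiomO6 hC,
      LscSigma.hasAbundanceOfCompactIdeals hC, LscSigma.evalEquiv hC, fun _ _ => rfl⟩
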